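/- Let $m>0$, $\lambda>0$, $\epsilon>0$, $n\in\mathbb N$, and let $M=\mathbb R\times\mathbb R^3\ni x=(t,\mathbf x)$ be Minkowski spacetime, $\Sigma_{0,\epsilon}=\{(t,\mathbf x)\in M: -\epsilon<t<\epsilon\}$. *Propagators.* Let $G_\lambda(x)=(\sqrt{2\pi}\lambda)^{-4}e^{-(t^2+|\mathbf x|^2)/(2\lambda^2)}$, $\omega(\mathbf p)=\sqrt{|\mathbf p|^2+m^2}$, and let $\Delta_+(x)=(2\pi)^{-3}\int_{\mathbb R^3}\frac{d\mathbf p}{2\omega(\mathbf p)}e^{-i(\omega(\mathbf p)t-\mathbf p\cdot\mathbf x)}$ be the vacuum two-point distribution of the free field of mass $m$. Put $$\Delta_{+,\lambda}(x)=\int_{M^2}dy\,dz\,G_\lambda(x-y)\Delta_+(y-z)G_\lambda(z),\qquad \Delta_{F,\lambda}(x)=\theta(t)\Delta_{+,\lambda}(x)+\theta(-t)\Delta_{+,\lambda}(-x);$$ both are continuous functions on $M$. *Observables.* Functionals are maps $F:\mathcal C\to\mathbb C$ on the real vector space $\mathcal C=C^\infty(M;\mathbb R)\cap\mathcal S'(M)$.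 For $O\subset M$ open, $\mathcal A(O)$ is the set of finite sums of functionals $A(\phi)=\int_{M^\ell}f(x_1,\dots,x_\ell)\,\phi(x_1)^{n_1}\cdots\phi(x_\ell)^{n_\ell}\,dx_1\cdots dx_\ell$ with $\ell\ge1$, $n_i\in\mathbb N$ and $f:M^\ell\to\mathbb C$ continuous with compact support contained in $O^\ell$; $\mathcal A=\mathcal A(M)$. For $H\in\{\Delta_{+,\lambda},\Delta_{F,\lambda}\}$ and $F,G\in\mathcal A$ let $$(F\star_H G)(\phi)=\sum_{r\ge0}\frac1{r!}\int F^{(r)}(\phi)(x_1,\dots,x_r)\prod_{i=1}^rH(x_i-y_i)\,G^{(r)}(\phi)(y_1,\dots,y_r)\,dx_1dy_1\cdots dx_rdy_r,$$ where $F^{(r)}(\phi)$ denotes the $r$-th functional derivative (a compactly supported distribution of order $0$ on $M^r$). Write $\star_\lambda=\star_{\Delta_{+,\lambda}}$ and $\cdot_{T_\lambda}=\star_{\Delta_{F,\lambda}}$. Let $\omega_\lambda(F)=F(0)$ be the free vacuum state. *Interaction.* For a functional $V$ let $S(V)=\sum_{k\ge0}\frac{(-i)^k}{k!}V^{\cdot_{T_\lambda}k}$,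 a formal power series graded by the number $k$ of factors $V$, let $S(V)^{-1}$ be its inverse formal power series with respect to $\star_\lambda$, and let $R_V(A)=S(V)^{-1}\star_\lambda\bigl(S(V)\cdot_{T_\lambda}A\bigr)$, with order-$k$ coefficient $R_V(A)^{[k]}$. Fix a smooth $\chi:\mathbb R\to\mathbb R$ with $\chi=1$ on $(-\epsilon,\epsilon)$ and $\chi=0$ outside $(-2\epsilon,2\epsilon)$, and for $h\in C_0^\infty(\mathbb R^3;\mathbb R)$ let $V_{\chi,h}(\phi)=\int_M\chi(t)h(\mathbf x)\phi(t,\mathbf x)^n\,dt\,d\mathbf x$. **Theorem.** Let $O\subset\Sigma_{0,\epsilon}$ be a bounded open set, $A\in\mathcal A(O)$ and $k\in\mathbb N$. Then the limit $$\omega_\lambda^{[k]}(A)=\lim_{h\to1}\omega_\lambda\bigl(R_{V_{\chi,h}}(A)^{[k]}\bigr)$$ exists and is finite: there is $L\in\mathbb C$ such that $\omega_\lambda\bigl(R_{V_{\chi,h_j}}(A)^{[k]}\bigr)\to L$ as $j\to\infty$ for every sequence $(h_j)$ in $C_0^\infty(\mathbb R^3;\mathbb R)$ that is uniformly bounded and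 converges pointwise to $1$. -/

import Mathlib

open MeasureTheory Filter Topology SchwartzMap
open scoped ContDiff

noncomputable section

namespace QST

/-! ### Spacetime and field configurations -/

/-- Physical space `ℝ³`. -/
abbrev Space : Type := EuclideanSpace ℝ (Fin 3)

/-- Minkowski spacetime `M = ℝ × ℝ³`; a point is `x = (t, 𝐱)`. Only its vector space structure,
its topology, its smooth structure and Lebesgue measure are used. -/
abbrev Spacetime : Type := ℝ × Space

/-- The time slab `Σ_{0,ε} = {x | t(x) ∈ (-ε, ε)}`. -/
def timeSlab (ε : ℝ) : Set Spacetime := {x | x.1 ∈ Set.Ioo (-ε) ε}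

/-- The real vector space `𝒞 = C^∞(M; ℝ) ∩ 𝒮'(M)` of field configurations: smooth functions whose
distribution extends continuously to Schwartz functions. -/
def FieldConfig : Submodule ℝ (Spacetime → ℝ) where
  carrier := {φ | ContDiff ℝ ∞ φ ∧ ∃ T : 𝓢(Spacetime, ℝ) →L[ℝ] ℝ,
    ∀ f : 𝓢(Spacetime, ℝ), HasCompactSupport f → T f = ∫ x, f x * φ x}
  zero_mem' := ⟨contDiff_const, 0, fun f _ => by simp⟩
  add_mem' := by
    rintro a b ⟨ha, T, hT⟩ ⟨hb, S, hS⟩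
    refine ⟨ha.add hb, T + S, fun f hf => ?_⟩
    have h1 : Integrable (fun x => f x * a x) :=
      (f.continuous.mul ha.continuous).integrable_of_hasCompactSupport hf.mul_right
    have h2 : Integrable (fun x => f x * b x) :=
      (f.continuous.mul hb.continuous).integrable_of_hasCompactSupport hf.mul_right
    simp only [add_apply, hT f hf, hS f hf, Pi.add_apply, mul_add]
    rw [integral_add h1 h2]
  smul_mem' := by
    rintro c a ⟨ha, T, hT⟩
    refine ⟨contDiff_const.smul ha, c • T, fun f hf => ?_⟩
    have h : ∀ x, f x * (c • a) x = c * (f x * a x) := fun x => by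
      simp only [Pi.smul_apply, smul_eq_mul]; ring
    simp only [smul_apply, hT f hf, smul_eq_mul, h]
    rw [integral_const_mul]

theorem fieldConfig_continuous (φ : FieldConfig) : Continuous (φ : Spacetime → ℝ) :=
  φ.2.1.continuous

/-- Complex valued functionals on field configurations. Sums, scalar multiples and the unit `1` are
pointwise. -/
abbrev Functional : Type := FieldConfig → ℂ

/-! ### Functional derivatives and the exponential products -/

/-- Directional derivative `φ ↦ (d/ds) F(φ + sψ)` at `s = 0`. -/
def dirDeriv (ψ : FieldConfig) (F : Functional) : Functional :=
  fun φ => deriv (fun s : ℝ => F (φ + s • ψ)) 0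

/-- Iterated directional derivative along `ψ 0, …, ψ (n-1)`. -/
def iterDirDeriv : (n : ℕ) → (Fin n → FieldConfig) → Functional → Functional
  | 0, _, F => F
  | n + 1, ψ, F => dirDeriv (ψ 0) (iterDirDeriv n (Fin.tail ψ) F)

/-- The product function `(x₁, …, xₙ) ↦ ψ₁(x₁) ⋯ ψₙ(xₙ)` on `Mⁿ`. -/
def tensorConfig {n : ℕ} (ψ : Fin n → FieldConfig) : C(Fin n → Spacetime, ℂ) where
  toFun X := ∏ i, ((ψ i : Spacetime → ℝ) (X i) : ℂ)
  continuous_toFun := by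
    refine continuous_finsetProd _ fun i _ => ?_
    exact Complex.continuous_ofReal.comp ((fieldConfig_continuous (ψ i)).comp (continuous_apply i))

/-- `u` is the `n`-th functional derivative `F⁽ⁿ⁾(φ)`. The derivatives of the functionals
considered here are compactly supported distributions of order zero on `Mⁿ` (compactly supported
complex Radon measures), i.e. continuous linear forms on `C(Mⁿ, ℂ)` with the topology of locally
uniform convergence. Such a form is determined by its values on product functions. -/
def IsFunctionalDeriv (F : Functional) (n : ℕ) (φ : FieldConfig)
    (u : C(Fin n → Spacetime, ℂ) →L[ℂ] ℂ) : Prop :=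
  ∀ ψ : Fin n → FieldConfig, u (tensorConfig ψ) = iterDirDeriv n ψ F φ

open Classical in
/-- The `n`-th functional derivative `F⁽ⁿ⁾(φ)` (zero if there is none of order zero). -/
def functionalDeriv (F : Functional) (n : ℕ) (φ : FieldConfig) :
    C(Fin n → Spacetime, ℂ) →L[ℂ] ℂ :=
  if h : ∃ u, IsFunctionalDeriv F n φ u then h.choose else 0

/-- The kernel `H(x₁ - y₁) ⋯ H(xₙ - yₙ)` on `Mⁿ × Mⁿ`. -/
def kernelPower (H : C(Spacetime, ℂ)) (n : ℕ) :
    C((Fin n → Spacetime) × (Fin n → Spacetime), ℂ) where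
  toFun Z := ∏ i, H (Z.1 i - Z.2 i)
  continuous_toFun := by fun_prop

/-- `⟨u ⊗ v, K⟩ = ∫∫ K(X, Y) du(X) dv(Y)`. -/
def tensorPairing {n : ℕ} (u v : C(Fin n → Spacetime, ℂ) →L[ℂ] ℂ)
    (K : C((Fin n → Spacetime) × (Fin n → Spacetime), ℂ)) : ℂ :=
  u ((ContinuousMap.mk v v.continuous).comp K.curry)

/-- The product `F ⋆_H G = m ∘ exp(Γ_H) (F ⊗ G)` with
`Γ_H = ∫ dx dy H(x - y) δ/δφ(x) ⊗ δ/δφ(y)`. For polynomial functionals the sum is finite. -/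
def expProd (H : C(Spacetime, ℂ)) (F G : Functional) : Functional :=
  fun φ => ∑' n : ℕ, (1 / (n.factorial : ℂ)) *
    tensorPairing (functionalDeriv F n φ) (functionalDeriv G n φ) (kernelPower H n)

/-! ### The propagators -/

/-- The Gaussian `G_l(x) = exp(-⟨x⟩² / (2 l²)) / (√(2π) l)⁴`, with `⟨x⟩² = t² + |𝐱|²`. -/
def gaussKernel (l : ℝ) (x : Spacetime) : ℝ :=
  Real.exp (-(x.1 ^ 2 + ‖x.2‖ ^ 2) / (2 * l ^ 2)) / (√(2 * Real.pi) * l) ^ 4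

/-- The energy `ω(𝐩) = √(|𝐩|² + m²)`. -/
def energy (m : ℝ) (p : Space) : ℝ := √(‖p‖ ^ 2 + m ^ 2)

/-- The plane wave `exp(-i (ω(𝐩) t - 𝐩·𝐱))`. -/
def planeWave (m : ℝ) (p : Space) (x : Spacetime) : ℂ :=
  Complex.exp (-Complex.I * ((energy m p * x.1 - inner ℝ p x.2 : ℝ) : ℂ))

/-- The vacuum two-point distribution `Δ₊` of the free field of mass `m`, that is
`Δ₊(x) = (2π)⁻³ ∫ d𝐩 / (2ω(𝐩)) exp(-i (ω(𝐩) t - 𝐩·𝐱))`, applied to a test function. -/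
def twoPointDistribution (m : ℝ) (f : Spacetime → ℂ) : ℂ :=
  (1 / (2 * Real.pi : ℂ) ^ 3) *
    ∫ p : Space, (1 / (2 * energy m p : ℂ)) * ∫ x : Spacetime, f x * planeWave m p x

/-- The modified two-point function
`Δ_{+,l}(x) = ∫∫ dy dz G_l(x - y) Δ₊(y - z) G_l(z)`, i.e. with `u = y - z`, the distribution `Δ₊`
applied to `u ↦ ∫ dz G_l(x - u - z) G_l(z)`. -/
def modTwoPointFun (m l : ℝ) (x : Spacetime) : ℂ :=
  twoPointDistribution m fun u => ((∫ z : Spacetime,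
    gaussKernel l (x - u - z) * gaussKernel l z : ℝ) : ℂ)

/-- The modified Feynman propagator
`Δ_{F,l}(x) = θ(t) Δ_{+,l}(x) + θ(-t) Δ_{+,l}(-x)`; the two branches agree at `t = 0`. -/
def modFeynmanFun (m l : ℝ) (x : Spacetime) : ℂ :=
  if 0 ≤ x.1 then modTwoPointFun m l x else modTwoPointFun m l (-x)

/-! ### Continuity of the propagators -/

theorem energy_pos {m : ℝ} (hm : 0 < m) (p : Space) : 0 < energy m p := by
  unfold energy; positivity

theorem gaussKernel_eq (l : ℝ) (x : Spacetime) :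
    gaussKernel l x = (1 / (√(2 * Real.pi) * l) ^ 4) *
      (Real.exp (-(1 / (2 * l ^ 2)) * x.1 ^ 2) * Real.exp (-(1 / (2 * l ^ 2)) * ‖x.2‖ ^ 2)) := by
  unfold gaussKernel
  rw [← Real.exp_add]
  ring_nf

/-- Fourier transform of `G_l`. -/
theorem gaussKernel_fourier {l : ℝ} (hl : 0 < l) (s : ℝ) (q : Space) :
    Integrable (fun x : Spacetime => (gaussKernel l x : ℂ) *
      Complex.exp (-Complex.I * ((s * x.1 - inner ℝ q x.2 : ℝ) : ℂ))) ∧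
    ∫ x : Spacetime, (gaussKernel l x : ℂ) *
      Complex.exp (-Complex.I * ((s * x.1 - inner ℝ q x.2 : ℝ) : ℂ)) =
    ((Real.exp (-(l ^ 2 * (s ^ 2 + ‖q‖ ^ 2) / 2)) : ℝ) : ℂ) := by
  set b : ℝ := 1 / (2 * l ^ 2) with hbdef
  have hb0 : 0 < b := by positivity
  have hb : 0 < (b : ℂ).re := by simpa using hb0
  have key : ∀ x : Spacetime, (gaussKernel l x : ℂ) *
      Complex.exp (-Complex.I * ((s * x.1 - inner ℝ q x.2 : ℝ) : ℂ)) =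
      (Complex.exp (-(b : ℂ) * (‖x.1‖ : ℂ) ^ 2 + (-Complex.I) * (inner ℝ s x.1 : ℝ))) *
      (((1 / (√(2 * Real.pi) * l) ^ 4 : ℝ) : ℂ) *
        Complex.exp (-(b : ℂ) * (‖x.2‖ : ℂ) ^ 2 + Complex.I * (inner ℝ q x.2 : ℝ))) := by
    intro x
    rw [gaussKernel_eq, ← hbdef]
    have h1 : ((‖x.1‖ : ℝ) : ℂ) ^ 2 = ((x.1 : ℝ) : ℂ) ^ 2 := by
      rw [← Complex.ofReal_pow, ← Complex.ofReal_pow, Real.norm_eq_abs, sq_abs]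
    have h2 : (inner ℝ s x.1 : ℝ) = x.1 * s := rfl
    rw [h1, h2]
    push_cast
    rw [mul_left_comm (Complex.exp _), ← Complex.exp_add, ← Complex.exp_add, mul_assoc,
      ← Complex.exp_add]
    ring_nf
  have hi1 := GaussianFourier.integrable_cexp_neg_mul_sq_norm_add (V := ℝ) hb (-Complex.I) s
  have hi2 := GaussianFourier.integrable_cexp_neg_mul_sq_norm_add (V := Space) hb Complex.I q
  simp_rw [key]
  refine ⟨hi1.mul_prod (hi2.const_mul _), ?_⟩
  have hprod := integral_prod_mul (μ := (volume : Measure ℝ)) (ν := (volume : Measure Space))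
    (fun t : ℝ => Complex.exp (-(b : ℂ) * (‖t‖ : ℂ) ^ 2 + (-Complex.I) * (inner ℝ s t : ℝ)))
    (fun y : Space => ((1 / (√(2 * Real.pi) * l) ^ 4 : ℝ) : ℂ) *
        Complex.exp (-(b : ℂ) * (‖y‖ : ℂ) ^ 2 + Complex.I * (inner ℝ q y : ℝ)))
  refine hprod.trans ?_
  rw [integral_const_mul, GaussianFourier.integral_cexp_neg_mul_sq_norm_add hb,
    GaussianFourier.integral_cexp_neg_mul_sq_norm_add hb]
  have hpb : (0 : ℝ) ≤ Real.pi / b := by positivity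
  have e1 : ((Real.pi : ℂ) / (b : ℂ)) ^ ((Module.finrank ℝ ℝ : ℂ) / 2) *
      ((Real.pi : ℂ) / (b : ℂ)) ^ ((Module.finrank ℝ Space : ℂ) / 2) =
      (((√(2 * Real.pi) * l) ^ 4 : ℝ) : ℂ) := by
    have hne : ((Real.pi : ℂ) / (b : ℂ)) ≠ 0 := by
      rw [← Complex.ofReal_div]; exact_mod_cast (by positivity : Real.pi / b ≠ 0)
    rw [← Complex.cpow_add _ _ hne]
    have h4 : ((Module.finrank ℝ ℝ : ℂ) / 2 + (Module.finrank ℝ Space : ℂ) / 2) = (2 : ℕ) := by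
      simp; norm_num
    rw [h4, Complex.cpow_natCast, ← Complex.ofReal_div, ← Complex.ofReal_pow]
    congr 1
    rw [mul_pow, show (4 : ℕ) = 2 * 2 by norm_num, pow_mul, Real.sq_sqrt (by positivity), hbdef]
    field_simp
  have hc : (((√(2 * Real.pi) * l) ^ 4 : ℝ) : ℂ) ≠ 0 := by
    exact_mod_cast (by positivity : (√(2 * Real.pi) * l) ^ 4 ≠ 0)
  calc _ = (((Real.pi : ℂ) / (b : ℂ)) ^ ((Module.finrank ℝ ℝ : ℂ) / 2) *
        ((Real.pi : ℂ) / (b : ℂ)) ^ ((Module.finrank ℝ Space : ℂ) / 2)) *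
        ((1 / (√(2 * Real.pi) * l) ^ 4 : ℝ) : ℂ) *
        (Complex.exp ((-Complex.I) ^ 2 * (‖s‖ : ℂ) ^ 2 / (4 * b)) *
         Complex.exp (Complex.I ^ 2 * (‖q‖ : ℂ) ^ 2 / (4 * b))) := by ring
    _ = _ := by
      rw [e1, ← Complex.exp_add, ← Complex.ofReal_mul,
        mul_one_div_cancel (by exact_mod_cast hc), Complex.ofReal_one, one_mul, Complex.ofReal_exp]
      congr 1
      have h1 : ((‖s‖ : ℝ) : ℂ) ^ 2 = ((s : ℝ) : ℂ) ^ 2 := by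
        rw [← Complex.ofReal_pow, ← Complex.ofReal_pow, Real.norm_eq_abs, sq_abs]
      have hl0 : (l : ℂ) ≠ 0 := by exact_mod_cast hl.ne'
      rw [h1, neg_sq, Complex.I_sq, hbdef]
      push_cast
      field_simp
      ring

/-- Momentum space formula for the modified two-point function. -/
theorem modTwoPointFun_eq (m : ℝ) {l : ℝ} (hl : 0 < l) (x : Spacetime) :
    modTwoPointFun m l x = (1 / (2 * Real.pi : ℂ) ^ 3) *
      ∫ p : Space, (1 / (2 * energy m p : ℂ)) *
        (((Real.exp (-(l ^ 2 * (2 * ‖p‖ ^ 2 + m ^ 2))) : ℝ) : ℂ) * planeWave m p x) := by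
  have : (volume : Measure Spacetime).IsAddHaarMeasure :=
    Measure.prod.instIsAddHaarMeasure volume volume
  unfold modTwoPointFun twoPointDistribution
  congr 2
  ext p
  congr 1
  have hEsq : energy m p ^ 2 = ‖p‖ ^ 2 + m ^ 2 := Real.sq_sqrt (by positivity)
  have hpw : ∀ v w : Spacetime, planeWave m p (v + w) = planeWave m p v * planeWave m p w := by
    intro v w
    simp only [planeWave, ← Complex.exp_add, Prod.fst_add, Prod.snd_add, inner_add_right]
    congr 1; push_cast; ring
  obtain ⟨hgi, hg⟩ := gaussKernel_fourier hl (energy m p) p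
  change Integrable (fun y : Spacetime => (gaussKernel l y : ℂ) * planeWave m p y) at hgi
  change ∫ y : Spacetime, (gaussKernel l y : ℂ) * planeWave m p y = _ at hg
  set F : Spacetime → ℂ := fun y => (gaussKernel l y : ℂ) * planeWave m p y with hF
  have hsym : ∀ w : Spacetime, gaussKernel l (-w) = gaussKernel l w := by
    intro w; simp [gaussKernel]
  have hrw : ∀ u : Spacetime, ((∫ z : Spacetime,
      gaussKernel l (x - u - z) * gaussKernel l z : ℝ) : ℂ) * planeWave m p u =
      planeWave m p x * ∫ z : Spacetime, F (u - x + z) * F (-z) := by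
    intro u
    rw [← integral_complex_ofReal, mul_comm, ← integral_const_mul, ← integral_const_mul]
    congr 1
    ext z
    have h1 : gaussKernel l (x - u - z) = gaussKernel l (u - x + z) := by
      rw [← hsym]; congr 1; abel
    have h2 : planeWave m p u =
        planeWave m p x * (planeWave m p (u - x + z) * planeWave m p (-z)) := by
      rw [← hpw, ← hpw]; congr 1; abel
    simp only [hF, h1, hsym z, h2]
    push_cast; ring
  simp_rw [hrw]
  rw [integral_const_mul, mul_comm]
  congr 1
  have hconv : ∫ v : Spacetime, ∫ z : Spacetime, F z * F (v - z) =
      (∫ v, F v) * ∫ v, F v := by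
    have := integral_convolution (L := ContinuousLinearMap.mul ℂ ℂ) (μ := volume) (ν := volume)
      hgi hgi
    simpa [convolution_def] using this
  calc ∫ u : Spacetime, ∫ z : Spacetime, F (u - x + z) * F (-z)
      = ∫ v : Spacetime, ∫ z : Spacetime, F (v + z) * F (-z) :=
        integral_sub_right_eq_self (fun v => ∫ z : Spacetime, F (v + z) * F (-z)) x
    _ = ∫ v : Spacetime, ∫ z : Spacetime, F z * F (v - z) := by
        congr 1; ext v
        rw [← integral_neg_eq_self (fun z => F z * F (v - z))]
        congr 1; ext z; rw [sub_neg_eq_add, mul_comm]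
    _ = _ := by
        rw [hconv, hg, ← Complex.ofReal_mul, ← Real.exp_add, hEsq]
        congr 2; ring

theorem norm_planeWave (m : ℝ) (p : Space) (x : Spacetime) : ‖planeWave m p x‖ = 1 := by
  unfold planeWave
  rw [Complex.norm_exp]
  simp

theorem continuous_modTwoPointFun {m l : ℝ} (hm : 0 < m) (hl : 0 < l) :
    Continuous (modTwoPointFun m l) := by
  have hE : Continuous (energy m) := by unfold energy; fun_prop
  have hEne : ∀ p, (2 * energy m p : ℂ) ≠ 0 := fun p => by
    have := (energy_pos hm p).ne'
    simpa using this
  have hJ₁ : ∀ x : Spacetime, Continuous fun p : Space => (1 / (2 * energy m p : ℂ)) *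
      (((Real.exp (-(l ^ 2 * (2 * ‖p‖ ^ 2 + m ^ 2))) : ℝ) : ℂ) * planeWave m p x) := by
    intro x
    have h1 : Continuous fun p : Space => (1 / (2 * energy m p : ℂ)) :=
      continuous_const.div (by fun_prop) hEne
    have h2 : Continuous fun p : Space =>
        ((Real.exp (-(l ^ 2 * (2 * ‖p‖ ^ 2 + m ^ 2))) : ℝ) : ℂ) := by fun_prop
    have h3 : Continuous fun p : Space => planeWave m p x := by unfold planeWave; fun_prop
    exact h1.mul (h2.mul h3)
  have hJ₂ : ∀ p : Space, Continuous fun x : Spacetime => (1 / (2 * energy m p : ℂ)) *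
      (((Real.exp (-(l ^ 2 * (2 * ‖p‖ ^ 2 + m ^ 2))) : ℝ) : ℂ) * planeWave m p x) := by
    intro p
    have h3 : Continuous fun x : Spacetime => planeWave m p x := by unfold planeWave; fun_prop
    exact continuous_const.mul (continuous_const.mul h3)
  have hfun := funext (modTwoPointFun_eq m hl)
  rw [hfun]
  refine continuous_const.mul ?_
  refine continuous_of_dominated
    (bound := fun p : Space => 1 / (2 * m) * Real.exp (-(2 * l ^ 2) * ‖p‖ ^ 2)) ?_ ?_ ?_ ?_
  · exact fun x => (hJ₁ x).aestronglyMeasurable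
  · intro x
    refine Eventually.of_forall fun p => ?_
    have hEm : m ≤ energy m p := Real.le_sqrt_of_sq_le (by nlinarith [sq_nonneg ‖p‖])
    have hEp := energy_pos hm p
    have h1 : ‖(1 / (2 * energy m p : ℂ))‖ ≤ 1 / (2 * m) := by
      rw [norm_div, norm_one, norm_mul, Complex.norm_real, Real.norm_of_nonneg hEp.le,
        Complex.norm_ofNat]
      exact one_div_le_one_div_of_le (by positivity) (by linarith)
    have h2 : ‖((Real.exp (-(l ^ 2 * (2 * ‖p‖ ^ 2 + m ^ 2))) : ℝ) : ℂ) * planeWave m p x‖ ≤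
        Real.exp (-(2 * l ^ 2) * ‖p‖ ^ 2) := by
      rw [norm_mul, norm_planeWave, mul_one, Complex.norm_real, Real.norm_eq_abs, Real.abs_exp]
      refine Real.exp_le_exp.mpr ?_
      nlinarith [sq_nonneg (l * m)]
    rw [norm_mul]
    exact mul_le_mul h1 h2 (norm_nonneg _) (by positivity)
  · refine Integrable.const_mul ?_ _
    have h := GaussianFourier.integrable_cexp_neg_mul_sq_norm_add (V := Space)
      (b := ((2 * l ^ 2 : ℝ) : ℂ)) (by rw [Complex.ofReal_re]; positivity) 0 0
    refine h.norm.congr (Eventually.of_forall fun p => ?_)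
    simp only [zero_mul, add_zero]
    rw [← Complex.ofReal_neg, ← Complex.ofReal_pow, ← Complex.ofReal_mul, Complex.norm_exp,
      Complex.ofReal_re]
  · exact Eventually.of_forall hJ₂

theorem modTwoPointFun_neg_of_time_zero (m : ℝ) {l : ℝ} (hl : 0 < l) (x : Spacetime)
    (hx : x.1 = 0) : modTwoPointFun m l (-x) = modTwoPointFun m l x := by
  rw [modTwoPointFun_eq m hl, modTwoPointFun_eq m hl]
  congr 1
  rw [← integral_neg_eq_self]
  congr 1; ext p
  simp [energy, planeWave, hx]

theorem continuous_modFeynmanFun {m l : ℝ} (hm : 0 < m) (hl : 0 < l) :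
    Continuous (modFeynmanFun m l) := by
  have h := continuous_modTwoPointFun hm hl
  unfold modFeynmanFun
  refine Continuous.if_le h (h.comp continuous_neg) continuous_const continuous_fst ?_
  intro x hx
  exact (modTwoPointFun_neg_of_time_zero m hl x hx.symm).symm

/-- `Δ_{+,l}` as a continuous function. -/
def modTwoPoint {m l : ℝ} (hm : 0 < m) (hl : 0 < l) : C(Spacetime, ℂ) :=
  ⟨modTwoPointFun m l, continuous_modTwoPointFun hm hl⟩

/-- `Δ_{F,l}` as a continuous function. -/
def modFeynman {m l : ℝ} (hm : 0 < m) (hl : 0 < l) : C(Spacetime, ℂ) :=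
  ⟨modFeynmanFun m l, continuous_modFeynmanFun hm hl⟩

/-- The product `⋆_l` of normal ordered observables, given by `Δ_{+,l}`. -/
def starProd {m l : ℝ} (hm : 0 < m) (hl : 0 < l) : Functional → Functional → Functional :=
  expProd (modTwoPoint hm hl)

/-- The time ordered product `·_{T_l}`, given by `Δ_{F,l}`. -/
def timeProd {m l : ℝ} (hm : 0 < m) (hl : 0 < l) : Functional → Functional → Functional :=
  expProd (modFeynman hm hl)

/-! ### Observables -/

/-- `A(φ) = ∫ dx₁ ⋯ dx_ℓ f(x₁, …, x_ℓ) φ(x₁)^{N₁} ⋯ φ(x_ℓ)^{N_ℓ}`. -/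
def multilocal {ℓ : ℕ} (f : (Fin ℓ → Spacetime) → ℂ) (N : Fin ℓ → ℕ) : Functional :=
  fun φ => ∫ X : Fin ℓ → Spacetime, f X * ∏ i, ((φ : Spacetime → ℝ) (X i) : ℂ) ^ N i

/-- `𝒜(O)`: finite sums of multilocal functionals with continuous `f` compactly supported
in `O^ℓ`. -/
def observables (O : Set Spacetime) : Submodule ℂ Functional :=
  Submodule.span ℂ {A | ∃ (ℓ : ℕ) (f : (Fin ℓ → Spacetime) → ℂ) (N : Fin ℓ → ℕ),
    0 < ℓ ∧ Continuous f ∧ HasCompactSupport f ∧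
    (tsupport f ⊆ {X | ∀ i, X i ∈ O}) ∧ A = multilocal f N}

/-- The interaction `V_g(φ) = ∫ g(x) φ(x)ⁿ dx`. -/
def interaction (n : ℕ) (g : Spacetime → ℝ) : Functional :=
  fun φ => ∫ x : Spacetime, (g x : ℂ) * ((φ : Spacetime → ℝ) x : ℂ) ^ n

/-- The vacuum state `ω(F) = F(0)`. -/
def vacuum (F : Functional) : ℂ := F 0

/-! ### The S matrix and the Bogoliubov map, order by order -/

section Series

variable {m l : ℝ} (hm : 0 < m) (hl : 0 < l)

/-- `V ·_T ⋯ ·_T V` (`k` factors). -/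
def timePow (V : Functional) : ℕ → Functional
  | 0 => 1
  | k + 1 => timeProd hm hl (timePow V k) V

/-- The order `k` coefficient `((-i)^k / k!) V ·_T ⋯ ·_T V` of the S matrix `S(V)`. -/
def sMatrix (V : Functional) (k : ℕ) : Functional :=
  ((-Complex.I) ^ k / (k.factorial : ℂ)) • timePow hm hl V k

/-- The order `k` coefficient of `S(V)⁻¹`, the `⋆`-inverse formal power series: it is fixed by
`∑_{i+j=k} (S(V)⁻¹)_i ⋆ S(V)_j = δ_{k,0}`, since `S(V)_0 = 1`. -/
def sMatrixInv (V : Functional) : ℕ → Functional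
  | 0 => 1
  | k + 1 => -∑ j : Fin (k + 1), starProd hm hl (sMatrixInv V j) (sMatrix hm hl V (k + 1 - j))

/-- The order `k` coefficient `R_V(A)^{[k]}` of the Bogoliubov map
`R_V(A) = S(V)⁻¹ ⋆ (S(V) ·_T A)`. -/
def bogoliubov (V A : Functional) (k : ℕ) : Functional :=
  ∑ j ∈ Finset.range (k + 1),
    starProd hm hl (sMatrixInv hm hl V (k - j)) (timeProd hm hl (sMatrix hm hl V j) A)

end Series

end QST

end

open QST

/-! The first ingredient is Wick's theorem in generating-function form. A functional is written as a
`kernelFunctional`: an integral over points X of a weight times the coefficient of a^N in Q_X(a)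
exp(∑ aᵢ φ(xᵢ)). Differentiating in φ multiplies the series by linear forms in a, so `expProd` with
kernel H multiplies two such series and inserts exp(∑ H(xᵢ - yⱼ) aᵢ bⱼ)
(`expProd_kernelFunctional`). Interactions and multilocal observables start from the series 1, so
every functional that occurs is a combination of `graphFunctional`s, where Q is the exponential of a
quadratic form whose matrix holds the propagators. The ⋆-inverse of S(V) has anti-Feynman lines
(`sMatrixInv_interaction`), and R_V(A)^{[k]} is (-i)^k / k! times the sum over subsets J of the k
interaction vertices, with sign (-1)^|J|, of the graph in which the vertices of J come from S(V)⁻¹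
(`bogoliubov_graphFunctional`).

The second ingredient is causality. A line from the later of two points has the same propagator
whether that point belongs to S(V)⁻¹ or to S(V) (`linePropagator_anti_eq_time`). If a nonempty set
of interaction vertices is not joined to the others, moving its latest vertex into or out of J only
flips the sign, so the signed sum vanishes (`sum_cutMatrix_eq_zero`). The same cancellation without
an observable and without a cut identifies S(V)⁻¹.

The third ingredient is spatial decay. For bounded times the two-point function falls off in space
faster than any power, being the spatial Fourier transform of a Schwartz function
(`exists_modTwoPoint_bound`). The function χ and the compact support of the observable bound all
times. If some vertex is far out, at radius r, the pigeonhole principle gives an empty annulus of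
width comparable to r / (k + 1). Deleting the lines across it changes the signed sum by O(r^{-M}),
and what remains is zero. The integrand at φ = 0 thus decays rapidly in the farthest vertex
(`exists_connectedCoeff_bound`), hence has an integrable majorant for uniformly bounded h, and
dominated convergence gives the limit (`tendsto_integral_connectedCoeff`). Finite sums of multilocal
functionals follow by linearity in A, justified by `IsRegular`. -/

noncomputable section

namespace QST

/-! ### Formal exponentials of multivariate power series -/

section FormalExp

open MvPowerSeries

variable {ι κ : Type*}

/-- The formal exponential `∑ qʳ / r!` of a power series without constant term. -/
def formalExp (q : MvPowerSeries ι ℂ) : MvPowerSeries ι ℂ :=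
  fun d => ∑ r ∈ Finset.range (d.degree + 1), (r.factorial : ℂ)⁻¹ * coeff d (q ^ r)

/-- Without constant term, q has order at least 1, so qʳ has order at least r. This is why the
truncation in `formalExp` loses nothing. -/
theorem coeff_pow_eq_zero_of_degree_lt {q : MvPowerSeries ι ℂ} (hq : constantCoeff q = 0)
    {d : ι →₀ ℕ} {r : ℕ} (h : d.degree < r) : coeff d (q ^ r) = 0 := by
  refine coeff_of_lt_order (lt_of_lt_of_le ?_ (le_order_pow_of_constantCoeff_eq_zero r hq))
  exact_mod_cast h

theorem coeff_pow_mul_eq_zero_of_degree_lt {q : MvPowerSeries ι ℂ} (hq : constantCoeff q = 0)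
    (p : MvPowerSeries ι ℂ) {d : ι →₀ ℕ} {r : ℕ} (h : d.degree < r) :
    coeff d (q ^ r * p) = 0 := by
  refine coeff_of_lt_order (lt_of_lt_of_le ?_ le_order_mul)
  refine lt_of_lt_of_le ?_
    ((le_order_pow_of_constantCoeff_eq_zero r hq).trans le_self_add)
  exact_mod_cast h

theorem coeff_pow_mul_pow_eq_zero_of_degree_lt {p q : MvPowerSeries ι ℂ}
    (hp : constantCoeff p = 0) (hq : constantCoeff q = 0) {d : ι →₀ ℕ} {r s : ℕ}
    (h : d.degree < r + s) : coeff d (p ^ r * q ^ s) = 0 := by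
  refine coeff_of_lt_order (lt_of_lt_of_le ?_ le_order_mul)
  refine lt_of_lt_of_le ?_ (add_le_add (le_order_pow_of_constantCoeff_eq_zero r hp)
    (le_order_pow_of_constantCoeff_eq_zero s hq))
  exact_mod_cast h

theorem coeff_formalExp {q : MvPowerSeries ι ℂ} (hq : constantCoeff q = 0) {d : ι →₀ ℕ} {R : ℕ}
    (h : d.degree < R) :
    coeff d (formalExp q) = ∑ r ∈ Finset.range R, (r.factorial : ℂ)⁻¹ * coeff d (q ^ r) := by
  change ∑ r ∈ Finset.range (d.degree + 1), (r.factorial : ℂ)⁻¹ * coeff d (q ^ r) = _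
  refine Finset.sum_subset (Finset.range_subset_range.2 h) fun r _ hr => ?_
  rw [coeff_pow_eq_zero_of_degree_lt hq (by simpa using hr), mul_zero]

/-- Both parts of a splitting of d have degree at most that of d, so one cutoff R serves the whole
antidiagonal. -/
theorem coeff_mul_formalExp (p : MvPowerSeries ι ℂ) {q : MvPowerSeries ι ℂ}
    (hq : constantCoeff q = 0) {d : ι →₀ ℕ} {R : ℕ} (h : d.degree < R) :
    coeff d (p * formalExp q) =
      ∑ r ∈ Finset.range R, (r.factorial : ℂ)⁻¹ * coeff d (p * q ^ r) := by
  classical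
  simp only [coeff_mul, Finset.mul_sum]
  rw [Finset.sum_comm]
  refine Finset.sum_congr rfl fun e he => ?_
  have hle : e.2.degree ≤ d.degree := by
    rw [← Finset.HasAntidiagonal.mem_antidiagonal.1 he, map_add]; exact Nat.le_add_left _ _
  rw [coeff_formalExp hq (hle.trans_lt h), Finset.mul_sum]
  refine Finset.sum_congr rfl fun r _ => ?_
  ring

theorem formalExp_zero : formalExp (0 : MvPowerSeries ι ℂ) = 1 := by
  classical
  ext d
  rw [coeff_formalExp (by simp) (Nat.lt_succ_self d.degree), Finset.sum_range_succ']
  simp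

theorem formalExp_add {p q : MvPowerSeries ι ℂ} (hp : constantCoeff p = 0)
    (hq : constantCoeff q = 0) : formalExp (p + q) = formalExp p * formalExp q := by
  classical
  ext d
  set R := d.degree + 1 with hR
  have hd : d.degree < R := Nat.lt_succ_self _
  rw [coeff_mul_formalExp _ hq hd, coeff_formalExp (by simp [hp, hq]) hd]
  have h1 : ∀ s ∈ Finset.range R, (s.factorial : ℂ)⁻¹ * coeff d (formalExp p * q ^ s) =
      ∑ r ∈ Finset.range R, (s.factorial : ℂ)⁻¹ * ((r.factorial : ℂ)⁻¹ *
        coeff d (p ^ r * q ^ s)) := by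
    intro s _
    rw [mul_comm (formalExp p), coeff_mul_formalExp _ hp hd, Finset.mul_sum]
    exact Finset.sum_congr rfl fun r _ => by rw [mul_comm (q ^ s)]
  rw [Finset.sum_congr rfl h1]
  have h2 : ∀ t ∈ Finset.range R, (t.factorial : ℂ)⁻¹ * coeff d ((p + q) ^ t) =
      ∑ e ∈ Finset.HasAntidiagonal.antidiagonal t, (e.2.factorial : ℂ)⁻¹ * ((e.1.factorial : ℂ)⁻¹ *
        coeff d (p ^ e.1 * q ^ e.2)) := by
    intro t _
    rw [(Commute.all p q).add_pow', map_sum, Finset.mul_sum]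
    refine Finset.sum_congr rfl fun e he => ?_
    rw [← Finset.HasAntidiagonal.mem_antidiagonal.1 he, map_nsmul, nsmul_eq_mul,
      ← mul_assoc, ← mul_assoc]
    congr 1
    rw [Nat.choose_symm_add, Nat.add_choose,
      Nat.cast_div (Nat.factorial_mul_factorial_dvd_factorial_add _ _)
      (by exact_mod_cast mul_ne_zero (Nat.factorial_ne_zero _) (Nat.factorial_ne_zero _))]
    have := Nat.factorial_ne_zero (e.1 + e.2)
    have := Nat.factorial_ne_zero e.1
    have := Nat.factorial_ne_zero e.2
    push_cast
    field_simp
  rw [Finset.sum_congr rfl h2, Finset.sum_sigma', ← Finset.sum_product']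
  -- The binomial theorem sums over the triangle r + s < R, the product over the square r, s < R.
  -- The extra terms have order above the degree of d and vanish.
  refine Finset.sum_of_injOn (fun x => (x.2.2, x.2.1)) ?_ ?_ ?_ ?_
  · rintro ⟨t, e⟩ hx ⟨t', e'⟩ hy hxy
    simp only [Finset.coe_sigma, Set.mem_sigma_iff, Finset.mem_coe,
      Finset.HasAntidiagonal.mem_antidiagonal]
      at hx hy
    simp only [Prod.mk.injEq] at hxy
    obtain ⟨h1, h2⟩ := hxy
    have : e = e' := Prod.ext h2 h1
    subst this
    have : t = t' := hx.2.symm.trans hy.2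
    subst this
    rfl
  · rintro ⟨t, e⟩ hx
    simp only [Finset.coe_sigma, Set.mem_sigma_iff, Finset.mem_coe,
      Finset.HasAntidiagonal.mem_antidiagonal,
      Finset.mem_range] at hx
    simp only [Finset.coe_product, Set.mem_prod, Finset.mem_coe, Finset.mem_range]
    omega
  · rintro ⟨s, r⟩ _ hx
    simp only [Set.mem_image, Finset.coe_sigma, Set.mem_sigma_iff, Finset.mem_coe,
      Finset.HasAntidiagonal.mem_antidiagonal, Finset.mem_range, not_exists, not_and] at hx
    rw [coeff_pow_mul_pow_eq_zero_of_degree_lt hp hq, mul_zero, mul_zero]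
    by_contra hcon
    exact hx ⟨r + s, (r, s)⟩ ⟨by simp only; omega, rfl⟩ rfl
  · rintro ⟨t, e⟩ _
    rfl

section Rename

theorem formalExp_rename {f : ι → κ} [TendstoCofinite f] {q : MvPowerSeries ι ℂ}
    (hq : constantCoeff q = 0) : formalExp (rename f q) = rename f (formalExp q) := by
  ext d
  have hd : d.degree < d.degree + 1 := Nat.lt_succ_self _
  rw [coeff_formalExp (by simpa using hq) hd, coeff_rename]
  have : ∀ e ∈ (TendstoCofinite.finite_preimage_singleton (Finsupp.mapDomain f) d).toFinset,
      coeff e (formalExp q) = ∑ r ∈ Finset.range (d.degree + 1),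
        (r.factorial : ℂ)⁻¹ * coeff e (q ^ r) := by
    intro e he
    refine coeff_formalExp hq ?_
    have : Finsupp.mapDomain f e = d := by simpa using he
    rw [← this, Finsupp.degree_mapDomain]
    exact Nat.lt_succ_self _
  rw [Finset.sum_congr rfl this, Finset.sum_comm]
  refine Finset.sum_congr rfl fun r _ => ?_
  rw [← map_pow, coeff_rename, Finset.mul_sum]

theorem coeff_mapDomain_rename_equiv (e : ι ≃ κ) (p : MvPowerSeries ι ℂ) (d : ι →₀ ℕ) :
    coeff (d.mapDomain e) (rename e p) = coeff d p := by
  have := coeff_embDomain_rename e.toEmbedding p d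
  rwa [Finsupp.embDomain_eq_mapDomain] at this

variable [Finite ι] [Finite κ]

/-- The two series use disjoint variables, so only one splitting of the monomial contributes: its
left part and its right part. -/
theorem coeff_sumElim_rename_mul_rename (p : MvPowerSeries ι ℂ) (q : MvPowerSeries κ ℂ)
    (d : ι →₀ ℕ) (e : κ →₀ ℕ) :
    coeff (d.sumElim e) (rename (Sum.inl : ι → ι ⊕ κ) p * rename (Sum.inr : κ → ι ⊕ κ) q) =
      coeff d p * coeff e q := by
  classical
  rw [coeff_mul, Finset.sum_eq_single (d.sumElim 0, Finsupp.sumElim 0 e)]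
  · have h1 := coeff_embDomain_rename Function.Embedding.inl p d (τ := ι ⊕ κ)
    have h2 := coeff_embDomain_rename Function.Embedding.inr q e (τ := ι ⊕ κ)
    rw [Finsupp.embDomain_inl] at h1
    rw [Finsupp.embDomain_inr] at h2
    exact congrArg₂ (· * ·) h1 h2
  · rintro ⟨x, y⟩ hxy hne
    rw [Finset.HasAntidiagonal.mem_antidiagonal] at hxy
    by_cases hx : x ∈ Set.range (Finsupp.mapDomain (Sum.inl : ι → ι ⊕ κ))
    · by_cases hy : y ∈ Set.range (Finsupp.mapDomain (Sum.inr : κ → ι ⊕ κ))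
      · obtain ⟨x', rfl⟩ := hx
        obtain ⟨y', rfl⟩ := hy
        simp only at hxy
        rw [← Finsupp.sumElim_eq_add] at hxy
        have e1 : x' = d := by
          ext i; simpa using DFunLike.congr_fun hxy (Sum.inl i)
        have e2 : y' = e := by
          ext i; simpa using DFunLike.congr_fun hxy (Sum.inr i)
        subst e1 e2
        exact absurd (by simp [Finsupp.sumElim_eq_add]) hne
      · rw [coeff_rename_eq_zero _ _ hy, mul_zero]
    · rw [coeff_rename_eq_zero _ _ hx, zero_mul]
  · intro h
    exact absurd (by rw [Finset.HasAntidiagonal.mem_antidiagonal, ← Finsupp.sumElim_add]; simp) h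

end Rename

/-- The linear form `∑ uᵢ aᵢ`. -/
def linForm [Fintype ι] (u : ι → ℂ) : MvPowerSeries ι ℂ := ∑ i, C (u i) * X i

@[simp] theorem constantCoeff_linForm [Fintype ι] (u : ι → ℂ) :
    constantCoeff (linForm u) = 0 := by simp [linForm]

theorem linForm_add [Fintype ι] (u v : ι → ℂ) : linForm (u + v) = linForm u + linForm v := by
  simp [linForm, add_mul, Finset.sum_add_distrib]

theorem linForm_smul [Fintype ι] (c : ℂ) (u : ι → ℂ) : linForm (c • u) = C c * linForm u := by
  simp [linForm, Finset.mul_sum, mul_assoc]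

theorem linForm_zero [Fintype ι] : linForm (0 : ι → ℂ) = 0 := by simp [linForm]

theorem rename_inl_linForm [Fintype ι] [Fintype κ] (u : ι → ℂ) (v : κ → ℂ) :
    linForm (Sum.elim u v) =
      rename (Sum.inl : ι → ι ⊕ κ) (linForm u) + rename (Sum.inr : κ → ι ⊕ κ) (linForm v) := by
  simp [linForm, map_sum]

theorem coeff_formalExp_C_mul_X [DecidableEq ι] (c : ℂ) (i : ι) (d : ι →₀ ℕ) :
    coeff d (formalExp (C c * X i)) =
      if d = Finsupp.single i (d i) then c ^ d i / ((d i).factorial : ℂ) else 0 := by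
  have h0 : constantCoeff (C c * X i : MvPowerSeries ι ℂ) = 0 := by simp
  rw [coeff_formalExp h0 (Nat.lt_succ_self d.degree)]
  have h : ∀ r, coeff d ((C c * X i : MvPowerSeries ι ℂ) ^ r) =
      if d = Finsupp.single i r then c ^ r else 0 := by
    intro r
    rw [mul_pow, ← map_pow, coeff_C_mul, coeff_X_pow]
    simp
  simp_rw [h]
  split_ifs with hd
  · rw [Finset.sum_eq_single (d i)]
    · rw [if_pos hd]; field_simp
    · intro r _ hr
      rw [if_neg, mul_zero]
      intro h'
      apply hr
      rw [h']; simp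
    · intro h'
      exfalso; apply h'
      rw [Finset.mem_range, hd]; simp
  · refine Finset.sum_eq_zero fun r _ => ?_
    rw [if_neg, mul_zero]
    intro h'
    apply hd
    rw [h']; simp

theorem coeff_formalExp_sum_C_mul_X [DecidableEq ι] (s : Finset ι) (u : ι → ℂ) (d : ι →₀ ℕ) :
    coeff d (formalExp (∑ i ∈ s, C (u i) * X i)) =
      if d.support ⊆ s then ∏ i ∈ s, u i ^ d i / ((d i).factorial : ℂ) else 0 := by
  induction s using Finset.induction_on generalizing d with
  | empty =>
    simp only [Finset.sum_empty, formalExp_zero, coeff_one, Finset.prod_empty,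
      Finset.subset_empty, Finsupp.support_eq_empty]
  | insert i s hi ih =>
    rw [Finset.sum_insert hi, formalExp_add (by simp) (by simp), coeff_mul]
    -- The factor for `i` uses only the variable `i` and the other factor avoids it, which forces
    -- this splitting.
    rw [Finset.sum_eq_single (Finsupp.single i (d i), d.erase i)]
    · simp only [coeff_formalExp_C_mul_X, ih, Finsupp.single_eq_same, if_true,
        Finsupp.support_erase, Finset.prod_insert hi]
      have : d.support.erase i ⊆ s ↔ d.support ⊆ insert i s := by
        rw [Finset.subset_insert_iff]
      simp only [this, mul_ite, mul_zero]
      split_ifs with h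
      · congr 1
        refine Finset.prod_congr rfl fun j hj => ?_
        rw [Finsupp.erase_ne (ne_of_mem_of_not_mem hj hi)]
      · rfl
    · rintro ⟨x, y⟩ hxy hne
      rw [Finset.HasAntidiagonal.mem_antidiagonal] at hxy
      simp only at hxy
      simp only [coeff_formalExp_C_mul_X, ih]
      by_cases hx : x = Finsupp.single i (x i)
      · by_cases hy : y.support ⊆ s
        · exfalso
          apply hne
          have hyi : y i = 0 := by
            by_contra h
            exact hi (hy (Finsupp.mem_support_iff.2 h))
          have hdi : d i = x i := by rw [← hxy]; simp [hyi]
          refine Prod.ext (by simpa [hdi] using hx) ?_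
          ext j
          by_cases hj : j = i
          · subst hj; simp [hyi]
          · have : x j = 0 := by rw [hx]; simp [Ne.symm hj]
            simp [Finsupp.erase_ne hj, ← hxy, this]
        · rw [if_neg hy, mul_zero]
      · rw [if_neg hx, zero_mul]
    · intro h
      exact absurd (by simp [Finset.HasAntidiagonal.mem_antidiagonal, Finsupp.single_add_erase]) h

theorem coeff_formalExp_linForm [Fintype ι] (u : ι → ℂ) (d : ι →₀ ℕ) :
    coeff d (formalExp (linForm u)) = ∏ i, u i ^ d i / ((d i).factorial : ℂ) := by
  classical
  rw [linForm, coeff_formalExp_sum_C_mul_X, if_pos (Finset.subset_univ _)]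

end FormalExp

/-! ### Uniqueness of functional derivatives -/

section Density

/-- Stone–Weierstrass for the topology of locally uniform convergence. -/
theorem dense_starSubalgebra_of_separatesPoints {X : Type*} [TopologicalSpace X]
    (A : StarSubalgebra ℂ C(X, ℂ)) (hA : A.SeparatesPoints) :
    Dense (A : Set C(X, ℂ)) := by
  intro f
  rw [mem_closure_iff_nhds_basis (nhds_basis_uniformity'
    Metric.uniformity_basis_dist.compactConvergenceUniformity)]
  rintro ⟨K, ε⟩ ⟨hK, hε⟩
  have : CompactSpace K := isCompact_iff_compactSpace.1 hK
  -- Restriction to `K` keeps the algebra separating, so the compact Stone–Weierstrass theorem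
  -- applies there.
  let ρ : C(X, ℂ) →⋆ₐ[ℂ] C(K, ℂ) := ContinuousMap.compStarAlgHom' ℂ ℂ ⟨Subtype.val, by fun_prop⟩
  have hsep : (A.map ρ).SeparatesPoints := by
    intro x y hxy
    obtain ⟨_, ⟨g, hg, rfl⟩, hne⟩ := hA (Subtype.coe_injective.ne hxy)
    exact ⟨_, ⟨ρ g, ⟨g, hg, rfl⟩, rfl⟩, hne⟩
  have htop := ContinuousMap.starSubalgebra_topologicalClosure_eq_top_of_separatesPoints _ hsep
  have hmem : ρ f ∈ (A.map ρ).topologicalClosure := htop ▸ StarSubalgebra.mem_top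
  obtain ⟨_, ⟨g, hg, rfl⟩, hd⟩ := Metric.mem_closure_iff.1
    (show ρ f ∈ closure ((A.map ρ : StarSubalgebra ℂ C(K, ℂ)) : Set C(K, ℂ)) from hmem) ε hε
  refine ⟨g, hg, fun x hx => ?_⟩
  exact lt_of_le_of_lt (ContinuousMap.dist_apply_le_dist (f := ρ f) (g := ρ g) ⟨x, hx⟩) hd

/-- A function of temperate growth as a field configuration. -/
def temperateConfig (φ : Spacetime → ℝ) (hφ : φ.HasTemperateGrowth) : FieldConfig :=
  have : (volume : Measure Spacetime).IsAddHaarMeasure :=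
    Measure.prod.instIsAddHaarMeasure volume volume
  ⟨φ, hφ.1, (SchwartzMap.integralCLM ℝ volume) ∘L (SchwartzMap.smulLeftCLM ℝ φ), fun f _ => by
    simp only [ContinuousLinearMap.comp_apply, SchwartzMap.integralCLM_apply]
    congr 1
    ext x
    rw [SchwartzMap.smulLeftCLM_apply_apply hφ, smul_eq_mul, mul_comm]⟩

/-- Products of functions of temperate growth in one variable each. -/
def temperateTensors (n : ℕ) : Submonoid C(Fin n → Spacetime, ℂ) where
  carrier := {t | ∃ ψ : Fin n → FieldConfig,
    (∀ i, (ψ i : Spacetime → ℝ).HasTemperateGrowth) ∧ t = tensorConfig ψ}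
  one_mem' := ⟨fun _ => temperateConfig (fun _ => 1) (Function.HasTemperateGrowth.const 1),
    fun _ => Function.HasTemperateGrowth.const 1, by
      ext X; simp [tensorConfig, temperateConfig]⟩
  mul_mem' := by
    rintro _ _ ⟨ψ, hψ, rfl⟩ ⟨ξ, hξ, rfl⟩
    refine ⟨fun i => temperateConfig (fun x => (ψ i : Spacetime → ℝ) x * (ξ i : Spacetime → ℝ) x)
      ((hψ i).mul (hξ i)), fun i => (hψ i).mul (hξ i), ?_⟩
    ext X
    simp [tensorConfig, temperateConfig, Finset.prod_mul_distrib]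

/-- The star algebra generated by products of functions of temperate growth. -/
def temperateAlgebra (n : ℕ) : StarSubalgebra ℂ C(Fin n → Spacetime, ℂ) where
  __ := Algebra.adjoin ℂ (temperateTensors n : Set C(Fin n → Spacetime, ℂ))
  star_mem' := by
    intro a ha
    change star a ∈ Algebra.adjoin ℂ _
    refine Algebra.adjoin_induction (p := fun a _ => star a ∈ Algebra.adjoin ℂ _)
      ?_ ?_ ?_ ?_ ha
    · rintro _ ⟨ψ, hψ, rfl⟩
      have : star (tensorConfig ψ) = tensorConfig ψ := by
        ext X; simp [tensorConfig]
      rw [this]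
      exact Algebra.subset_adjoin ⟨ψ, hψ, rfl⟩
    · intro c
      have : star (algebraMap ℂ C(Fin n → Spacetime, ℂ) c) = algebraMap ℂ _ (star c) := by
        ext X; simp
      rw [this]
      exact Subalgebra.algebraMap_mem _ _
    · intro x y _ _ hx hy
      rw [star_add]; exact add_mem hx hy
    · intro x y _ _ hx hy
      rw [star_mul']; exact mul_mem hx hy

theorem temperateAlgebra_separatesPoints (n : ℕ) : (temperateAlgebra n).SeparatesPoints := by
  classical
  intro X Y hXY
  obtain ⟨i, hi⟩ := Function.ne_iff.1 hXY
  obtain ⟨L, hL⟩ : ∃ L : Spacetime →L[ℝ] ℝ, L (X i) ≠ L (Y i) := by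
    by_cases h1 : (X i).1 = (Y i).1
    · have h2 : (X i).2 ≠ (Y i).2 := fun h => hi (Prod.ext h1 h)
      obtain ⟨j, hj⟩ : ∃ j, (X i).2 j ≠ (Y i).2 j := by
        by_contra! hcon
        exact h2 (by ext j; exact hcon j)
      exact ⟨(EuclideanSpace.proj j).comp (ContinuousLinearMap.snd ℝ ℝ Space), by simpa using hj⟩
    · exact ⟨ContinuousLinearMap.fst ℝ ℝ Space, by simpa using h1⟩
  let ψ : Fin n → FieldConfig := fun j => if j = i then
    temperateConfig L L.hasTemperateGrowth
    else temperateConfig (fun _ => 1) (Function.HasTemperateGrowth.const 1)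
  have hψ : ∀ j, (ψ j : Spacetime → ℝ).HasTemperateGrowth := by
    intro j
    by_cases h : j = i
    · simpa [ψ, h, temperateConfig] using L.hasTemperateGrowth
    · simp [ψ, h, temperateConfig, Function.HasTemperateGrowth.const]
  have hval : ∀ Z, tensorConfig ψ Z = (L (Z i) : ℂ) := by
    intro Z
    change ∏ j, ((ψ j : Spacetime → ℝ) (Z j) : ℂ) = _
    rw [Finset.prod_eq_single i]
    · simp [ψ, temperateConfig]
    · intro j _ hj
      simp [ψ, hj, temperateConfig]
    · simp
  refine ⟨_, ⟨tensorConfig ψ, Algebra.subset_adjoin ⟨ψ, hψ, rfl⟩, rfl⟩, ?_⟩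
  change tensorConfig ψ X ≠ tensorConfig ψ Y
  rw [hval, hval]
  exact_mod_cast hL

/-- Tempered smooth functions are not closed under products, so density is shown with those of
temperate growth. Their tensors form a monoid, hence already span the algebra they generate, and
agreement on tensors suffices. -/
theorem continuousLinearMap_ext_tensorConfig {n : ℕ} {u v : C(Fin n → Spacetime, ℂ) →L[ℂ] ℂ}
    (h : ∀ ψ, u (tensorConfig ψ) = v (tensorConfig ψ)) : u = v := by
  have hd := dense_starSubalgebra_of_separatesPoints _ (temperateAlgebra_separatesPoints n)
  refine DFunLike.coe_injective (Continuous.ext_on hd u.continuous v.continuous ?_)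
  intro a ha
  have ha' : a ∈ Subalgebra.toSubmodule
    (Algebra.adjoin ℂ (temperateTensors n : Set C(Fin n → Spacetime, ℂ))) := ha
  rw [Algebra.adjoin_eq_span, Submonoid.closure_eq] at ha'
  clear ha
  induction ha' using Submodule.span_induction with
  | mem x hx => obtain ⟨ψ, _, rfl⟩ := hx; exact h ψ
  | zero => simp
  | add x y _ _ hx hy => rw [map_add, map_add, hx, hy]
  | smul c x _ hx => rw [map_smul, map_smul, hx]

/-- Uniqueness allows an explicit derivative to replace the choice made in `functionalDeriv`. -/
theorem functionalDeriv_eq {F : Functional} {n : ℕ} {φ : FieldConfig}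
    {u : C(Fin n → Spacetime, ℂ) →L[ℂ] ℂ} (hu : IsFunctionalDeriv F n φ u) :
    functionalDeriv F n φ = u := by
  have hex : ∃ u, IsFunctionalDeriv F n φ u := ⟨u, hu⟩
  rw [functionalDeriv, dif_pos hex]
  exact continuousLinearMap_ext_tensorConfig fun ψ => (hex.choose_spec ψ).trans (hu ψ).symm

end Density

/-! ### Functionals given by generating functions -/

section CoeffContinuity

open MvPowerSeries

variable {ι κ T : Type*} [TopologicalSpace T]

/-- All coefficients depend continuously on a parameter. -/
def CoeffContinuous (Q : T → MvPowerSeries ι ℂ) : Prop :=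
  ∀ d, Continuous fun x => coeff d (Q x)

namespace CoeffContinuous

variable {P Q : T → MvPowerSeries ι ℂ}

theorem const (q : MvPowerSeries ι ℂ) : CoeffContinuous fun _ : T => q :=
  fun _ => continuous_const

theorem mul (hP : CoeffContinuous P) (hQ : CoeffContinuous Q) :
    CoeffContinuous fun x => P x * Q x := fun d => by
  classical
  simp only [coeff_mul]
  exact continuous_finsetSum _ fun e _ => (hP _).mul (hQ _)

theorem sum {α : Type*} (s : Finset α) {P : α → T → MvPowerSeries ι ℂ}
    (hP : ∀ a ∈ s, CoeffContinuous (P a)) : CoeffContinuous fun x => ∑ a ∈ s, P a x := fun d => by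
  simp only [map_sum]
  exact continuous_finsetSum _ fun a ha => hP a ha d

theorem pow (hP : CoeffContinuous P) (r : ℕ) : CoeffContinuous fun x => P x ^ r := by
  induction r with
  | zero => simpa using const 1
  | succ r ih => simpa only [pow_succ] using ih.mul hP

theorem prod {α : Type*} (s : Finset α) {P : α → T → MvPowerSeries ι ℂ}
    (hP : ∀ a ∈ s, CoeffContinuous (P a)) : CoeffContinuous fun x => ∏ a ∈ s, P a x := by
  classical
  induction s using Finset.induction_on with
  | empty => simpa using const 1
  | insert a s ha ih =>
    simp only [Finset.prod_insert ha]
    exact (hP a (by simp)).mul (ih fun b hb => hP b (by simp [hb]))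

theorem C_mul {c : T → ℂ} (hc : Continuous c) (hP : CoeffContinuous P) :
    CoeffContinuous fun x => C (c x) * P x := fun d => by
  simp only [coeff_C_mul]; exact hc.mul (hP d)

theorem formalExp (hP : CoeffContinuous P) : CoeffContinuous fun x => formalExp (P x) := fun d => by
  change Continuous fun x => ∑ r ∈ Finset.range (d.degree + 1), _
  exact continuous_finsetSum _ fun r _ => continuous_const.mul (hP.pow r d)

theorem rename (hP : CoeffContinuous P) (f : ι → κ) [TendstoCofinite f] :
    CoeffContinuous fun x => MvPowerSeries.rename f (P x) := fun d => by
  simp only [coeff_rename]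
  exact continuous_finsetSum _ fun r _ => hP r

theorem comp {T' : Type*} [TopologicalSpace T'] (hP : CoeffContinuous P) {g : T' → T}
    (hg : Continuous g) : CoeffContinuous fun x => P (g x) := fun d => (hP d).comp hg

theorem linForm [Fintype ι] {u : T → ι → ℂ} (hu : ∀ i, Continuous fun x => u x i) :
    CoeffContinuous fun x => linForm (u x) :=
  sum _ fun i _ => C_mul (hu i) (const _)

end CoeffContinuous

end CoeffContinuity

/-! ### Kernel functionals and their derivatives -/

section KernelFunctional

open MvPowerSeries

variable {ι κ : Type} [Fintype ι] [Fintype κ]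

/-- The values of a field configuration at a family of points. -/
def fieldValues (φ : FieldConfig) (X : ι → Spacetime) : ι → ℂ :=
  fun i => ((φ : Spacetime → ℝ) (X i) : ℂ)

omit [Fintype ι] in
theorem continuous_fieldValues (φ : FieldConfig) (i : ι) :
    Continuous fun X : ι → Spacetime => fieldValues φ X i :=
  Complex.continuous_ofReal.comp ((fieldConfig_continuous φ).comp (continuous_apply i))

/-- The functional `φ ↦ ∫ f(X) [a^N] (Q_X(a) exp(∑ aᵢ φ(xᵢ))) dX`. -/
def kernelFunctional (N : ι →₀ ℕ) (f : (ι → Spacetime) → ℂ)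
    (Q : (ι → Spacetime) → MvPowerSeries ι ℂ) : Functional :=
  fun φ => ∫ X, f X * coeff N (Q X * formalExp (linForm (fieldValues φ X)))

variable {N : ι →₀ ℕ} {f : (ι → Spacetime) → ℂ} {Q : (ι → Spacetime) → MvPowerSeries ι ℂ}

theorem integrable_mul_of_compactSupport (hf : Continuous f) (hfc : HasCompactSupport f)
    {g : (ι → Spacetime) → ℂ} (hg : Continuous g) : Integrable fun X => f X * g X :=
  (hf.mul hg).integrable_of_hasCompactSupport hfc.mul_right

/-- On the line φ + sψ the exponential gains the factor exp(s ∑ aᵢ ψ(xᵢ)), and only powers of s up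
to the degree of N reach the coefficient of a^N. The functional is a polynomial in s, and its linear
coefficient is the derivative. -/
theorem hasDerivAt_kernelFunctional (hf : Continuous f) (hfc : HasCompactSupport f)
    (hQ : CoeffContinuous Q) (φ ψ : FieldConfig) :
    HasDerivAt (fun s : ℝ => kernelFunctional N f Q (φ + s • ψ))
      (kernelFunctional N f (fun X => Q X * linForm (fieldValues ψ X)) φ) 0 := by
  -- One more than the truncation requires, so that the index r = 1 is present even when N = 0.
  set R := N.degree + 2 with hR
  set c : ℕ → ℂ := fun r => ∫ X, f X * ((r.factorial : ℂ)⁻¹ *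
    coeff N (Q X * formalExp (linForm (fieldValues φ X)) * linForm (fieldValues ψ X) ^ r)) with hc
  have hcont : ∀ r, Continuous fun X => (r.factorial : ℂ)⁻¹ *
      coeff N (Q X * formalExp (linForm (fieldValues φ X)) * linForm (fieldValues ψ X) ^ r) :=
    fun r => continuous_const.mul (((hQ.mul (CoeffContinuous.linForm
      (continuous_fieldValues φ)).formalExp).mul ((CoeffContinuous.linForm
      (continuous_fieldValues ψ)).pow r)) N)
  have key : ∀ s : ℝ, kernelFunctional N f Q (φ + s • ψ) =
      ∑ r ∈ Finset.range R, (s : ℂ) ^ r * c r := by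
    intro s
    have h1 : ∀ X : ι → Spacetime, fieldValues (φ + s • ψ) X =
        fieldValues φ X + (s : ℂ) • fieldValues ψ X := by
      intro X; ext i; simp [fieldValues]
    have h2 : ∀ X, f X * coeff N (Q X * formalExp (linForm (fieldValues (φ + s • ψ) X))) =
        ∑ r ∈ Finset.range R, (s : ℂ) ^ r * (f X * ((r.factorial : ℂ)⁻¹ *
          coeff N (Q X * formalExp (linForm (fieldValues φ X)) *
            linForm (fieldValues ψ X) ^ r))) := by
      intro X
      rw [h1, linForm_add, linForm_smul, formalExp_add (by simp) (by simp), ← mul_assoc,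
        coeff_mul_formalExp _ (by simp) (show N.degree < R by omega), Finset.mul_sum]
      refine Finset.sum_congr rfl fun r _ => ?_
      rw [mul_pow, ← map_pow, mul_left_comm _ (C _), coeff_C_mul]
      ring
    simp only [kernelFunctional, h2]
    rw [integral_finsetSum _ fun r _ =>
      (integrable_mul_of_compactSupport hf hfc (hcont r)).const_mul _]
    exact Finset.sum_congr rfl fun r _ => integral_const_mul _ _
  have hval : kernelFunctional N f (fun X => Q X * linForm (fieldValues ψ X)) φ = c 1 := by
    simp only [kernelFunctional, hc, pow_one, Nat.factorial_one, Nat.cast_one, inv_one, one_mul]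
    congr 1; ext X
    rw [mul_right_comm]
  rw [hval]
  have hd : HasDerivAt (fun s : ℝ => ∑ r ∈ Finset.range R, (s : ℂ) ^ r * c r)
      (∑ r ∈ Finset.range R, ((r : ℂ) * ((0 : ℝ) : ℂ) ^ (r - 1) * 1) * c r) 0 := by
    refine HasDerivAt.fun_sum fun r _ => ?_
    exact ((Complex.ofRealCLM.hasDerivAt (x := (0 : ℝ))).pow r).mul_const (c r)
  have hs : ∑ r ∈ Finset.range R, ((r : ℂ) * ((0 : ℝ) : ℂ) ^ (r - 1) * 1) * c r = c 1 := by
    rw [Finset.sum_eq_single 1]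
    · simp
    · intro r _ hr
      rcases Nat.eq_zero_or_pos r with rfl | h0
      · simp
      · have : r - 1 ≠ 0 := by omega
        simp [this]
    · intro h
      exact absurd (Finset.mem_range.2 (by omega)) h
  rw [hs] at hd
  exact hd.congr_of_eventuallyEq (Eventually.of_forall key)

theorem coeffContinuous_mul_prod_linForm (hQ : CoeffContinuous Q) {n : ℕ}
    (ψ : Fin n → FieldConfig) :
    CoeffContinuous fun X => Q X * ∏ s, linForm (fieldValues (ψ s) X) :=
  hQ.mul (CoeffContinuous.prod _ fun s _ =>
    CoeffContinuous.linForm (continuous_fieldValues (ψ s)))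

theorem iterDirDeriv_kernelFunctional (hf : Continuous f) (hfc : HasCompactSupport f)
    (hQ : CoeffContinuous Q) (n : ℕ) (ψ : Fin n → FieldConfig) :
    iterDirDeriv n ψ (kernelFunctional N f Q) =
      kernelFunctional N f fun X => Q X * ∏ s, linForm (fieldValues (ψ s) X) := by
  induction n with
  | zero => simp [iterDirDeriv]
  | succ n ih =>
    ext φ
    rw [iterDirDeriv, ih, dirDeriv, (hasDerivAt_kernelFunctional hf hfc
      (coeffContinuous_mul_prod_linForm hQ _) φ (ψ 0)).deriv]
    congr 1; ext1 X
    rw [Fin.prod_univ_succ, mul_assoc, mul_comm (∏ s, _)]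
    rfl

/-- The coefficient of `Ψ(x_{i₁}, …, x_{i_n})` in the `n`-th derivative of a kernel functional. -/
def derivCoeff (N : ι →₀ ℕ) (Q : (ι → Spacetime) → MvPowerSeries ι ℂ) (φ : FieldConfig) {n : ℕ}
    (i : Fin n → ι) (X : ι → Spacetime) : ℂ :=
  coeff N (Q X * formalExp (linForm (fieldValues φ X)) * ∏ s, MvPowerSeries.X (i s))

theorem continuous_derivCoeff (hQ : CoeffContinuous Q) (φ : FieldConfig) {n : ℕ}
    (i : Fin n → ι) : Continuous (derivCoeff N Q φ i) :=
  ((hQ.mul (CoeffContinuous.linForm (continuous_fieldValues φ)).formalExp).mul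
    (CoeffContinuous.const _)) N

theorem continuous_sum_derivCoeff_mul (hQ : CoeffContinuous Q) (φ : FieldConfig) {n : ℕ}
    (Ψ : C(Fin n → Spacetime, ℂ)) : Continuous fun X : ι → Spacetime =>
      ∑ i : Fin n → ι, derivCoeff N Q φ i X * Ψ fun s => X (i s) :=
  continuous_finsetSum _ fun i _ => (continuous_derivCoeff hQ φ i).mul
    (Ψ.continuous.comp (continuous_pi fun s => continuous_apply (i s)))

/-- The `n`-th functional derivative of a kernel functional. -/
def kernelDeriv (hf : Continuous f) (hfc : HasCompactSupport f) (hQ : CoeffContinuous Q)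
    (N : ι →₀ ℕ) (n : ℕ) (φ : FieldConfig) : C(Fin n → Spacetime, ℂ) →L[ℂ] ℂ where
  toFun Ψ := ∫ X, f X * ∑ i : Fin n → ι, derivCoeff N Q φ i X * Ψ fun s => X (i s)
  map_add' Ψ Ξ := by
    rw [← integral_add (integrable_mul_of_compactSupport hf hfc
        (continuous_sum_derivCoeff_mul hQ φ Ψ))
      (integrable_mul_of_compactSupport hf hfc (continuous_sum_derivCoeff_mul hQ φ Ξ))]
    congr 1; ext X
    simp only [ContinuousMap.add_apply, mul_add, Finset.sum_add_distrib]
  map_smul' c Ψ := by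
    rw [RingHom.id_apply, smul_eq_mul, ← integral_const_mul]
    congr 1; ext X
    simp only [ContinuousMap.smul_apply, smul_eq_mul, Finset.mul_sum]
    exact Finset.sum_congr rfl fun i _ => by ring
  cont := by
    rw [← continuousOn_univ]
    refine continuousOn_integral_of_compact_support hfc ?_ fun Ψ X _ hX => by
      rw [image_eq_zero_of_notMem_tsupport hX, zero_mul]
    refine Continuous.continuousOn ?_
    refine (hf.comp continuous_snd).mul (continuous_finsetSum _ fun i _ => ?_)
    refine ((continuous_derivCoeff hQ φ i).comp continuous_snd).mul ?_
    exact continuous_fst.eval (by fun_prop)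

theorem isFunctionalDeriv_kernelDeriv (hf : Continuous f) (hfc : HasCompactSupport f)
    (hQ : CoeffContinuous Q) (n : ℕ) (φ : FieldConfig) :
    IsFunctionalDeriv (kernelFunctional N f Q) n φ (kernelDeriv hf hfc hQ N n φ) := by
  classical
  intro ψ
  rw [iterDirDeriv_kernelFunctional hf hfc hQ]
  change ∫ X, _ = ∫ X, _
  congr 1; ext X
  congr 1
  -- Expanding the product of sums over all maps `i` turns the product of linear forms into
  -- evaluations of the tensor of the ψ's at (x_{i 1}, …, x_{i n}).
  have : ∏ s, linForm (fieldValues (ψ s) X) =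
      ∑ i : Fin n → ι, C (∏ s, fieldValues (ψ s) X (i s)) * ∏ s, MvPowerSeries.X (i s) := by
    simp only [linForm]
    rw [Finset.prod_univ_sum, Fintype.piFinset_univ]
    refine Finset.sum_congr rfl fun i _ => ?_
    rw [Finset.prod_mul_distrib, map_prod]
  beta_reduce
  rw [this, mul_right_comm, Finset.mul_sum, map_sum]
  refine Finset.sum_congr rfl fun i _ => ?_
  rw [mul_left_comm, coeff_C_mul, mul_comm]
  rfl

theorem functionalDeriv_kernelFunctional (hf : Continuous f) (hfc : HasCompactSupport f)
    (hQ : CoeffContinuous Q) (n : ℕ) (φ : FieldConfig) :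
    functionalDeriv (kernelFunctional N f Q) n φ = kernelDeriv hf hfc hQ N n φ :=
  functionalDeriv_eq (isFunctionalDeriv_kernelDeriv hf hfc hQ n φ)

end KernelFunctional

/-! ### Products of kernel functionals -/

section KernelProduct

open MvPowerSeries

variable {ι κ : Type} [Fintype ι] [Fintype κ]

/-- The product `f(X) g(Y)` as a function on `M^(ι ⊕ κ)`. -/
def tensorFun (f : (ι → Spacetime) → ℂ) (g : (κ → Spacetime) → ℂ) (Z : ι ⊕ κ → Spacetime) : ℂ :=
  f (Z ∘ Sum.inl) * g (Z ∘ Sum.inr)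

omit [Fintype ι] [Fintype κ] in
theorem continuous_comp_inl : Continuous fun Z : ι ⊕ κ → Spacetime => Z ∘ Sum.inl :=
  continuous_pi fun _ => continuous_apply _

omit [Fintype ι] [Fintype κ] in
theorem continuous_comp_inr : Continuous fun Z : ι ⊕ κ → Spacetime => Z ∘ Sum.inr :=
  continuous_pi fun _ => continuous_apply _

omit [Fintype ι] [Fintype κ] in
theorem continuous_tensorFun {f : (ι → Spacetime) → ℂ} {g : (κ → Spacetime) → ℂ}
    (hf : Continuous f) (hg : Continuous g) : Continuous (tensorFun f g) :=
  (hf.comp continuous_comp_inl).mul (hg.comp continuous_comp_inr)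

omit [Fintype ι] [Fintype κ] in
theorem continuous_sumElim_uncurry : Continuous fun p : (ι → Spacetime) × (κ → Spacetime) =>
    (Sum.elim p.1 p.2 : ι ⊕ κ → Spacetime) :=
  continuous_pi fun i => by rcases i with i | i <;> simp only [Sum.elim_inl, Sum.elim_inr] <;>
    fun_prop

omit [Fintype ι] [Fintype κ] in
theorem hasCompactSupport_tensorFun {f : (ι → Spacetime) → ℂ} {g : (κ → Spacetime) → ℂ}
    (hf : HasCompactSupport f) (hg : HasCompactSupport g) :
    HasCompactSupport (tensorFun f g) := by
  refine HasCompactSupport.intro ((hf.isCompact.prod hg.isCompact).image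
    continuous_sumElim_uncurry) fun Z hZ => ?_
  by_contra hne
  refine hZ ⟨(Z ∘ Sum.inl, Z ∘ Sum.inr), ⟨subset_tsupport _ ?_, subset_tsupport _ ?_⟩,
    Sum.elim_comp_inl_inr Z⟩
  · exact left_ne_zero_of_mul hne
  · exact right_ne_zero_of_mul hne

theorem integral_sum_pi {E : Type*} [NormedAddCommGroup E] [NormedSpace ℝ E]
    {G : (ι ⊕ κ → Spacetime) → E} (hG : Integrable G) :
    ∫ Z, G Z = ∫ X : ι → Spacetime, ∫ Y : κ → Spacetime, G (Sum.elim X Y) := by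
  have hmp := (volume_measurePreserving_sumPiEquivProdPi (fun _ : ι ⊕ κ => Spacetime)).symm
  have h1 : Integrable (fun p : (ι → Spacetime) × (κ → Spacetime) => G (Sum.elim p.1 p.2))
      (volume.prod volume) :=
    (hmp.integrable_comp_emb (MeasurableEquiv.measurableEmbedding _)).2 hG
  rw [← integral_prod _ h1]
  exact (hmp.integral_comp (MeasurableEquiv.measurableEmbedding _) G).symm

/-- The bilinear form `∑ H(xᵢ - yⱼ) aᵢ bⱼ`. -/
def crossForm (H : C(Spacetime, ℂ)) (Z : ι ⊕ κ → Spacetime) : MvPowerSeries (ι ⊕ κ) ℂ :=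
  ∑ e : ι × κ, C (H (Z (.inl e.1) - Z (.inr e.2))) * (X (.inl e.1) * X (.inr e.2))

@[simp] theorem constantCoeff_crossForm (H : C(Spacetime, ℂ)) (Z : ι ⊕ κ → Spacetime) :
    constantCoeff (crossForm H Z) = 0 := by simp [crossForm]

theorem coeffContinuous_crossForm (H : C(Spacetime, ℂ)) :
    CoeffContinuous (crossForm H : (ι ⊕ κ → Spacetime) → _) :=
  CoeffContinuous.sum _ fun _ _ => CoeffContinuous.C_mul (by fun_prop) (CoeffContinuous.const _)

/-- The generating function of a product of kernel functionals. -/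
def prodSeries (H : C(Spacetime, ℂ)) (P : (ι → Spacetime) → MvPowerSeries ι ℂ)
    (Q : (κ → Spacetime) → MvPowerSeries κ ℂ) (Z : ι ⊕ κ → Spacetime) : MvPowerSeries (ι ⊕ κ) ℂ :=
  rename Sum.inl (P (Z ∘ Sum.inl)) * rename Sum.inr (Q (Z ∘ Sum.inr)) * formalExp (crossForm H Z)

variable {P : (ι → Spacetime) → MvPowerSeries ι ℂ} {Q : (κ → Spacetime) → MvPowerSeries κ ℂ}

/-- The integrand of order `n` in the product of two kernel functionals. -/
def pairingCoeff (H : C(Spacetime, ℂ)) (N : ι →₀ ℕ) (M : κ →₀ ℕ)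
    (P : (ι → Spacetime) → MvPowerSeries ι ℂ) (Q : (κ → Spacetime) → MvPowerSeries κ ℂ)
    (φ : FieldConfig) (n : ℕ) (Z : ι ⊕ κ → Spacetime) : ℂ :=
  coeff (N.sumElim M) (rename Sum.inl (P (Z ∘ Sum.inl)) * rename Sum.inr (Q (Z ∘ Sum.inr)) *
    formalExp (linForm (fieldValues φ Z)) * crossForm H Z ^ n)

theorem continuous_pairingCoeff (H : C(Spacetime, ℂ)) (N : ι →₀ ℕ) (M : κ →₀ ℕ)
    (hP : CoeffContinuous P) (hQ : CoeffContinuous Q) (φ : FieldConfig) (n : ℕ) :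
    Continuous (pairingCoeff H N M P Q φ n) :=
  (((((hP.comp continuous_comp_inl).rename _).mul ((hQ.comp continuous_comp_inr).rename _)).mul
    (CoeffContinuous.linForm (continuous_fieldValues φ)).formalExp).mul
    ((coeffContinuous_crossForm H).pow n)) _

/-- The n-th power of the bilinear form expands over pairs of maps choosing the two ends of each of
n lines. For each pair the series is a product of one in the left and one in the right variables,
whose coefficients are the two derivatives. -/
theorem pairingCoeff_eq_sum (H : C(Spacetime, ℂ)) (N : ι →₀ ℕ) (M : κ →₀ ℕ)
    (P : (ι → Spacetime) → MvPowerSeries ι ℂ) (Q : (κ → Spacetime) → MvPowerSeries κ ℂ)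
    (φ : FieldConfig) (n : ℕ) (x : ι → Spacetime) (y : κ → Spacetime) :
    pairingCoeff H N M P Q φ n (Sum.elim x y) =
      ∑ i : Fin n → ι, ∑ j : Fin n → κ, derivCoeff N P φ i x * (derivCoeff M Q φ j y *
        ∏ s, H (x (i s) - y (j s))) := by
  classical
  have h1 : crossForm H (Sum.elim x y) ^ n = ∑ i : Fin n → ι, ∑ j : Fin n → κ,
      C (∏ s, H (x (i s) - y (j s))) *
        (rename Sum.inl (∏ s, X (i s)) * rename Sum.inr (∏ s, X (j s))) := by
    rw [← Fin.prod_const, crossForm, Finset.prod_univ_sum, Fintype.piFinset_univ,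
      ← Fintype.sum_prod_type', ← (Equiv.arrowProdEquivProdArrow (Fin n) _ _).sum_comp]
    refine Finset.sum_congr rfl fun e _ => ?_
    simp [Finset.prod_mul_distrib, map_prod]
  have h2 : fieldValues φ (Sum.elim x y) = Sum.elim (fieldValues φ x) (fieldValues φ y) := by
    ext (i | i) <;> rfl
  rw [pairingCoeff, h1, h2, rename_inl_linForm, formalExp_add (by simp) (by simp),
    formalExp_rename (by simp), formalExp_rename (by simp), Finset.mul_sum, map_sum]
  refine Finset.sum_congr rfl fun i _ => ?_
  rw [Finset.mul_sum, map_sum]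
  refine Finset.sum_congr rfl fun j _ => ?_
  rw [mul_left_comm, coeff_C_mul, Sum.elim_comp_inl, Sum.elim_comp_inr]
  rw [show ∀ a b c d e g : MvPowerSeries (ι ⊕ κ) ℂ, a * b * (c * d) * (e * g) =
    (a * c * e) * (b * d * g) by intros; ring]
  simp only [← map_mul]
  rw [coeff_sumElim_rename_mul_rename, derivCoeff, derivCoeff]
  ring

variable {f : (ι → Spacetime) → ℂ} {g : (κ → Spacetime) → ℂ}

theorem tensorPairing_kernelDeriv (H : C(Spacetime, ℂ)) (N : ι →₀ ℕ) (M : κ →₀ ℕ)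
    (hf : Continuous f) (hfc : HasCompactSupport f) (hP : CoeffContinuous P)
    (hg : Continuous g) (hgc : HasCompactSupport g) (hQ : CoeffContinuous Q)
    (φ : FieldConfig) (n : ℕ) :
    tensorPairing (kernelDeriv hf hfc hP N n φ) (kernelDeriv hg hgc hQ M n φ) (kernelPower H n) =
      ∫ Z, tensorFun f g Z * pairingCoeff H N M P Q φ n Z := by
  rw [integral_sum_pi (integrable_mul_of_compactSupport (continuous_tensorFun hf hg)
    (hasCompactSupport_tensorFun hfc hgc) (continuous_pairingCoeff H N M hP hQ φ n))]
  change ∫ x, _ * _ = _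
  congr 1; ext x
  have hint : ∀ i : Fin n → ι, Integrable fun y : κ → Spacetime => g y *
      (derivCoeff N P φ i x * ∑ j : Fin n → κ, derivCoeff M Q φ j y *
        ∏ s, H (x (i s) - y (j s))) := by
    intro i
    refine integrable_mul_of_compactSupport hg hgc (continuous_const.mul
      (continuous_finsetSum _ fun j _ => (continuous_derivCoeff hQ φ j).mul ?_))
    fun_prop
  calc f x * ∑ i : Fin n → ι, derivCoeff N P φ i x *
        ∫ y, g y * ∑ j : Fin n → κ, derivCoeff M Q φ j y * ∏ s, H (x (i s) - y (j s))
      = f x * ∫ y, ∑ i : Fin n → ι, g y * (derivCoeff N P φ i x *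
          ∑ j : Fin n → κ, derivCoeff M Q φ j y * ∏ s, H (x (i s) - y (j s))) := by
        rw [integral_finsetSum _ fun i _ => hint i]
        congr 1
        refine Finset.sum_congr rfl fun i _ => ?_
        rw [← integral_const_mul]
        congr 1; ext y; ring
    _ = _ := by
        rw [← integral_const_mul]
        congr 1; ext y
        rw [pairingCoeff_eq_sum, tensorFun, Sum.elim_comp_inl, Sum.elim_comp_inr, mul_assoc,
          Finset.mul_sum]
        simp only [Finset.mul_sum]

/-- The order-n term inserts the n-th power of the bilinear form over n!, so the sum over n is its
formal exponential. Orders above the total degree vanish, which makes the sum finite. -/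
theorem expProd_kernelFunctional (H : C(Spacetime, ℂ)) (N : ι →₀ ℕ) (M : κ →₀ ℕ)
    (hf : Continuous f) (hfc : HasCompactSupport f) (hP : CoeffContinuous P)
    (hg : Continuous g) (hgc : HasCompactSupport g) (hQ : CoeffContinuous Q) :
    expProd H (kernelFunctional N f P) (kernelFunctional M g Q) =
      kernelFunctional (N.sumElim M) (tensorFun f g) (prodSeries H P Q) := by
  ext φ
  set R := (N.sumElim M).degree + 1 with hR
  have hterm : ∀ n, (1 / (n.factorial : ℂ)) *
      tensorPairing (functionalDeriv (kernelFunctional N f P) n φ)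
        (functionalDeriv (kernelFunctional M g Q) n φ) (kernelPower H n) =
      ∫ Z, tensorFun f g Z * ((n.factorial : ℂ)⁻¹ * pairingCoeff H N M P Q φ n Z) := by
    intro n
    rw [functionalDeriv_kernelFunctional hf hfc hP, functionalDeriv_kernelFunctional hg hgc hQ,
      tensorPairing_kernelDeriv, one_div, ← integral_const_mul]
    congr 1; ext Z; ring
  simp only [expProd, hterm]
  rw [tsum_eq_sum (s := Finset.range R)]
  · rw [← integral_finsetSum]
    · simp only [kernelFunctional, prodSeries]
      congr 1; ext Z
      rw [mul_right_comm, coeff_mul_formalExp _ (by simp) (show _ < R from Nat.lt_succ_self _),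
        Finset.mul_sum]
      rfl
    · intro n _
      exact integrable_mul_of_compactSupport (continuous_tensorFun hf hg)
        (hasCompactSupport_tensorFun hfc hgc)
        (continuous_const.mul (continuous_pairingCoeff H N M hP hQ φ n))
  · intro n hn
    have : ∀ Z, pairingCoeff H N M P Q φ n Z = 0 := by
      intro Z
      rw [pairingCoeff, mul_comm]
      exact coeff_pow_mul_eq_zero_of_degree_lt (by simp) _ (by simpa [hR] using hn)
    simp [this]

end KernelProduct

/-! ### Functionals of complete graphs -/

section GraphFunctional

open MvPowerSeries

/-- The vertices of a graph belong to `S(V)⁻¹`, to `S(V)`, or to the observable. -/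
inductive VertexKind : Type
  | anti
  | time
  | obs

open VertexKind

variable {m l : ℝ} (hm : 0 < m) (hl : 0 < l)

theorem modFeynman_of_nonneg {x : Spacetime} (hx : 0 ≤ x.1) :
    modFeynman hm hl x = modTwoPoint hm hl x := if_pos hx

theorem modFeynman_neg (x : Spacetime) : modFeynman hm hl (-x) = modFeynman hm hl x := by
  change modFeynmanFun m l (-x) = modFeynmanFun m l x
  unfold modFeynmanFun
  rcases lt_trichotomy x.1 0 with h | h | h
  · rw [if_pos (by simpa using h.le), if_neg (by simpa using h)]
  · rw [if_pos (by simp [h]), if_pos h.ge, modTwoPointFun_neg_of_time_zero m hl x h]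
  · rw [if_neg (by simpa using h), if_pos h.le, neg_neg]

/-- The reflected two-point function `x ↦ Δ_{+,l}(-x)`. -/
def modTwoPointNeg : C(Spacetime, ℂ) := (modTwoPoint hm hl).comp ⟨fun x => -x, continuous_neg⟩

/-- The anti-Feynman propagator. -/
def modAntiFeynman : C(Spacetime, ℂ) := modTwoPoint hm hl + modTwoPointNeg hm hl - modFeynman hm hl

/-- The propagator joining vertices of given kinds. -/
def linePropagator : VertexKind → VertexKind → C(Spacetime, ℂ)
  | obs, obs => 0
  | anti, anti => modAntiFeynman hm hl
  | anti, time => modTwoPoint hm hl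
  | anti, obs => modTwoPoint hm hl
  | time, anti => modTwoPointNeg hm hl
  | obs, anti => modTwoPointNeg hm hl
  | time, time => modFeynman hm hl
  | time, obs => modFeynman hm hl
  | obs, time => modFeynman hm hl

theorem linePropagator_neg (a b : VertexKind) (x : Spacetime) :
    linePropagator hm hl a b (-x) = linePropagator hm hl b a x := by
  cases a <;> cases b <;> simp [linePropagator, modTwoPointNeg, modAntiFeynman, modFeynman_neg,
    add_comm]

/-- At nonnegative time Δ_F equals Δ₊, and therefore the anti-Feynman propagator equals Δ₊(-x).
These are exactly the values assigned to the other kind. -/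
theorem linePropagator_anti_eq_time (b : VertexKind) {x : Spacetime} (hx : 0 ≤ x.1) :
    linePropagator hm hl anti b x = linePropagator hm hl time b x := by
  cases b <;> simp [linePropagator, modTwoPointNeg, modAntiFeynman, modFeynman_of_nonneg hm hl hx]

variable {ι κ : Type} [Fintype ι] [Fintype κ]

open Classical in
/-- The matrix of propagators of the complete graph. -/
def graphKernel (k : ι → VertexKind) (Z : ι → Spacetime) (i j : ι) : ℂ :=
  if i = j then 0 else linePropagator hm hl (k i) (k j) (Z i - Z j)

omit [Fintype ι] in
theorem continuous_graphKernel (k : ι → VertexKind) (i j : ι) :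
    Continuous fun Z => graphKernel hm hl k Z i j := by
  unfold graphKernel
  split_ifs
  · exact continuous_const
  · fun_prop

/-- The quadratic form `½ ∑ Kᵢⱼ aᵢ aⱼ`. -/
def quadForm (K : ι → ι → ℂ) : MvPowerSeries ι ℂ := ∑ i, ∑ j, C (K i j / 2) * (X i * X j)

@[simp] theorem constantCoeff_quadForm (K : ι → ι → ℂ) : constantCoeff (quadForm K) = 0 := by
  simp [quadForm]

theorem rename_quadForm (e : ι ≃ κ) (K : κ → κ → ℂ) :
    rename e (quadForm fun i j => K (e i) (e j)) = quadForm K := by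
  simp only [quadForm, map_sum, map_mul, rename_C, rename_X]
  rw [← e.sum_comp]
  exact Finset.sum_congr rfl fun i _ => by rw [← e.sum_comp]

theorem coeffContinuous_quadForm {T : Type*} [TopologicalSpace T] {K : T → ι → ι → ℂ}
    (hK : ∀ i j, Continuous fun x => K x i j) : CoeffContinuous fun x => quadForm (K x) :=
  CoeffContinuous.sum _ fun i _ => CoeffContinuous.sum _ fun j _ =>
    CoeffContinuous.C_mul ((hK i j).div_const 2) (CoeffContinuous.const _)

/-- The generating function of the complete graph. -/
def graphSeries (k : ι → VertexKind) (Z : ι → Spacetime) : MvPowerSeries ι ℂ :=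
  formalExp (quadForm (graphKernel hm hl k Z))

theorem coeffContinuous_graphSeries (k : ι → VertexKind) :
    CoeffContinuous (graphSeries hm hl k) :=
  (coeffContinuous_quadForm (continuous_graphKernel hm hl k)).formalExp

/-- All factors are exponentials, so the exponents add. The bilinear form supplies the two
off-diagonal blocks of the joint matrix, which agree because reversing a line reflects its
propagator. -/
theorem prodSeries_graphSeries {H : C(Spacetime, ℂ)} {a : ι → VertexKind} {b : κ → VertexKind}
    (hH : ∀ i j, linePropagator hm hl (a i) (b j) = H) :
    prodSeries H (graphSeries hm hl a) (graphSeries hm hl b) =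
      graphSeries hm hl (Sum.elim a b) := by
  classical
  ext1 Z
  rw [prodSeries, graphSeries, graphSeries, graphSeries, ← formalExp_rename (by simp),
    ← formalExp_rename (by simp), ← formalExp_add (by simp) (by simp),
    ← formalExp_add (by simp) (by simp)]
  congr 1
  have h1 : ∀ i j, graphKernel hm hl (Sum.elim a b) Z (.inl i) (.inl j) =
      graphKernel hm hl a (Z ∘ Sum.inl) i j := fun i j => by
    simp [graphKernel]
  have h2 : ∀ i j, graphKernel hm hl (Sum.elim a b) Z (.inr i) (.inr j) =
      graphKernel hm hl b (Z ∘ Sum.inr) i j := fun i j => by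
    simp [graphKernel]
  have h3 : ∀ i j, graphKernel hm hl (Sum.elim a b) Z (.inl i) (.inr j) =
      H (Z (.inl i) - Z (.inr j)) := fun i j => by
    simp [graphKernel, hH]
  have h4 : ∀ i j, graphKernel hm hl (Sum.elim a b) Z (.inr j) (.inl i) =
      H (Z (.inl i) - Z (.inr j)) := fun i j => by
    rw [← hH i j, ← linePropagator_neg]
    simp [graphKernel]
  -- Each crossing line occurs twice in the quadratic form, once in each direction and each time
  -- with weight one half.
  have h5 : ∀ z : ℂ, (C z : MvPowerSeries (ι ⊕ κ) ℂ) = C (z / 2) + C (z / 2) := fun z => by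
    rw [← map_add, add_halves]
  simp only [quadForm, crossForm, Fintype.sum_sum_type, h1, h2, h3, h4, map_sum, map_mul,
    rename_C, rename_X, Fintype.sum_prod_type, Finset.sum_add_distrib]
  rw [Finset.sum_comm (s := (Finset.univ : Finset κ)) (t := (Finset.univ : Finset ι))]
  simp only [fun i j => h5 (H (Z (.inl i) - Z (.inr j))), add_mul, Finset.sum_add_distrib]
  simp only [fun i j => mul_comm (X (Sum.inr j) : MvPowerSeries (ι ⊕ κ) ℂ) (X (Sum.inl i))]
  ring

/-- The functional of a complete graph with degrees `N` and weight `f`. -/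
def graphFunctional (k : ι → VertexKind) (N : ι →₀ ℕ) (f : (ι → Spacetime) → ℂ) : Functional :=
  kernelFunctional N f (graphSeries hm hl k)

theorem expProd_graphFunctional {H : C(Spacetime, ℂ)} {a : ι → VertexKind} {b : κ → VertexKind}
    (hH : ∀ i j, linePropagator hm hl (a i) (b j) = H) (N : ι →₀ ℕ) (M : κ →₀ ℕ)
    {f : (ι → Spacetime) → ℂ} {g : (κ → Spacetime) → ℂ}
    (hf : Continuous f) (hfc : HasCompactSupport f) (hg : Continuous g)
    (hgc : HasCompactSupport g) :
    expProd H (graphFunctional hm hl a N f) (graphFunctional hm hl b M g) =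
      graphFunctional hm hl (Sum.elim a b) (N.sumElim M) (tensorFun f g) := by
  rw [graphFunctional, graphFunctional, expProd_kernelFunctional H N M hf hfc
    (coeffContinuous_graphSeries hm hl a) hg hgc (coeffContinuous_graphSeries hm hl b),
    prodSeries_graphSeries hm hl hH]
  rfl

theorem smul_graphFunctional (c : ℂ) (k : ι → VertexKind) (N : ι →₀ ℕ)
    (f : (ι → Spacetime) → ℂ) :
    c • graphFunctional hm hl k N f = graphFunctional hm hl k N (c • f) := by
  ext φ
  simp only [Pi.smul_apply, graphFunctional, kernelFunctional, smul_eq_mul]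
  rw [← integral_const_mul]
  congr 1; ext X; ring

/-- Only the labelled graph matters, not the index type. This later identifies products indexed by
`Fin j ⊕ Fin (k - j)` with subsets of `Fin k`. -/
theorem graphFunctional_reindex (e : ι ≃ κ) {a : ι → VertexKind} {b : κ → VertexKind}
    {N : ι →₀ ℕ} {M : κ →₀ ℕ} {f : (ι → Spacetime) → ℂ} {g : (κ → Spacetime) → ℂ}
    (hab : ∀ i, b (e i) = a i) (hNM : ∀ i, M (e i) = N i)
    (hfg : ∀ Z : κ → Spacetime, g Z = f (Z ∘ e)) :
    graphFunctional hm hl a N f = graphFunctional hm hl b M g := by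
  classical
  obtain rfl : a = b ∘ e := funext fun i => (hab i).symm
  obtain rfl : M = N.mapDomain e := by
    ext j
    rw [← e.apply_symm_apply j, hNM, Finsupp.mapDomain_apply e.injective]
  ext φ
  have hmp := volume_measurePreserving_piCongrLeft (fun _ : κ => Spacetime) e
  rw [graphFunctional, graphFunctional, kernelFunctional, kernelFunctional,
    ← hmp.integral_comp (MeasurableEquiv.measurableEmbedding _)]
  congr 1; ext X
  obtain ⟨Z, rfl⟩ : ∃ Z : κ → Spacetime, X = Z ∘ e :=
    ⟨X ∘ e.symm, by ext1 i; simp⟩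
  have hZ : MeasurableEquiv.piCongrLeft (fun _ : κ => Spacetime) e (Z ∘ e) = Z := by
    ext1 j
    obtain ⟨i, rfl⟩ := e.surjective j
    exact Equiv.piCongrLeft_apply_apply (fun _ : κ => Spacetime) e _ i
  rw [hZ, hfg, ← coeff_mapDomain_rename_equiv e, map_mul, graphSeries, graphSeries,
    ← formalExp_rename (by simp), ← formalExp_rename (by simp)]
  have h1 : rename e (quadForm (graphKernel hm hl (b ∘ e) (Z ∘ e))) =
      quadForm (graphKernel hm hl b Z) := by
    rw [← rename_quadForm e]
    congr 2
    ext i j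
    simp [graphKernel]
  have h2 : rename e (linForm (fieldValues φ (Z ∘ e))) = linForm (fieldValues φ Z) := by
    simp only [linForm, map_sum, map_mul, rename_C, rename_X]
    rw [← e.sum_comp]
    rfl
  rw [h1, h2]

/-! ### Interaction vertices and observables -/

/-- All degrees equal to `n`. -/
def constDegree (ι : Type) [Finite ι] (n : ℕ) : ι →₀ ℕ := Finsupp.equivFunOnFinite.symm fun _ => n

@[simp] theorem constDegree_apply (n : ℕ) (i : ι) : constDegree ι n i = n := rfl

/-- The weight `∏ g(xᵢ)`. -/
def prodWeight (ι : Type) [Fintype ι] (g : Spacetime → ℂ) (X : ι → Spacetime) : ℂ := ∏ i, g (X i)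

theorem continuous_prodWeight {g : Spacetime → ℂ} (hg : Continuous g) :
    Continuous (prodWeight ι g) := by
  unfold prodWeight; fun_prop

theorem hasCompactSupport_prodWeight {g : Spacetime → ℂ} (hg : HasCompactSupport g) :
    HasCompactSupport (prodWeight ι g) := by
  refine HasCompactSupport.intro (isCompact_univ_pi fun _ : ι => hg.isCompact) fun X hX => ?_
  simp only [Set.mem_pi, Set.mem_univ, true_imp_iff, not_forall] at hX
  obtain ⟨i, hi⟩ := hX
  exact Finset.prod_eq_zero (Finset.mem_univ i) (image_eq_zero_of_notMem_tsupport hi)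

/-- Observable points are not joined to each other, so the graph series is 1. The factorials in the
weight undo those in the coefficients of the exponential. -/
theorem multilocal_eq_graphFunctional {ℓ : ℕ} (f : (Fin ℓ → Spacetime) → ℂ) (N : Fin ℓ → ℕ) :
    multilocal f N = graphFunctional hm hl (fun _ => obs) (Finsupp.equivFunOnFinite.symm N)
      ((∏ i, ((N i).factorial : ℂ)) • f) := by
  ext φ
  have h : ∀ Z : Fin ℓ → Spacetime, graphSeries hm hl (fun _ => obs) Z = 1 := by
    intro Z
    have : graphKernel hm hl (fun _ : Fin ℓ => obs) Z = 0 := by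
      ext i j; simp [graphKernel, linePropagator]
    rw [graphSeries, this, show quadForm (0 : Fin ℓ → Fin ℓ → ℂ) = 0 by simp [quadForm],
      formalExp_zero]
  simp only [graphFunctional, kernelFunctional, multilocal, h, one_mul, coeff_formalExp_linForm,
    Pi.smul_apply, smul_eq_mul]
  congr 1; ext X
  rw [mul_assoc, mul_left_comm, ← Finset.prod_mul_distrib]
  congr 1
  refine Finset.prod_congr rfl fun i _ => ?_
  have : ((N i).factorial : ℂ) ≠ 0 := by exact_mod_cast Nat.factorial_ne_zero _
  simp only [Finsupp.equivFunOnFinite_symm_apply_apply, fieldValues]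
  field_simp

theorem interaction_eq_graphFunctional (n : ℕ) (g : Spacetime → ℝ) :
    interaction n g = graphFunctional hm hl (fun _ : Fin 1 => time) (constDegree (Fin 1) n)
      (prodWeight (Fin 1) fun x => (n.factorial : ℂ) * g x) := by
  ext φ
  have h : ∀ Z : Fin 1 → Spacetime, graphSeries hm hl (fun _ => time) Z = 1 := by
    intro Z
    have : graphKernel hm hl (fun _ : Fin 1 => time) Z = 0 := by
      ext i j; simp [graphKernel, Subsingleton.elim i j]
    rw [graphSeries, this, show quadForm (0 : Fin 1 → Fin 1 → ℂ) = 0 by simp [quadForm],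
      formalExp_zero]
  have hmp := volume_preserving_funUnique (Fin 1) Spacetime
  simp only [graphFunctional, kernelFunctional, interaction, h, one_mul, coeff_formalExp_linForm]
  rw [← hmp.integral_comp (MeasurableEquiv.measurableEmbedding _)]
  congr 1; ext X
  have : (n.factorial : ℂ) ≠ 0 := by exact_mod_cast Nat.factorial_ne_zero _
  simp only [prodWeight, Finset.univ_unique, Finset.prod_singleton, fieldValues,
    constDegree_apply]
  change (g (X default) : ℂ) * ((φ : Spacetime → ℝ) (X default) : ℂ) ^ n = _
  field_simp

theorem one_eq_graphFunctional (k : Fin 0 → VertexKind) (n : ℕ) (g : Spacetime → ℂ) :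
    (1 : Functional) =
      graphFunctional hm hl k (constDegree (Fin 0) n) (prodWeight (Fin 0) g) := by
  ext φ
  have h : ∀ Z : Fin 0 → Spacetime, graphSeries hm hl k Z = 1 := by
    intro Z
    rw [graphSeries, show quadForm (graphKernel hm hl k Z) = 0 by simp [quadForm],
      formalExp_zero]
  simp only [graphFunctional, kernelFunctional, h, one_mul, coeff_formalExp_linForm, prodWeight,
    Finset.univ_eq_empty, Finset.prod_empty]
  simp [volume_pi, Measure.pi_of_empty (fun _ : Fin 0 => (volume : Measure Spacetime))]

end GraphFunctional

/-! ### Cancellation of the vertex with the latest time -/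

section LatestVertex

open MvPowerSeries VertexKind

variable {m l : ℝ} (hm : 0 < m) (hl : 0 < l) {ι κ : Type} [Fintype ι] [Fintype κ]

/-- The vertices in `J` belong to `S(V)⁻¹`, the others to `S(V)`. -/
def subsetKind [DecidableEq ι] (J : Finset ι) (i : ι) : VertexKind := if i ∈ J then anti else time

open Classical in
/-- The matrix `K` with the entries joining `S` to its complement deleted. -/
def cutMatrix (S : Set ι) (K : ι → ι → ℂ) (i j : ι) : ℂ := if i ∈ S ↔ j ∈ S then K i j else 0

-- Changing the kind of `v` affects only lines ending at `v`. Those surviving the cut have their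
-- other end in `S`, at a time no later than that of `v`, where the two kinds have equal
-- propagators.
omit [Fintype ι] in
theorem cutMatrix_graphKernel_congr {S : Set ι} {v : ι} (hv : v ∈ S) {Z : ι → Spacetime}
    (hZ : ∀ j ∈ S, (Z j).1 ≤ (Z v).1) {a b : ι → VertexKind} (hab : ∀ j, j ≠ v → a j = b j)
    (ha : a v = anti) (hb : b v = time) :
    cutMatrix S (graphKernel hm hl a Z) = cutMatrix S (graphKernel hm hl b Z) := by
  have key : ∀ j ∈ S, j ≠ v → graphKernel hm hl a Z v j = graphKernel hm hl b Z v j := by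
    intro j hj hjv
    simp only [graphKernel, if_neg hjv.symm, ha, hb, hab j hjv]
    exact linePropagator_anti_eq_time hm hl _ (by simpa using hZ j hj)
  have symm : ∀ (c : ι → VertexKind) (i j : ι),
      graphKernel hm hl c Z i j = graphKernel hm hl c Z j i := by
    intro c i j
    unfold graphKernel
    by_cases h : i = j
    · rw [if_pos h, if_pos h.symm]
    · rw [if_neg h, if_neg (Ne.symm h), ← linePropagator_neg, neg_sub]
  ext i j
  unfold cutMatrix
  split_ifs with h
  · by_cases hi : i = v
    · subst hi
      by_cases hj : j = i
      · subst hj; simp [graphKernel]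
      · exact key j (h.1 hv) hj
    · by_cases hj : j = v
      · subst hj
        rw [symm a, symm b]
        exact key i (h.2 hv) hi
      · simp only [graphKernel, hab i hi, hab j hj]
  · rfl

/-- Toggling the membership of `v` is a fixed-point-free involution that reverses the sign and
preserves `F`. -/
theorem sum_neg_one_pow_card_mul_eq_zero {R : Type*} [Ring R] [DecidableEq ι] (v : ι)
    (F : Finset ι → R) (hF : ∀ J, v ∉ J → F (insert v J) = F J) :
    ∑ J : Finset ι, (-1) ^ J.card * F J = 0 := by
  refine Finset.sum_involution (fun J _ => if v ∈ J then J.erase v else insert v J) ?_ ?_ ?_ ?_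
  · intro J _
    split_ifs with h
    · have h1 : F J = F (J.erase v) := by
        rw [← hF _ (Finset.notMem_erase v J), Finset.insert_erase h]
      rw [h1, ← Finset.card_erase_add_one h, pow_succ]
      noncomm_ring
    · rw [hF J h, Finset.card_insert_of_notMem h, pow_succ]
      noncomm_ring
  · intro J _ _
    split_ifs with h
    · exact fun h' => Finset.notMem_erase v J (by rw [h']; exact h)
    · exact fun h' => h (h' ▸ Finset.mem_insert_self v J)
  · intro J _; exact Finset.mem_univ _
  · intro J _
    by_cases h : v ∈ J
    · simp [h]
    · simp [h]

omit [Fintype κ] in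
/-- If `S` is a nonempty set of interaction vertices and the lines joining it to the other vertices
are deleted, then the signed sum over all kinds of interaction vertices vanishes. -/
theorem sum_cutMatrix_eq_zero {R : Type*} [Ring R] [DecidableEq ι] (S : Set ι) (hS : S.Nonempty)
    (c : κ → VertexKind) (Z : ι ⊕ κ → Spacetime) (F : (ι ⊕ κ → ι ⊕ κ → ℂ) → R) :
    ∑ J : Finset ι, (-1) ^ J.card *
      F (cutMatrix (Sum.inl '' S) (graphKernel hm hl (Sum.elim (subsetKind J) c) Z)) = 0 := by
  -- `v` is a latest vertex of `S`. It may be earlier than vertices outside `S`, since the lines to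
  -- those are cut.
  obtain ⟨v, hv, hmax⟩ := S.toFinite.exists_maximalFor (fun i => (Z (.inl i)).1) S hS
  refine sum_neg_one_pow_card_mul_eq_zero v _ fun J hJ => ?_
  congr 1
  refine cutMatrix_graphKernel_congr hm hl (S := Sum.inl '' S) (v := .inl v) ⟨v, hv, rfl⟩ ?_ ?_ ?_ ?_
  · rintro _ ⟨j, hj, rfl⟩
    rcases le_total (Z (.inl j)).1 (Z (.inl v)).1 with h | h
    · exact h
    · exact hmax hj h
  · rintro (j | j) hj
    · have : j ≠ v := fun h => hj (by rw [h])
      simp [subsetKind, this]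
    · rfl
  · simp [subsetKind]
  · simp [subsetKind, hJ]

/-- With interaction vertices only, the latest one is later than all its neighbours and no cut is
needed. Integrated, this is the order-by-order identity for the inverse of S(V). -/
theorem sum_graphSeries_eq_zero [DecidableEq ι] [Nonempty ι] (Z : ι → Spacetime) :
    ∑ J : Finset ι, (-1) ^ J.card * graphSeries hm hl (subsetKind J) Z = 0 := by
  obtain ⟨v, -, hmax⟩ := (Set.toFinite (Set.univ : Set ι)).exists_maximalFor
    (fun i => (Z i).1) Set.univ Set.univ_nonempty
  refine sum_neg_one_pow_card_mul_eq_zero v _ fun J hJ => ?_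
  have huniv : ∀ K : ι → ι → ℂ, cutMatrix Set.univ K = K := fun K => by
    ext i j; simp [cutMatrix]
  rw [graphSeries, graphSeries, ← huniv (graphKernel hm hl _ Z),
    ← huniv (graphKernel hm hl (subsetKind J) Z)]
  congr 2
  refine cutMatrix_graphKernel_congr hm hl (Set.mem_univ v) ?_ ?_ ?_ ?_
  · intro j _
    rcases le_total (Z j).1 (Z v).1 with h | h
    · exact h
    · exact hmax (Set.mem_univ j) h
  · intro j hj
    simp [subsetKind, hj]
  · simp [subsetKind]
  · simp [subsetKind, hJ]

end LatestVertex

/-! ### The Bogoliubov map as a sum over graphs -/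

section Series

open VertexKind

variable {m l : ℝ} (hm : 0 < m) (hl : 0 < l)

/-- There are k choose j subsets of size j, which turns 1 / (j! (k - j)!) into 1 / k!. The sign
comes from iʲ = (-1)ʲ (-i)ʲ. -/
theorem sum_range_eq_sum_finset {E : Type*} [AddCommGroup E] [Module ℂ E] (k : ℕ) (a : ℕ → E) :
    ∑ j ∈ Finset.range (k + 1), ((Complex.I ^ j / (j.factorial : ℂ)) *
      ((-Complex.I) ^ (k - j) / ((k - j).factorial : ℂ))) • a j =
    ((-Complex.I) ^ k / (k.factorial : ℂ)) • ∑ J : Finset (Fin k), (-1 : ℂ) ^ J.card • a J.card := by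
  have h := Finset.sum_powerset_apply_card (fun j => (-1 : ℂ) ^ j • a j)
    (x := (Finset.univ : Finset (Fin k)))
  rw [Finset.powerset_univ] at h
  rw [h, Finset.card_univ, Fintype.card_fin, Finset.smul_sum]
  refine Finset.sum_congr rfl fun j hj => ?_
  have hjk : j ≤ k := Nat.lt_succ_iff.1 (Finset.mem_range.1 hj)
  rw [← Nat.cast_smul_eq_nsmul ℂ, smul_smul, smul_smul]
  congr 1
  have h1 : (-Complex.I) ^ k = (-Complex.I) ^ j * (-Complex.I) ^ (k - j) := by
    rw [← pow_add, Nat.add_sub_cancel' hjk]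
  have h2 : (Complex.I : ℂ) ^ j = (-1) ^ j * (-Complex.I) ^ j := by
    rw [← mul_pow]; simp
  have h3 : (k.factorial : ℂ) = (k.choose j : ℂ) * (j.factorial : ℂ) * ((k - j).factorial : ℂ) := by
    exact_mod_cast (Nat.choose_mul_factorial_mul_factorial hjk).symm
  have f1 : (j.factorial : ℂ) ≠ 0 := by exact_mod_cast Nat.factorial_ne_zero _
  have f2 : ((k - j).factorial : ℂ) ≠ 0 := by exact_mod_cast Nat.factorial_ne_zero _
  have f3 : (k.choose j : ℂ) ≠ 0 := by exact_mod_cast (Nat.choose_pos hjk).ne'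
  rw [h1, h2, h3]
  field_simp

variable (n : ℕ) {g : Spacetime → ℝ}

/-- The weight of an interaction vertex. -/
def vertexWeight (n : ℕ) (g : Spacetime → ℝ) (x : Spacetime) : ℂ := (n.factorial : ℂ) * g x

theorem continuous_vertexWeight (hg : Continuous g) : Continuous (vertexWeight n g) := by
  unfold vertexWeight; fun_prop

theorem hasCompactSupport_vertexWeight (hg : HasCompactSupport g) :
    HasCompactSupport (vertexWeight n g) :=
  HasCompactSupport.mul_left (f := fun _ => (n.factorial : ℂ))
    (hg.comp_left (g := ((↑) : ℝ → ℂ)) Complex.ofReal_zero)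

variable {ι κ : Type} [Fintype ι] [Fintype κ]

/-- The functional of a complete graph of interaction vertices. -/
def vertexFunctional (n : ℕ) (g : Spacetime → ℝ) (a : ι → VertexKind) : Functional :=
  graphFunctional hm hl a (constDegree ι n) (prodWeight ι (vertexWeight n g))

theorem expProd_vertexFunctional (hg : Continuous g) (hgc : HasCompactSupport g)
    {H : C(Spacetime, ℂ)} {a : ι → VertexKind} {b : κ → VertexKind}
    (hH : ∀ i j, linePropagator hm hl (a i) (b j) = H) (c d : ℂ) :
    expProd H (c • vertexFunctional hm hl n g a) (d • vertexFunctional hm hl n g b) =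
      (c * d) • vertexFunctional hm hl n g (Sum.elim a b) := by
  have hw := continuous_vertexWeight n hg
  have hwc := hasCompactSupport_vertexWeight n hgc
  rw [vertexFunctional, vertexFunctional, vertexFunctional, smul_graphFunctional,
    smul_graphFunctional, smul_graphFunctional, expProd_graphFunctional hm hl hH _ _
      ((continuous_prodWeight hw).const_smul c) ((hasCompactSupport_prodWeight hwc).smul_left)
      ((continuous_prodWeight hw).const_smul d) ((hasCompactSupport_prodWeight hwc).smul_left)]
  congr 1
  · ext (i | i) <;> rfl
  · ext Z
    simp only [tensorFun, prodWeight, Pi.smul_apply, smul_eq_mul, Fintype.prod_sum_type,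
      Function.comp_apply]
    ring

theorem vertexFunctional_reindex (e : ι ≃ κ) {a : ι → VertexKind} {b : κ → VertexKind}
    (hab : ∀ i, b (e i) = a i) :
    vertexFunctional hm hl n g a = vertexFunctional hm hl n g b :=
  graphFunctional_reindex hm hl e hab (fun _ => rfl) fun Z => by
    rw [prodWeight, prodWeight, ← e.prod_comp]; rfl

theorem timePow_interaction (hg : Continuous g) (hgc : HasCompactSupport g) (k : ℕ) :
    timePow hm hl (interaction n g) k = vertexFunctional hm hl n g fun _ : Fin k => time := by
  induction k with
  | zero => exact one_eq_graphFunctional hm hl _ n _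
  | succ k ih =>
    have h1 : interaction n g = (1 : ℂ) • vertexFunctional hm hl n g fun _ : Fin 1 => time := by
      rw [one_smul]; exact interaction_eq_graphFunctional hm hl n g
    rw [timePow, ih, h1, ← one_smul ℂ (vertexFunctional hm hl n g fun _ : Fin k => time),
      timeProd,
      expProd_vertexFunctional hm hl n hg hgc (H := modFeynman hm hl) (fun _ _ => rfl),
      one_mul, one_smul]
    exact vertexFunctional_reindex hm hl n finSumFinEquiv (by rintro (i | i) <;> rfl)

theorem sMatrix_interaction (hg : Continuous g) (hgc : HasCompactSupport g) (k : ℕ) :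
    sMatrix hm hl (interaction n g) k = ((-Complex.I) ^ k / (k.factorial : ℂ)) •
      vertexFunctional hm hl n g fun _ : Fin k => time := by
  rw [sMatrix, timePow_interaction hm hl n hg hgc]

/-- The bijection of `Fin #J ⊕ Fin (k - #J)` with `Fin k` taking the first summand to `J`. -/
def finsetSumEquiv {k : ℕ} (J : Finset (Fin k)) : Fin J.card ⊕ Fin (k - J.card) ≃ Fin k :=
  finSumEquivOfFinset rfl (by rw [Finset.card_compl, Fintype.card_fin])

theorem subsetKind_finsetSumEquiv {k : ℕ} (J : Finset (Fin k))
    (i : Fin J.card ⊕ Fin (k - J.card)) : subsetKind J (finsetSumEquiv J i) =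
      Sum.elim (fun _ => anti) (fun _ => time) i := by
  rcases i with i | i
  · rw [finsetSumEquiv, finSumEquivOfFinset_inl, subsetKind, if_pos (Finset.orderEmbOfFin_mem ..)]
    rfl
  · rw [finsetSumEquiv, finSumEquivOfFinset_inr, subsetKind, if_neg]
    · rfl
    · exact Finset.mem_compl.1 (Finset.orderEmbOfFin_mem ..)

theorem sum_vertexFunctional_eq_zero (hg : Continuous g) (hgc : HasCompactSupport g) (k : ℕ) :
    ∑ J : Finset (Fin (k + 1)), (-1 : ℂ) ^ J.card • vertexFunctional hm hl n g (subsetKind J) =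
      0 := by
  ext φ
  simp only [Finset.sum_apply, Pi.smul_apply, smul_eq_mul, vertexFunctional, graphFunctional,
    kernelFunctional, Pi.zero_apply]
  simp only [← integral_const_mul]
  rw [← integral_finsetSum]
  · rw [← integral_zero (Fin (k + 1) → Spacetime) ℂ (μ := volume)]
    congr 1; ext Z
    have h := congrArg (fun p => prodWeight (Fin (k + 1)) (vertexWeight n g) Z *
      MvPowerSeries.coeff (constDegree (Fin (k + 1)) n)
        (p * formalExp (linForm (fieldValues φ Z)))) (sum_graphSeries_eq_zero hm hl Z)
    simp only [zero_mul, map_zero, mul_zero] at h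
    rw [← h, Finset.sum_mul, map_sum, Finset.mul_sum]
    refine Finset.sum_congr rfl fun J _ => ?_
    have hC : ((-1) ^ J.card : MvPowerSeries (Fin (k + 1)) ℂ) =
      MvPowerSeries.C ((-1 : ℂ) ^ J.card) := by simp
    rw [hC, mul_assoc, MvPowerSeries.coeff_C_mul]
    ring
  · intro J _
    refine (integrable_mul_of_compactSupport
      (continuous_prodWeight (continuous_vertexWeight n hg))
      (hasCompactSupport_prodWeight (hasCompactSupport_vertexWeight n hgc)) ?_).const_mul _
    exact ((coeffContinuous_graphSeries hm hl _).mul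
      (CoeffContinuous.linForm (continuous_fieldValues φ)).formalExp) _

/-- By induction, the terms of the recursion are the part with at most k anti vertices of the signed
sum over subsets of k + 1 vertices. That sum vanishes, so minus this part is the remaining term, in
which all vertices are anti. -/
theorem sMatrixInv_interaction (hg : Continuous g) (hgc : HasCompactSupport g) (k : ℕ) :
    sMatrixInv hm hl (interaction n g) k = (Complex.I ^ k / (k.factorial : ℂ)) •
      vertexFunctional hm hl n g fun _ : Fin k => anti := by
  induction k using Nat.strong_induction_on with
  | _ k ih =>
  cases k with
  | zero =>
    simp only [sMatrixInv, pow_zero, Nat.factorial_zero, Nat.cast_one, div_one, one_smul]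
    exact one_eq_graphFunctional hm hl _ n _
  | succ k =>
    have h1 : ∀ j : Fin (k + 1), starProd hm hl (sMatrixInv hm hl (interaction n g) j)
        (sMatrix hm hl (interaction n g) (k + 1 - j)) =
        ((Complex.I ^ (j : ℕ) / ((j : ℕ).factorial : ℂ)) *
          ((-Complex.I) ^ (k + 1 - j) / ((k + 1 - j).factorial : ℂ))) •
          vertexFunctional hm hl n g (Sum.elim (fun _ : Fin j => anti)
            fun _ : Fin (k + 1 - j) => time) := by
      intro j
      rw [ih j j.2, sMatrix_interaction hm hl n hg hgc, starProd,
        expProd_vertexFunctional hm hl n hg hgc (H := modTwoPoint hm hl) fun _ _ => rfl]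
    have h2 := sum_range_eq_sum_finset (k + 1) fun j => vertexFunctional hm hl n g
      (Sum.elim (fun _ : Fin j => anti) fun _ : Fin (k + 1 - j) => time)
    have h3 : ∀ J : Finset (Fin (k + 1)), vertexFunctional hm hl n g
        (Sum.elim (fun _ : Fin J.card => anti) fun _ : Fin (k + 1 - J.card) => time) =
        vertexFunctional hm hl n g (subsetKind J) := fun J =>
      vertexFunctional_reindex hm hl n (finsetSumEquiv J) (subsetKind_finsetSumEquiv J)
    simp only [h3] at h2
    -- Splitting off j = k + 1 leaves exactly the sum in the recursion.
    rw [sum_vertexFunctional_eq_zero hm hl n hg hgc, smul_zero, Finset.sum_range_succ,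
      Finset.sum_range] at h2
    rw [sMatrixInv, Finset.sum_congr rfl fun j _ => h1 j, eq_neg_of_add_eq_zero_left h2, neg_neg,
      vertexFunctional_reindex hm hl n (finSumFinEquiv.trans (finCongr (by omega)))
        (b := fun _ : Fin (k + 1) => anti)]
    · simp
    -- In this top term the second summand is `Fin (k + 1 - (k + 1))`, which is empty.
    · rintro (i | i)
      · rfl
      · exact absurd i.2 (by omega)

/-- The functional of a complete graph of interaction vertices and points of an observable. -/
def vertexObsFunctional (n : ℕ) (g : Spacetime → ℝ) (a : ι → VertexKind) (N : κ →₀ ℕ)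
    (f : (κ → Spacetime) → ℂ) : Functional :=
  graphFunctional hm hl (Sum.elim a fun _ => obs) ((constDegree ι n).sumElim N)
    (tensorFun (prodWeight ι (vertexWeight n g)) f)

variable {f : (κ → Spacetime) → ℂ} (N : κ →₀ ℕ)

theorem timeProd_sMatrix_graphFunctional (hg : Continuous g) (hgc : HasCompactSupport g)
    (hf : Continuous f) (hfc : HasCompactSupport f) (j : ℕ) :
    timeProd hm hl (sMatrix hm hl (interaction n g) j) (graphFunctional hm hl (fun _ => obs) N f) =
      ((-Complex.I) ^ j / (j.factorial : ℂ)) •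
        vertexObsFunctional hm hl n g (fun _ : Fin j => time) N f := by
  have hw := continuous_prodWeight (ι := Fin j) (continuous_vertexWeight n hg)
  have hwc := hasCompactSupport_prodWeight (ι := Fin j) (hasCompactSupport_vertexWeight n hgc)
  rw [sMatrix_interaction hm hl n hg hgc, vertexFunctional, smul_graphFunctional, timeProd,
    expProd_graphFunctional hm hl (H := modFeynman hm hl) (fun _ _ => rfl) _ _
      (hw.const_smul _) hwc.smul_left hf hfc,
    vertexObsFunctional, smul_graphFunctional]
  congr 1
  ext Z
  simp only [tensorFun, Pi.smul_apply, smul_eq_mul]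
  ring

/-- The term with j factors from S(V)⁻¹ and k - j from S(V) depends only on j. Relabelling
distributes it over the subsets of size j, and the prefactors combine as in
`sum_range_eq_sum_finset`. -/
theorem bogoliubov_graphFunctional (hg : Continuous g) (hgc : HasCompactSupport g)
    (hf : Continuous f) (hfc : HasCompactSupport f) (k : ℕ) :
    bogoliubov hm hl (interaction n g) (graphFunctional hm hl (fun _ => obs) N f) k =
      ((-Complex.I) ^ k / (k.factorial : ℂ)) • ∑ J : Finset (Fin k), (-1 : ℂ) ^ J.card •
        vertexObsFunctional hm hl n g (subsetKind J) N f := by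
  have hw : ∀ j, Continuous (prodWeight (Fin j) (vertexWeight n g)) := fun j =>
    continuous_prodWeight (continuous_vertexWeight n hg)
  have hwc : ∀ j, HasCompactSupport (prodWeight (Fin j) (vertexWeight n g)) := fun j =>
    hasCompactSupport_prodWeight (hasCompactSupport_vertexWeight n hgc)
  let a : ℕ → Functional := fun j => graphFunctional hm hl
    (Sum.elim (fun _ : Fin j => anti) (Sum.elim (fun _ : Fin (k - j) => time) fun _ : κ => obs))
    ((constDegree (Fin j) n).sumElim ((constDegree (Fin (k - j)) n).sumElim N))
    (tensorFun (prodWeight (Fin j) (vertexWeight n g))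
      (tensorFun (prodWeight (Fin (k - j)) (vertexWeight n g)) f))
  have h1 : ∀ j ∈ Finset.range (k + 1), starProd hm hl (sMatrixInv hm hl (interaction n g) j)
      (timeProd hm hl (sMatrix hm hl (interaction n g) (k - j))
        (graphFunctional hm hl (fun _ => obs) N f)) =
      ((Complex.I ^ j / (j.factorial : ℂ)) *
        ((-Complex.I) ^ (k - j) / ((k - j).factorial : ℂ))) • a j := by
    intro j _
    rw [timeProd_sMatrix_graphFunctional hm hl n N hg hgc hf hfc,
      sMatrixInv_interaction hm hl n hg hgc, vertexFunctional, vertexObsFunctional,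
      smul_graphFunctional, smul_graphFunctional, starProd,
      expProd_graphFunctional hm hl _ _ _ ((hw _).const_smul _) (hwc _).smul_left
        ((continuous_tensorFun (hw _) hf).const_smul _)
        (hasCompactSupport_tensorFun (hwc _) hfc).smul_left, smul_graphFunctional]
    · congr 1
      ext Z
      simp only [tensorFun, Pi.smul_apply, smul_eq_mul]
      ring
    · rintro i (j | j) <;> rfl
  have h2 : ∀ J : Finset (Fin k), a J.card = vertexObsFunctional hm hl n g (subsetKind J) N f := by
    intro J
    refine graphFunctional_reindex hm hl ((Equiv.sumAssoc _ _ _).symm.trans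
      (Equiv.sumCongr (finsetSumEquiv J) (Equiv.refl κ))) ?_ ?_ ?_
    · rintro (i | i | i)
      · exact subsetKind_finsetSumEquiv J (.inl i)
      · exact subsetKind_finsetSumEquiv J (.inr i)
      · rfl
    · rintro (i | i | i) <;> rfl
    · intro Z
      simp only [tensorFun, prodWeight]
      rw [← (finsetSumEquiv J).prod_comp, Fintype.prod_sum_type, mul_assoc]
      rfl
  -- `bogoliubov` is indexed by the order of S(V), whereas the subset sum is indexed by the order of
  -- S(V)⁻¹.
  rw [bogoliubov, ← Finset.sum_flip]
  have h3 : ∀ j ∈ Finset.range (k + 1), k - (k - j) = j := fun j hj =>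
    Nat.sub_sub_self (Nat.lt_succ_iff.1 (Finset.mem_range.1 hj))
  rw [Finset.sum_congr rfl fun j hj => by rw [h3 j hj], Finset.sum_congr rfl h1,
    sum_range_eq_sum_finset]
  simp only [h2]

end Series

/-! ### Spatial decay of the two-point function -/

section Decay

theorem exists_iteratedDeriv_gaussian (c : ℝ) (n : ℕ) : ∃ P : Polynomial ℝ, ∀ x,
    iteratedDeriv n (fun x : ℝ => Real.exp (-c * x ^ 2)) x = P.eval x * Real.exp (-c * x ^ 2) := by
  induction n with
  | zero => exact ⟨1, fun x => by simp⟩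
  | succ n ih =>
    obtain ⟨P, hP⟩ := ih
    refine ⟨Polynomial.derivative P - Polynomial.C (2 * c) * Polynomial.X * P, fun x => ?_⟩
    rw [iteratedDeriv_succ, funext hP]
    have h1 : HasDerivAt (fun x : ℝ => Real.exp (-c * x ^ 2))
        (Real.exp (-c * x ^ 2) * (-c * (2 * x))) x := by
      have := ((hasDerivAt_pow 2 x).const_mul (-c)).exp
      simpa using this
    rw [((P.hasDerivAt x).fun_mul h1).deriv]
    simp only [Polynomial.eval_sub, Polynomial.eval_mul, Polynomial.eval_C, Polynomial.eval_X]
    ring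

theorem exists_pow_mul_gaussian_le {c : ℝ} (hc : 0 < c) (k : ℕ) :
    ∃ B, ∀ x : ℝ, |x| ^ k * Real.exp (-c * x ^ 2) ≤ B := by
  -- The constant comes from yᵏ / k! ≤ exp y at y = c (1 + x²), together with |x| ≤ 1 + x².
  refine ⟨k.factorial * Real.exp c / c ^ k, fun x => ?_⟩
  have h1 : |x| ≤ 1 + x ^ 2 := by
    rw [← sq_abs]; nlinarith [sq_nonneg (|x| - 1), abs_nonneg x]
  have h2 := Real.pow_div_factorial_le_exp (c * (1 + x ^ 2)) (by positivity) k
  rw [div_le_iff₀ (by positivity), mul_pow] at h2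
  rw [le_div_iff₀ (by positivity)]
  calc |x| ^ k * Real.exp (-c * x ^ 2) * c ^ k
      ≤ (1 + x ^ 2) ^ k * Real.exp (-c * x ^ 2) * c ^ k := by gcongr
    _ = (c ^ k * (1 + x ^ 2) ^ k) * Real.exp (-c * x ^ 2) := by ring
    _ ≤ (Real.exp (c * (1 + x ^ 2)) * k.factorial) * Real.exp (-c * x ^ 2) := by gcongr
    _ = k.factorial * (Real.exp (c * (1 + x ^ 2)) * Real.exp (-c * x ^ 2)) := by ring
    _ = k.factorial * Real.exp c := by rw [← Real.exp_add]; ring_nf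

theorem exists_polynomial_mul_gaussian_le {c : ℝ} (hc : 0 < c) (P : Polynomial ℝ) (k : ℕ) :
    ∃ B, ∀ x : ℝ, |x| ^ k * (|P.eval x| * Real.exp (-c * x ^ 2)) ≤ B := by
  induction P using Polynomial.induction_on' with
  | add P Q hP hQ =>
    obtain ⟨B, hB⟩ := hP
    obtain ⟨D, hD⟩ := hQ
    refine ⟨B + D, fun x => le_trans ?_ (add_le_add (hB x) (hD x))⟩
    rw [← mul_add, ← add_mul, Polynomial.eval_add]
    gcongr
    exact abs_add_le _ _
  | monomial n a =>
    obtain ⟨B, hB⟩ := exists_pow_mul_gaussian_le hc (k + n)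
    refine ⟨|a| * B, fun x => le_trans (le_of_eq ?_)
      (mul_le_mul_of_nonneg_left (hB x) (abs_nonneg a))⟩
    rw [Polynomial.eval_monomial, abs_mul, abs_pow, pow_add]
    ring

/-- The Gaussian `exp(-c x²)` on the line as a Schwartz function. -/
def gaussSchwartz {c : ℝ} (hc : 0 < c) : 𝓢(ℝ, ℝ) where
  toFun x := Real.exp (-c * x ^ 2)
  smooth' := by fun_prop
  decay' k n := by
    obtain ⟨P, hP⟩ := exists_iteratedDeriv_gaussian c n
    obtain ⟨B, hB⟩ := exists_polynomial_mul_gaussian_le hc P k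
    refine ⟨B, fun x => ?_⟩
    rw [norm_iteratedFDeriv_eq_norm_iteratedDeriv, hP, norm_mul, Real.norm_eq_abs,
      Real.norm_eq_abs, Real.norm_eq_abs, Real.abs_exp]
    exact hB x

/-- The spacetime Gaussian is obtained by inserting this function into the one-dimensional one.
Unlike the norm it is smooth at the origin, at the price of the summand 1 in the exponent. -/
theorem hasTemperateGrowth_sqrt_one_add_norm_sq (H : Type*) [NormedAddCommGroup H]
    [InnerProductSpace ℝ H] : (fun x : H => √(1 + ‖x‖ ^ 2)).HasTemperateGrowth := by
  simpa only [Real.sqrt_eq_rpow] using Function.hasTemperateGrowth_one_add_norm_sq_rpow H (1 / 2)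

/-- The Gaussian `exp(-c (1 + t² + |𝐱|²))` on spacetime as a Schwartz function. -/
def spacetimeGauss {c : ℝ} (hc : 0 < c) : 𝓢(Spacetime, ℝ) :=
  SchwartzMap.compCLMOfContinuousLinearEquiv ℝ (WithLp.prodContinuousLinearEquiv 2 ℝ ℝ Space).symm
    (SchwartzMap.compCLM ℝ (hasTemperateGrowth_sqrt_one_add_norm_sq (WithLp 2 (ℝ × Space)))
      ⟨1, 1, fun x => by
        have : ‖x‖ ≤ √(1 + ‖x‖ ^ 2) := Real.le_sqrt_of_sq_le (by linarith)
        rw [Real.norm_of_nonneg (Real.sqrt_nonneg _)]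
        linarith⟩ (gaussSchwartz hc))

theorem spacetimeGauss_apply {c : ℝ} (hc : 0 < c) (x : Spacetime) :
    spacetimeGauss hc x = Real.exp (-c * (1 + x.1 ^ 2 + ‖x.2‖ ^ 2)) := by
  change Real.exp (-c * √(1 + ‖WithLp.toLp 2 x‖ ^ 2) ^ 2) = _
  rw [Real.sq_sqrt (by positivity), WithLp.prod_norm_sq_eq_of_L2]
  simp [add_assoc]

theorem hasTemperateGrowth_cexp_I_mul :
    (fun y : ℝ => Complex.exp (Complex.I * y)).HasTemperateGrowth := by
  refine ⟨(contDiff_const.mul Complex.ofRealCLM.contDiff).cexp, fun n => ⟨0, 1, fun x => ?_⟩⟩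
  have h : ∀ n : ℕ, iteratedDeriv n (fun y : ℝ => Complex.exp (Complex.I * y)) =
      fun y : ℝ => Complex.I ^ n * Complex.exp (Complex.I * y) := by
    intro n
    induction n with
    | zero => simp
    | succ n ih =>
      rw [iteratedDeriv_succ, ih]
      ext y
      have h1 : HasDerivAt (fun y : ℝ => Complex.exp (Complex.I * y))
          (Complex.exp (Complex.I * y) * (Complex.I * 1)) y :=
        ((Complex.ofRealCLM.hasDerivAt (x := y)).const_mul Complex.I).cexp
      rw [(h1.const_mul _).deriv]
      ring
  rw [norm_iteratedFDeriv_eq_norm_iteratedDeriv, h, norm_mul, norm_pow, Complex.norm_I, one_pow,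
    mul_comm Complex.I, Complex.norm_exp_ofReal_mul_I]
  simp

/-- Positive mass reduces ω and 1/ω to powers of 1 + |p|², which are smooth and of temperate growth.
-/
theorem energy_eq_rpow {m : ℝ} (hm : 0 < m) (p : Space) :
    energy m p = m * (1 + ‖m⁻¹ • p‖ ^ 2) ^ (1 / 2 : ℝ) := by
  rw [← Real.sqrt_eq_rpow, energy, norm_smul, mul_pow, Real.norm_of_nonneg (by positivity)]
  nth_rewrite 2 [← Real.sqrt_sq hm.le]
  rw [← Real.sqrt_mul (by positivity)]
  congr 1
  field_simp
  ring

theorem hasTemperateGrowth_energy {m : ℝ} (hm : 0 < m) :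
    (fun x : Spacetime => energy m x.2).HasTemperateGrowth := by
  have h1 : (fun x : Spacetime => m⁻¹ • x.2).HasTemperateGrowth :=
    (m⁻¹ • ContinuousLinearMap.snd ℝ ℝ Space).hasTemperateGrowth
  have h2 := (Function.hasTemperateGrowth_one_add_norm_sq_rpow Space (1 / 2)).comp h1
  have h3 := (Function.HasTemperateGrowth.const (E := Spacetime) m).mul h2
  refine Eq.mp (congrArg _ (funext fun x => ?_)) h3
  exact (energy_eq_rpow hm x.2).symm

theorem hasTemperateGrowth_inv_energy {m : ℝ} (hm : 0 < m) :
    (fun x : Spacetime => (energy m x.2)⁻¹).HasTemperateGrowth := by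
  have h1 : (fun x : Spacetime => m⁻¹ • x.2).HasTemperateGrowth :=
    (m⁻¹ • ContinuousLinearMap.snd ℝ ℝ Space).hasTemperateGrowth
  have h2 := (Function.hasTemperateGrowth_one_add_norm_sq_rpow Space (-(1 / 2))).comp h1
  have h3 := (Function.HasTemperateGrowth.const (E := Spacetime) m⁻¹).mul h2
  refine Eq.mp (congrArg _ (funext fun x => ?_)) h3
  rw [energy_eq_rpow hm, mul_inv, ← Real.rpow_neg (by positivity)]
  rfl

/-- The oscillating factor `exp(-i ω(𝐩) t) / ω(𝐩)` has temperate growth in `(t, 𝐩)`. -/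
theorem hasTemperateGrowth_modeFactor {m : ℝ} (hm : 0 < m) :
    (fun x : Spacetime => (((energy m x.2)⁻¹ : ℝ) : ℂ) *
      Complex.exp (Complex.I * ((-(energy m x.2 * x.1) : ℝ) : ℂ))).HasTemperateGrowth := by
  have h1 := Function.Complex.hasTemperateGrowth_ofReal.comp (hasTemperateGrowth_inv_energy hm)
  have ht : (fun x : Spacetime => x.1).HasTemperateGrowth :=
    (ContinuousLinearMap.fst ℝ ℝ Space).hasTemperateGrowth
  have h2 := hasTemperateGrowth_cexp_I_mul.comp (((hasTemperateGrowth_energy hm).mul ht).neg)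
  exact h1.mul h2

/-- A spatial slice is a translate composed with an inclusion of norm at most 1. Spacetime Schwartz
seminorms therefore control all slices uniformly in time. -/
theorem norm_iteratedFDeriv_prodMk_le {f : Spacetime → ℂ} (hf : ContDiff ℝ ∞ f) (n : ℕ) (t : ℝ)
    (p : Space) : ‖iteratedFDeriv ℝ n (fun p : Space => f (t, p)) p‖ ≤
      ‖iteratedFDeriv ℝ n f (t, p)‖ := by
  have h1 : (fun p : Space => f (t, p)) =
      (fun x : Spacetime => f (x + (t, 0))) ∘ ContinuousLinearMap.inr ℝ ℝ Space := by
    ext p; simp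
  have h2 : ContDiff ℝ n (fun x : Spacetime => f (x + (t, 0))) :=
    (hf.of_le (mod_cast le_top)).comp (contDiff_id.add contDiff_const)
  rw [h1, ContinuousLinearMap.iteratedFDeriv_comp_right _ h2 p le_rfl]
  refine (ContinuousMultilinearMap.norm_compContinuousLinearMap_le _ _).trans ?_
  rw [iteratedFDeriv_comp_add_right]
  have h3 : (ContinuousLinearMap.inr ℝ ℝ Space p + (t, 0) : Spacetime) = (t, p) := by simp
  rw [h3]
  refine mul_le_of_le_one_right (norm_nonneg _) (Finset.prod_le_one (fun _ _ => norm_nonneg _) ?_)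
  exact fun _ _ => ContinuousLinearMap.norm_inr_le_one ℝ ℝ Space

theorem integrable_one_add_norm_pow_inv : Integrable fun p : Space => ((1 + ‖p‖) ^ 4)⁻¹ := by
  have h := integrable_one_add_norm (E := Space) (μ := volume) (r := 4) (by simp; norm_num)
  refine h.congr (Eventually.of_forall fun p => ?_)
  simp only
  rw [Real.rpow_neg (by positivity)]
  norm_cast

/-- The Fourier transform of a Schwartz function in the spatial variable decays rapidly, uniformly
in time. -/
theorem exists_spatial_fourier_bound (F : 𝓢(Spacetime, ℂ)) (N : ℕ) : ∃ C, 0 ≤ C ∧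
    ∀ (t : ℝ) (w : Space), ‖w‖ ^ N * ‖FourierTransform.fourier (fun p : Space => F (t, p)) w‖ ≤
      C := by
  have hb : ∀ n : ℕ, ∃ B, 0 ≤ B ∧ ∀ (t : ℝ) (p : Space),
      ‖iteratedFDeriv ℝ n (fun p : Space => F (t, p)) p‖ ≤ B * ((1 + ‖p‖) ^ 4)⁻¹ := by
    intro n
    -- The weight 4 exceeds the dimension 3, so the bound is integrable in p.
    refine ⟨2 ^ 4 * ((Finset.Iic (4, n)).sup fun m => SchwartzMap.seminorm ℝ m.1 m.2) F,
      by positivity, fun t p => ?_⟩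
    have h := SchwartzMap.one_add_le_sup_seminorm_apply (𝕜 := ℝ) (m := (4, n)) (k := 4) (n := n)
      le_rfl le_rfl F (t, p)
    rw [← div_eq_mul_inv, le_div_iff₀ (by positivity), mul_comm]
    refine le_trans ?_ h
    have hp : ‖p‖ ≤ ‖((t, p) : Spacetime)‖ := le_max_right _ _
    gcongr
    exact norm_iteratedFDeriv_prodMk_le (F.smooth ⊤) n t p
  choose B hB0 hB using hb
  have hsm : ∀ t : ℝ, ContDiff ℝ ∞ fun p : Space => F (t, p) := fun t =>
    (F.smooth ⊤).comp (contDiff_const.prodMk contDiff_id)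
  have hint : ∀ (t : ℝ) (n : ℕ), Integrable fun p : Space =>
      ‖iteratedFDeriv ℝ n (fun p : Space => F (t, p)) p‖ := by
    intro t n
    refine (integrable_one_add_norm_pow_inv.const_mul (B n)).mono' ?_
      (Eventually.of_forall fun p => by rw [norm_norm]; exact hB n t p)
    exact ((hsm t).continuous_iteratedFDeriv (mod_cast le_top)).norm.aestronglyMeasurable
  refine ⟨2 ^ N * ∑ n ∈ Finset.range (N + 1), B n * ∫ p : Space, ((1 + ‖p‖) ^ 4)⁻¹, ?_,
    fun t w => ?_⟩
  · have : 0 ≤ ∫ p : Space, ((1 + ‖p‖) ^ 4)⁻¹ := integral_nonneg fun p => by positivity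
    exact mul_nonneg (by positivity) (Finset.sum_nonneg fun n _ => mul_nonneg (hB0 n) this)
  -- The power ‖w‖ᴺ is paid for by N derivatives in p; the transform itself is not differentiated.
  · have h := Real.pow_mul_norm_iteratedFDeriv_fourier_le (K := 0) (N := ⊤) (hsm t)
      (fun k n hk _ => by
        have : k = 0 := by simpa using hk
        subst this
        simpa using hint t n) (k := 0) (n := N) (by simp) le_top w
    simp only [norm_iteratedFDeriv_zero, pow_zero, one_mul, Nat.cast_zero, mul_zero, zero_add,
      Finset.range_one] at h
    refine h.trans ?_
    gcongr
    rw [Finset.sum_product, Finset.sum_singleton]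
    refine Finset.sum_le_sum fun n _ => ?_
    simp only [pow_zero, one_mul]
    rw [← integral_const_mul]
    exact integral_mono (hint t n) (integrable_one_add_norm_pow_inv.const_mul _) (hB n t)

/-- Derivatives of exp(-iωt) in p grow with t. Inserting a Gaussian in t as well gives a function
that is Schwartz in (t, p) jointly, and the prefactor exp(2 l² t²) compensates for it. -/
theorem modTwoPointFun_eq_fourier {m l : ℝ} (hm : 0 < m) (hl : 0 < l) :
    ∃ F : 𝓢(Spacetime, ℂ), ∃ c : ℂ, ∀ x : Spacetime, modTwoPointFun m l x =
      c * Complex.exp ((2 * l ^ 2 * x.1 ^ 2 : ℝ)) *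
        FourierTransform.fourier (fun p : Space => F (x.1, p)) ((-(2 * Real.pi)⁻¹) • x.2) := by
  have hc : 0 < 2 * l ^ 2 := by positivity
  let Γ : 𝓢(Spacetime, ℂ) := SchwartzMap.postcompCLM (𝕜 := ℝ) Complex.ofRealCLM (spacetimeGauss hc)
  refine ⟨SchwartzMap.smulLeftCLM ℂ (fun x : Spacetime => (((energy m x.2)⁻¹ : ℝ) : ℂ) *
      Complex.exp (Complex.I * ((-(energy m x.2 * x.1) : ℝ) : ℂ))) Γ,
    -- The term 2 l² removes the 1 in the exponent of the Gaussian; -l² m² is the mass term of the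
    -- damping factor. The argument -x / 2π adapts the 2π convention of the transform.
    (1 / (2 * Real.pi : ℂ) ^ 3) * (1 / 2) * Complex.exp ((2 * l ^ 2 - l ^ 2 * m ^ 2 : ℝ)),
    fun x => ?_⟩
  rw [modTwoPointFun_eq m hl, Real.fourier_eq', ← integral_const_mul, ← integral_const_mul]
  congr 1; ext p
  rw [SchwartzMap.smulLeftCLM_apply_apply (hasTemperateGrowth_modeFactor hm)]
  have hΓ : Γ (x.1, p) = ((Real.exp (-(2 * l ^ 2) * (1 + x.1 ^ 2 + ‖p‖ ^ 2)) : ℝ) : ℂ) := by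
    change ((spacetimeGauss hc (x.1, p) : ℝ) : ℂ) = _
    rw [spacetimeGauss_apply]
  rw [hΓ]
  have hE : ((energy m p : ℝ) : ℂ) ≠ 0 := by exact_mod_cast (energy_pos hm p).ne'
  have hpi : ((Real.pi : ℝ) : ℂ) ≠ 0 := by exact_mod_cast Real.pi_ne_zero
  have hinner : -2 * Real.pi * (-(2 * Real.pi)⁻¹ * inner ℝ p x.2) = inner ℝ p x.2 := by
    field_simp
  simp only [planeWave, smul_eq_mul, inner_smul_right, Complex.ofReal_exp]
  rw [hinner]
  have h : Complex.exp ((-(l ^ 2 * (2 * ‖p‖ ^ 2 + m ^ 2)) : ℝ) : ℂ) *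
      Complex.exp (-Complex.I * ((energy m p * x.1 - inner ℝ p x.2 : ℝ) : ℂ)) =
      Complex.exp ((2 * l ^ 2 - l ^ 2 * m ^ 2 : ℝ) : ℂ) *
        Complex.exp ((2 * l ^ 2 * x.1 ^ 2 : ℝ) : ℂ) *
      Complex.exp (((inner ℝ p x.2 : ℝ) : ℂ) * Complex.I) *
      Complex.exp (Complex.I * ((-(energy m p * x.1) : ℝ) : ℂ)) *
      Complex.exp ((-(2 * l ^ 2) * (1 + x.1 ^ 2 + ‖p‖ ^ 2) : ℝ) : ℂ) := by
    simp only [← Complex.exp_add]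
    congr 1
    push_cast
    ring
  rw [h, Complex.ofReal_inv]
  field_simp

/-- The Fourier bounds of orders 0 and N combine through (1 + r)ᴺ ≤ 2ᴺ (1 + rᴺ), and exp(2 l² t²) is
bounded for |t| ≤ T. -/
theorem exists_modTwoPoint_bound {m l : ℝ} (hm : 0 < m) (hl : 0 < l) (T : ℝ) (N : ℕ) :
    ∃ C, 0 ≤ C ∧ ∀ x : Spacetime, |x.1| ≤ T →
      ‖modTwoPointFun m l x‖ ≤ C * ((1 + ‖x.2‖) ^ N)⁻¹ := by
  obtain ⟨F, c, hF⟩ := modTwoPointFun_eq_fourier hm hl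
  obtain ⟨C₀, hC₀, h₀⟩ := exists_spatial_fourier_bound F 0
  obtain ⟨C₁, hC₁, h₁⟩ := exists_spatial_fourier_bound F N
  set A := ‖c‖ * Real.exp (2 * l ^ 2 * T ^ 2) with hA
  refine ⟨A * (2 ^ N * (C₀ + (2 * Real.pi) ^ N * C₁)), by positivity, fun x hx => ?_⟩
  set f := ‖FourierTransform.fourier (fun p : Space => F (x.1, p)) ((-(2 * Real.pi)⁻¹) • x.2)‖
    with hf
  have hn : ‖(-(2 * Real.pi)⁻¹) • x.2‖ = (2 * Real.pi)⁻¹ * ‖x.2‖ := by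
    rw [norm_smul, norm_neg, norm_inv, Real.norm_of_nonneg (by positivity)]
  have e0 : f ≤ C₀ := by
    have := h₀ x.1 ((-(2 * Real.pi)⁻¹) • x.2)
    rwa [pow_zero, one_mul] at this
  have e1 : ‖x.2‖ ^ N * f ≤ (2 * Real.pi) ^ N * C₁ := by
    have := h₁ x.1 ((-(2 * Real.pi)⁻¹) • x.2)
    rw [hn, mul_pow, inv_pow, mul_assoc, inv_mul_le_iff₀ (by positivity)] at this
    exact this
  have e2 : (1 + ‖x.2‖) ^ N ≤ 2 ^ N * (1 + ‖x.2‖ ^ N) := by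
    have hx0 : 0 ≤ ‖x.2‖ := norm_nonneg _
    calc (1 + ‖x.2‖) ^ N ≤ (2 * max 1 ‖x.2‖) ^ N := by
          gcongr
          linarith [le_max_left 1 ‖x.2‖, le_max_right 1 ‖x.2‖]
      _ = 2 ^ N * max 1 ‖x.2‖ ^ N := mul_pow _ _ _
      _ ≤ 2 ^ N * (1 + ‖x.2‖ ^ N) := by
          gcongr
          rcases max_choice 1 ‖x.2‖ with h | h <;> rw [h]
          · rw [one_pow]; linarith [pow_nonneg hx0 N]
          · linarith
  rw [← div_eq_mul_inv, le_div_iff₀ (by positivity), hF, norm_mul, norm_mul, ← hf,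
    Complex.norm_exp, Complex.ofReal_re]
  have e3 : Real.exp (2 * l ^ 2 * x.1 ^ 2) ≤ Real.exp (2 * l ^ 2 * T ^ 2) := by
    have : x.1 ^ 2 ≤ T ^ 2 := sq_le_sq' (by linarith [(abs_le.1 hx).1]) (abs_le.1 hx).2
    gcongr
  have hf0 : 0 ≤ f := norm_nonneg _
  calc ‖c‖ * Real.exp (2 * l ^ 2 * x.1 ^ 2) * f * (1 + ‖x.2‖) ^ N
      ≤ A * f * (2 ^ N * (1 + ‖x.2‖ ^ N)) := by rw [hA]; gcongr
    _ = A * (2 ^ N * (f + ‖x.2‖ ^ N * f)) := by ring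
    _ ≤ A * (2 ^ N * (C₀ + (2 * Real.pi) ^ N * C₁)) := by gcongr

end Decay

/-! ### Cluster decay of the integrand and the adiabatic limit -/

section Cluster

open MvPowerSeries VertexKind

variable {ι κ : Type} [Fintype ι] [Fintype κ]

theorem contDiff_coeff_formalExp_quadForm (d : ι →₀ ℕ) :
    ContDiff ℝ 1 fun K : ι → ι → ℂ => coeff d (formalExp (quadForm K)) := by
  classical
  have hq : ∀ d : ι →₀ ℕ, ContDiff ℝ 1 fun K : ι → ι → ℂ => coeff d (quadForm K) := by
    intro d
    simp only [quadForm, map_sum, coeff_C_mul]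
    refine ContDiff.sum fun i _ => ContDiff.sum fun j _ => ContDiff.mul ?_ contDiff_const
    exact (contDiff_apply_apply ℝ ℂ i j).div_const 2
  have hpow : ∀ (r : ℕ) (d : ι →₀ ℕ),
      ContDiff ℝ 1 fun K : ι → ι → ℂ => coeff d (quadForm K ^ r) := by
    intro r
    induction r with
    | zero => intro d; simp only [pow_zero]; exact contDiff_const
    | succ r ih =>
      intro d
      simp only [pow_succ, coeff_mul]
      exact ContDiff.sum fun e _ => (ih _).mul (hq _)
  change ContDiff ℝ 1 fun K : ι → ι → ℂ => ∑ r ∈ Finset.range (d.degree + 1), _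
  exact ContDiff.sum fun r _ => contDiff_const.mul (hpow r d)

/-- Each coefficient is a polynomial in the entries of K, hence Lipschitz on bounded sets. This
measures the effect of deleting small entries. -/
theorem exists_lipschitz_coeff_formalExp_quadForm (d : ι →₀ ℕ) (B : ℝ) :
    ∃ L, 0 ≤ L ∧ ∀ K K' : ι → ι → ℂ, ‖K‖ ≤ B → ‖K'‖ ≤ B →
      ‖coeff d (formalExp (quadForm K)) - coeff d (formalExp (quadForm K'))‖ ≤ L * ‖K - K'‖ := by
  obtain ⟨L, hL⟩ := LocallyLipschitzOn.exists_lipschitzOnWith_of_compact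
    (isCompact_closedBall (0 : ι → ι → ℂ) B)
    ((contDiff_coeff_formalExp_quadForm d).locallyLipschitz.locallyLipschitzOn)
  refine ⟨L, L.2, fun K K' hK hK' => ?_⟩
  simpa only [dist_eq_norm] using hL.dist_le_mul K (by simpa using hK) K' (by simpa using hK')

variable {m l : ℝ} (hm : 0 < m) (hl : 0 < l)

theorem exists_linePropagator_bound (T : ℝ) (M : ℕ) : ∃ D, 0 ≤ D ∧ ∀ (a b : VertexKind)
    (x : Spacetime), |x.1| ≤ T → ‖linePropagator hm hl a b x‖ ≤ D * ((1 + ‖x.2‖) ^ M)⁻¹ := by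
  obtain ⟨C, hC, h⟩ := exists_modTwoPoint_bound hm hl T M
  -- The worst case is the anti-Feynman propagator, a combination of three values of Δ₊ at ±x.
  refine ⟨3 * C, by positivity, fun a b x hx => ?_⟩
  set ρ := C * ((1 + ‖x.2‖) ^ M)⁻¹ with hρ
  have hρ0 : 0 ≤ ρ := by positivity
  have h1 : ‖modTwoPoint hm hl x‖ ≤ ρ := h x hx
  have h2 : ‖modTwoPointNeg hm hl x‖ ≤ ρ := by simpa using! h (-x) (by simpa using hx)
  have h3 : ‖modFeynman hm hl x‖ ≤ ρ := by
    change ‖modFeynmanFun m l x‖ ≤ ρ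
    unfold modFeynmanFun
    split_ifs
    · exact h1
    · exact h2
  rw [mul_assoc, ← hρ]
  cases a <;> cases b <;> simp only [linePropagator, modAntiFeynman]
  · change ‖modTwoPoint hm hl x + modTwoPointNeg hm hl x - modFeynman hm hl x‖ ≤ 3 * ρ
    have h4 := norm_add_le (modTwoPoint hm hl x) (modTwoPointNeg hm hl x)
    exact (norm_sub_le _ _).trans (by linarith)
  all_goals first | linarith | (simp only [ContinuousMap.zero_apply, norm_zero]; linarith)

/-- Among `k + 1` consecutive annuli one contains none of `k` given points. -/
theorem exists_empty_annulus (r : ι → ℝ) (R₀ : ℝ) {δ : ℝ} (hδ : 0 < δ) :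
    ∃ p : ℕ, p < Fintype.card ι + 1 ∧ ∀ j, r j ≤ R₀ + p * δ ∨ R₀ + (p + 1) * δ < r j := by
  by_contra! hcon
  have : Nonempty ι := ⟨(hcon 0 (Nat.succ_pos _)).choose⟩
  choose! j hj using hcon
  -- Were every annulus occupied, disjointness of the annuli would make the choice of occupants
  -- injective on a set larger than `ι`.
  have hlt : ∀ p q : Fin (Fintype.card ι + 1), p < q → j p ≠ j q := by
    intro p q hpq heq
    have h1 := (hj p p.2).2
    have h2 := (hj q q.2).1
    rw [heq] at h1
    have h3 : ((p : ℕ) : ℝ) + 1 ≤ ((q : ℕ) : ℝ) := by exact_mod_cast hpq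
    nlinarith
  have hinj : Function.Injective fun p : Fin (Fintype.card ι + 1) => j p := by
    intro p q hpq
    rcases lt_trichotomy p q with h | h | h
    · exact absurd hpq (hlt p q h)
    · exact h
    · exact absurd hpq.symm (hlt q p h)
  have := Fintype.card_le_of_injective _ hinj
  simp at this

variable [DecidableEq ι]

/-- The signed sum over the kinds of the interaction vertices. -/
def connectedCoeff (N : ι ⊕ κ →₀ ℕ) (Z : ι ⊕ κ → Spacetime) : ℂ :=
  ∑ J : Finset ι, (-1) ^ J.card *
    coeff N (graphSeries hm hl (Sum.elim (subsetKind J) fun _ => obs) Z)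

theorem continuous_connectedCoeff (N : ι ⊕ κ →₀ ℕ) :
    Continuous (connectedCoeff hm hl N) :=
  continuous_finsetSum _ fun _ _ => continuous_const.mul (coeffContinuous_graphSeries hm hl _ _)

/-- If vertex `i` is far out, some annulus between radius R₀ and `i` is empty. The lines across it
are small, and without them the signed sum is zero, so the sum is bounded by the size of those
lines. -/
theorem exists_connectedCoeff_bound (N : ι ⊕ κ →₀ ℕ) (T : ℝ) {R₀ : ℝ} (hR₀ : 0 ≤ R₀) (M : ℕ) :
    ∃ C, 0 ≤ C ∧ ∀ Z : ι ⊕ κ → Spacetime, (∀ v, |(Z v).1| ≤ T) →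
      (∀ j, ‖(Z (.inr j)).2‖ ≤ R₀) → ‖connectedCoeff hm hl N Z‖ ≤ C ∧
        ∀ i, ‖connectedCoeff hm hl N Z‖ ≤ C * ((1 + ‖(Z (.inl i)).2‖) ^ M)⁻¹ := by
  classical
  -- Times in [-T, T] have differences within 2T.
  obtain ⟨D, hD0, hD⟩ := exists_linePropagator_bound hm hl (2 * T) M
  obtain ⟨L, hL0, hL⟩ := exists_lipschitz_coeff_formalExp_quadForm N D
  set n := Fintype.card ι with hn
  set c₀ := ‖coeff N (formalExp (quadForm (0 : ι ⊕ κ → ι ⊕ κ → ℂ)))‖ with hc₀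
  -- 2ⁿ counts the subsets. `C₁` comes from comparing with the zero matrix and settles r i ≤ R₀.
  -- `C₂` is for r i > R₀; its last factor comes from 1 + r i ≤ (1 + R₀)(n + 1)(1 + δ).
  set C₁ := 2 ^ n * (c₀ + L * D) with hC₁
  set C₂ := 2 ^ n * (L * D) * ((1 + R₀) * (n + 1)) ^ M with hC₂
  have hC₁0 : 0 ≤ C₁ := by positivity
  have hC₂0 : 0 ≤ C₂ := by positivity
  have hpow : 1 ≤ (1 + R₀) ^ M := one_le_pow₀ (by linarith)
  refine ⟨C₁ * (1 + R₀) ^ M + C₂, by positivity, fun Z hT hZ => ?_⟩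
  set K : Finset ι → ι ⊕ κ → ι ⊕ κ → ℂ := fun J =>
    graphKernel hm hl (Sum.elim (subsetKind J) fun _ => obs) Z with hK
  have hentry : ∀ J v w, ‖K J v w‖ ≤ D * ((1 + ‖(Z v).2 - (Z w).2‖) ^ M)⁻¹ := by
    intro J v w
    simp only [hK, graphKernel]
    split_ifs
    · rw [norm_zero]; positivity
    · refine hD _ _ _ ?_
      have h1 := hT v
      have h2 := hT w
      rw [Prod.fst_sub]
      linarith [abs_sub (Z v).1 (Z w).1]
  have hentry' : ∀ J v w, ‖K J v w‖ ≤ D := fun J v w =>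
    (hentry J v w).trans (mul_le_of_le_one_right hD0 (inv_le_one_of_one_le₀
      (one_le_pow₀ (by linarith [norm_nonneg ((Z v).2 - (Z w).2)]))))
  have hKD : ∀ J, ‖K J‖ ≤ D := fun J =>
    (pi_norm_le_iff_of_nonneg hD0).2 fun v => (pi_norm_le_iff_of_nonneg hD0).2 (hentry' J v)
  have hsum : ∀ F : Finset ι → ℂ, ∀ B : ℝ, (∀ J, ‖F J‖ ≤ B) →
      ‖∑ J : Finset ι, (-1) ^ J.card * F J‖ ≤ 2 ^ n * B := by
    intro F B hF
    refine (norm_sum_le_of_le _ fun J _ => (?_ : _ ≤ B)).trans (le_of_eq ?_)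
    · rw [norm_mul, norm_pow, norm_neg, norm_one, one_pow, one_mul]; exact hF J
    · simp [hn]
  have hbound : ‖connectedCoeff hm hl N Z‖ ≤ C₁ := by
    refine hsum _ _ fun J => ?_
    have h1 := hL (K J) 0 (hKD J) (by simpa using hD0)
    rw [sub_zero] at h1
    have h2 : L * ‖K J‖ ≤ L * D := mul_le_mul_of_nonneg_left (hKD J) hL0
    have h3 := norm_le_norm_add_norm_sub' (coeff N (formalExp (quadForm (K J))))
      (coeff N (formalExp (quadForm 0)))
    simp only [graphSeries]
    change ‖coeff N (formalExp (quadForm (K J)))‖ ≤ _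
    linarith
  refine ⟨hbound.trans ((le_mul_of_one_le_right hC₁0 hpow).trans (by linarith)), fun i => ?_⟩
  set r : ι → ℝ := fun j => ‖(Z (.inl j)).2‖ with hr
  change _ ≤ _ * ((1 + r i) ^ M)⁻¹
  have hr0 : ∀ j, 0 ≤ r j := fun j => norm_nonneg _
  have hri : 0 < (1 + r i) ^ M := pow_pos (by linarith [hr0 i]) M
  rw [← div_eq_mul_inv, le_div_iff₀ hri]
  rcases le_or_gt (r i) R₀ with hi | hi
  · calc ‖connectedCoeff hm hl N Z‖ * (1 + r i) ^ M ≤ C₁ * (1 + R₀) ^ M := by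
          have := hr0 i
          gcongr
      _ ≤ _ := by linarith
  -- n + 1 annuli of this width fill the range from R₀ to r i exactly, so `i` lies beyond the empty
  -- one.
  set δ := (r i - R₀) / (n + 1) with hδ
  have hδ0 : 0 < δ := div_pos (by linarith) (by positivity)
  have hδi : r i = R₀ + (n + 1) * δ := by rw [hδ]; field_simp; ring
  obtain ⟨p, hp, hgap⟩ := exists_empty_annulus r R₀ hδ0
  set S : Set ι := {j | R₀ + (p + 1) * δ < r j} with hS
  have hiS : i ∈ S := by
    refine (hgap i).resolve_left fun h => ?_
    have : (p : ℝ) + 1 ≤ n + 1 := by exact_mod_cast hp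
    nlinarith
  have hin : ∀ v ∈ (Sum.inl '' S : Set (ι ⊕ κ)), R₀ + (p + 1) * δ ≤ ‖(Z v).2‖ := by
    rintro _ ⟨j, hj, rfl⟩
    exact le_of_lt hj
  have hout : ∀ v ∉ (Sum.inl '' S : Set (ι ⊕ κ)), ‖(Z v).2‖ ≤ R₀ + p * δ := by
    rintro (j | j) hj
    · exact (hgap j).resolve_right fun h => hj ⟨j, h, rfl⟩
    · exact (hZ j).trans (by have := hδ0.le; linarith [mul_nonneg (Nat.cast_nonneg p) this])
  have hcross : ∀ v w, ¬(v ∈ (Sum.inl '' S : Set (ι ⊕ κ)) ↔ w ∈ (Sum.inl '' S : Set (ι ⊕ κ))) →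
      δ ≤ ‖(Z v).2 - (Z w).2‖ := by
    intro v w hvw
    by_cases hv : v ∈ (Sum.inl '' S : Set (ι ⊕ κ))
    · have hw : w ∉ (Sum.inl '' S : Set (ι ⊕ κ)) := fun hw => hvw ⟨fun _ => hw, fun _ => hv⟩
      have := norm_sub_norm_le (Z v).2 (Z w).2
      linarith [hin v hv, hout w hw]
    · have hw : w ∈ (Sum.inl '' S : Set (ι ⊕ κ)) := by
        by_contra hw
        exact hvw ⟨fun h => absurd h hv, fun h => absurd h hw⟩
      have := norm_sub_norm_le (Z w).2 (Z v).2
      rw [norm_sub_rev] at this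
      linarith [hin w hw, hout v hv]
  set E := D * ((1 + δ) ^ M)⁻¹ with hE
  have hE0 : 0 ≤ E := by positivity
  have hdiff : ∀ J, ‖K J - cutMatrix (Sum.inl '' S) (K J)‖ ≤ E := by
    intro J
    refine (pi_norm_le_iff_of_nonneg hE0).2 fun v => (pi_norm_le_iff_of_nonneg hE0).2 fun w => ?_
    simp only [Pi.sub_apply, cutMatrix]
    split_ifs with h
    · simpa using hE0
    · rw [sub_zero]
      refine (hentry J v w).trans ?_
      have := hcross v w h
      rw [hE]
      gcongr
  have hcut : ∀ J, ‖cutMatrix (Sum.inl '' S) (K J)‖ ≤ D := by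
    intro J
    refine (pi_norm_le_iff_of_nonneg hD0).2 fun v => (pi_norm_le_iff_of_nonneg hD0).2 fun w => ?_
    unfold cutMatrix
    split_ifs
    · exact hentry' J v w
    · simpa using hD0
  -- The signed sum of the cut graphs, which is zero, is subtracted term by term; the Lipschitz
  -- bound then applies to each difference.
  have hW : ‖connectedCoeff hm hl N Z‖ ≤ 2 ^ n * (L * E) := by
    have h0 := sum_cutMatrix_eq_zero hm hl S ⟨i, hiS⟩ (fun _ : κ => obs) Z
      fun K => coeff N (formalExp (quadForm K))
    rw [← sub_zero (connectedCoeff hm hl N Z), ← h0, connectedCoeff, ← Finset.sum_sub_distrib]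
    simp only [← mul_sub]
    refine hsum _ _ fun J => ?_
    exact (hL _ _ (hKD J) (hcut J)).trans (mul_le_mul_of_nonneg_left (hdiff J) hL0)
  have hcmp : (1 + r i) ^ M ≤ ((1 + R₀) * (n + 1)) ^ M * (1 + δ) ^ M := by
    rw [← mul_pow]
    have := hr0 i
    refine pow_le_pow_left₀ (by linarith) ?_ M
    rw [hδi]
    have hn0 : (0 : ℝ) ≤ n := Nat.cast_nonneg n
    nlinarith [mul_nonneg hR₀ hn0, mul_nonneg hR₀ hδ0.le, mul_nonneg hn0 hδ0.le,
      mul_nonneg (mul_nonneg hR₀ hn0) hδ0.le]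
  calc ‖connectedCoeff hm hl N Z‖ * (1 + r i) ^ M
      ≤ 2 ^ n * (L * E) * (((1 + R₀) * (n + 1)) ^ M * (1 + δ) ^ M) := by gcongr
    _ = C₂ * (((1 + δ) ^ M)⁻¹ * (1 + δ) ^ M) := by rw [hC₂, hE]; ring
    _ = C₂ := by rw [inv_mul_cancel₀ (by positivity), mul_one]
    _ ≤ _ := by linarith [mul_nonneg hC₁0 (zero_le_one.trans hpow)]

/-- Decay of order 4 · card ι in the farthest vertex dominates the product of fourth powers over all
vertices, and each factor is integrable over ℝ³. -/
theorem exists_connectedCoeff_prod_bound (N : ι ⊕ κ →₀ ℕ) (T : ℝ) {R₀ : ℝ} (hR₀ : 0 ≤ R₀) :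
    ∃ C, 0 ≤ C ∧ ∀ Z : ι ⊕ κ → Spacetime, (∀ v, |(Z v).1| ≤ T) →
      (∀ j, ‖(Z (.inr j)).2‖ ≤ R₀) →
        ‖connectedCoeff hm hl N Z‖ ≤ C * ∏ i, ((1 + ‖(Z (.inl i)).2‖) ^ 4)⁻¹ := by
  obtain ⟨C, hC, h⟩ := exists_connectedCoeff_bound hm hl N T hR₀ (4 * Fintype.card ι)
  refine ⟨C, hC, fun Z hT hZ => ?_⟩
  obtain ⟨h0, h1⟩ := h Z hT hZ
  rcases isEmpty_or_nonempty ι with hι | hι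
  · simpa using h0
  · obtain ⟨i, -, hi⟩ := Finset.exists_max_image Finset.univ (fun i => ‖(Z (.inl i)).2‖)
      Finset.univ_nonempty
    refine (h1 i).trans (mul_le_mul_of_nonneg_left ?_ hC)
    rw [Finset.prod_inv_distrib, pow_mul]
    refine inv_anti₀ (Finset.prod_pos fun j _ => by positivity) ?_
    refine (Finset.prod_le_prod (fun j _ => by positivity) fun j hj =>
      (?_ : _ ≤ (1 + ‖(Z (.inl i)).2‖) ^ 4)).trans (le_of_eq (by simp))
    have := hi j hj
    gcongr

/-! ### Integrable majorant and passage to the limit -/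

omit [DecidableEq ι] in
theorem integrable_tensor {a : (ι → Spacetime) → ℝ} {b : (κ → Spacetime) → ℝ} (ha : Integrable a)
    (hb : Integrable b) :
    Integrable fun Z : ι ⊕ κ → Spacetime => a (Z ∘ Sum.inl) * b (Z ∘ Sum.inr) := by
  have hmp := volume_measurePreserving_sumPiEquivProdPi (fun _ : ι ⊕ κ => Spacetime)
  exact (hmp.integrable_comp_emb (MeasurableEquiv.measurableEmbedding _)
    (g := fun p : (ι → Spacetime) × (κ → Spacetime) => a p.1 * b p.2)).2 (ha.mul_prod hb)

theorem vacuum_sum_vertexObsFunctional (n : ℕ) {g : Spacetime → ℝ} (hg : Continuous g)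
    (hgc : HasCompactSupport g) (N : κ →₀ ℕ) {f : (κ → Spacetime) → ℂ} (hf : Continuous f)
    (hfc : HasCompactSupport f) :
    vacuum (∑ J : Finset ι, (-1 : ℂ) ^ J.card •
      vertexObsFunctional hm hl n g (subsetKind J) N f) =
      ∫ Z, tensorFun (prodWeight ι (vertexWeight n g)) f Z *
        connectedCoeff hm hl ((constDegree ι n).sumElim N) Z := by
  have h0 : ∀ Z : ι ⊕ κ → Spacetime, fieldValues (0 : FieldConfig) Z = 0 := fun Z => by
    ext i; simp [fieldValues]
  simp only [vacuum, Finset.sum_apply, Pi.smul_apply, smul_eq_mul, vertexObsFunctional,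
    graphFunctional, kernelFunctional, h0, linForm_zero, formalExp_zero, mul_one,
    ← integral_const_mul]
  rw [← integral_finsetSum]
  · congr 1; ext Z
    rw [connectedCoeff, Finset.mul_sum]
    exact Finset.sum_congr rfl fun J _ => by ring
  · intro J _
    exact (integrable_mul_of_compactSupport (continuous_tensorFun
      (continuous_prodWeight (continuous_vertexWeight n hg)) hf)
      (hasCompactSupport_tensorFun (hasCompactSupport_prodWeight
        (hasCompactSupport_vertexWeight n hgc)) hfc)
      (coeffContinuous_graphSeries hm hl _ _)).const_mul _

theorem continuous_cutoff {χ : ℝ → ℝ} (hχ : Continuous χ) {h : Space → ℝ} (hh : Continuous h) :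
    Continuous fun x : Spacetime => χ x.1 * h x.2 := by fun_prop

theorem hasCompactSupport_cutoff {χ : ℝ → ℝ} (hχ : HasCompactSupport χ) {h : Space → ℝ}
    (hh : HasCompactSupport h) : HasCompactSupport fun x : Spacetime => χ x.1 * h x.2 := by
  refine HasCompactSupport.intro (hχ.isCompact.prod hh.isCompact) fun x hx => ?_
  by_contra hne
  exact hx ⟨subset_tsupport _ (left_ne_zero_of_mul hne),
    subset_tsupport _ (right_ne_zero_of_mul hne)⟩

/-- The limit `h → 1` of the signed sum over graphs exists. -/
theorem tendsto_integral_connectedCoeff (n : ℕ) {χ : ℝ → ℝ} (hχ : Continuous χ)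
    (hχc : HasCompactSupport χ) (N : ι ⊕ κ →₀ ℕ) {f : (κ → Spacetime) → ℂ} (hf : Continuous f)
    (hfc : HasCompactSupport f) {h : ℕ → Space → ℝ} (hh : ∀ j, Continuous (h j))
    {B : ℝ} (hB : ∀ j x, |h j x| ≤ B) (hlim : ∀ x, Tendsto (fun j => h j x) atTop (𝓝 1)) :
    Tendsto (fun j => ∫ Z, tensorFun
        (prodWeight ι (vertexWeight n fun x : Spacetime => χ x.1 * h j x.2)) f Z *
        connectedCoeff hm hl N Z) atTop
      (𝓝 (∫ Z, tensorFun (prodWeight ι (vertexWeight n fun x : Spacetime => χ x.1)) f Z *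
        connectedCoeff hm hl N Z)) := by
  obtain ⟨T₁, hT₁⟩ : ∃ T, ∀ t, χ t ≠ 0 → |t| ≤ T := by
    obtain ⟨T, hT⟩ := hχc.isCompact.isBounded.exists_norm_le
    exact ⟨T, fun t ht => hT t (subset_tsupport _ ht)⟩
  obtain ⟨T₂, hT₂⟩ : ∃ T, ∀ Y, f Y ≠ 0 → ‖Y‖ ≤ T := by
    obtain ⟨T, hT⟩ := hfc.isCompact.isBounded.exists_norm_le
    exact ⟨T, fun t ht => hT t (subset_tsupport _ ht)⟩
  obtain ⟨C, hC, hbd⟩ := exists_connectedCoeff_prod_bound hm hl N (max T₁ T₂)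
    (le_max_left 0 T₂)
  -- The majorant factorizes over vertices: χ gives integrability in time, the cluster bound in
  -- space, and B bounds every h j.
  let a : Spacetime → ℝ := fun x => ((n.factorial : ℝ) * B * |χ x.1|) * ((1 + ‖x.2‖) ^ 4)⁻¹
  have ha : Integrable a := by
    have h1 : Integrable fun t : ℝ => (n.factorial : ℝ) * B * |χ t| :=
      ((hχ.integrable_of_hasCompactSupport hχc).abs).const_mul _
    exact h1.mul_prod integrable_one_add_norm_pow_inv
  have hbound : Integrable fun Z : ι ⊕ κ → Spacetime =>
      (∏ i, a ((Z ∘ Sum.inl) i)) * (C * ‖f (Z ∘ Sum.inr)‖) :=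
    integrable_tensor (Integrable.fintype_prod fun _ => ha)
      ((hf.integrable_of_hasCompactSupport hfc).norm.const_mul C)
  have hB0 : 0 ≤ B := (abs_nonneg _).trans (hB 0 0)
  refine tendsto_integral_of_dominated_convergence _ (fun j => ?_) hbound (fun j => ?_) ?_
  · exact ((continuous_tensorFun (continuous_prodWeight (continuous_vertexWeight n
      (continuous_cutoff hχ (hh j)))) hf).mul
      (continuous_connectedCoeff hm hl N)).aestronglyMeasurable
  · refine Eventually.of_forall fun Z => ?_
    have hpos : ∀ i : ι, 0 ≤ a ((Z ∘ Sum.inl) i) := fun i => by positivity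
    have hrhs : 0 ≤ (∏ i, a ((Z ∘ Sum.inl) i)) * (C * ‖f (Z ∘ Sum.inr)‖) :=
      mul_nonneg (Finset.prod_nonneg fun i _ => hpos i) (by positivity)
    -- The cluster bound requires bounded times and observable points near the origin. Where this is
    -- not ensured by χ and f being nonzero, the integrand vanishes.
    by_cases hf0 : f (Z ∘ Sum.inr) = 0
    · simp [tensorFun, hf0]
    by_cases hχ0 : ∃ i : ι, χ (Z (.inl i)).1 = 0
    · obtain ⟨i, hi⟩ := hχ0
      have : prodWeight ι (vertexWeight n fun x : Spacetime => χ x.1 * h j x.2) (Z ∘ Sum.inl) = 0 :=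
        Finset.prod_eq_zero (Finset.mem_univ i) (by simp [vertexWeight, hi])
      simpa [tensorFun, this] using hrhs
    push Not at hχ0
    have hY := hT₂ _ hf0
    have hY' : ∀ i : κ, ‖Z (.inr i)‖ ≤ T₂ := fun i =>
      (norm_le_pi_norm (Z ∘ Sum.inr) i).trans hY
    have hW := hbd Z (by
      rintro (i | i)
      · exact (hT₁ _ (hχ0 i)).trans (le_max_left _ _)
      · exact ((norm_fst_le (Z (.inr i))).trans (hY' i)).trans (le_max_right _ _))
      fun i => ((norm_snd_le (Z (.inr i))).trans (hY' i)).trans (le_max_right _ _)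
    have hw : ‖prodWeight ι (vertexWeight n fun x : Spacetime => χ x.1 * h j x.2)
        (Z ∘ Sum.inl)‖ ≤ ∏ i : ι, ((n.factorial : ℝ) * B * |χ (Z (.inl i)).1|) := by
      rw [prodWeight, norm_prod]
      refine Finset.prod_le_prod (fun i _ => norm_nonneg _) fun i _ => ?_
      have := hB j (Z (.inl i)).2
      simp only [vertexWeight, Function.comp_apply, norm_mul, Complex.norm_natCast,
        Complex.norm_real, Real.norm_eq_abs]
      rw [mul_assoc, mul_comm B]
      gcongr
    have hprod : ∏ i, a ((Z ∘ Sum.inl) i) =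
        (∏ i : ι, ((n.factorial : ℝ) * B * |χ (Z (.inl i)).1|)) *
          ∏ i : ι, ((1 + ‖(Z (.inl i)).2‖) ^ 4)⁻¹ := Finset.prod_mul_distrib
    rw [hprod, norm_mul, tensorFun, norm_mul]
    calc _ ≤ ((∏ i : ι, ((n.factorial : ℝ) * B * |χ (Z (.inl i)).1|)) * ‖f (Z ∘ Sum.inr)‖) *
          (C * ∏ i, ((1 + ‖(Z (.inl i)).2‖) ^ 4)⁻¹) := by
          have : 0 ≤ ∏ i : ι, ((n.factorial : ℝ) * B * |χ (Z (.inl i)).1|) :=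
            Finset.prod_nonneg fun i _ => by positivity
          gcongr
      _ = _ := by ring
  · refine Eventually.of_forall fun Z => ?_
    refine Tendsto.mul_const _ (Tendsto.mul_const _ ?_)
    refine tendsto_finsetProd _ fun i _ => ?_
    simp only [vertexWeight, Complex.ofReal_mul]
    have h1 : Tendsto (fun j => ((h j (Z (.inl i)).2 : ℝ) : ℂ)) atTop (𝓝 1) := by
      simpa using! (Complex.continuous_ofReal.tendsto 1).comp (hlim (Z (.inl i)).2)
    simpa using! ((h1.const_mul ((χ (Z (.inl i)).1 : ℝ) : ℂ)).const_mul (n.factorial : ℂ))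

end Cluster

/-! ### Functionals on which the exponential products are linear -/

section Regular

theorem tensorPairing_add {n : ℕ} (u v w : C(Fin n → Spacetime, ℂ) →L[ℂ] ℂ)
    (K : C((Fin n → Spacetime) × (Fin n → Spacetime), ℂ)) :
    tensorPairing u (v + w) K = tensorPairing u v K + tensorPairing u w K := by
  unfold tensorPairing
  rw [← map_add]
  rfl

theorem tensorPairing_smul {n : ℕ} (u : C(Fin n → Spacetime, ℂ) →L[ℂ] ℂ) (c : ℂ)
    (v : C(Fin n → Spacetime, ℂ) →L[ℂ] ℂ)
    (K : C((Fin n → Spacetime) × (Fin n → Spacetime), ℂ)) :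
    tensorPairing u (c • v) K = c * tensorPairing u v K := by
  unfold tensorPairing
  rw [← smul_eq_mul, ← map_smul]
  rfl

/-- Functionals with finitely many nonzero functional derivatives, all of order zero and
differentiable along lines. -/
structure IsRegular (F : Functional) : Prop where
  exists_deriv : ∀ n φ, ∃ u, IsFunctionalDeriv F n φ u
  differentiableAt : ∀ n ψ φ ξ,
    DifferentiableAt ℝ (fun s : ℝ => iterDirDeriv n ψ F (φ + s • ξ)) 0
  exists_bound : ∃ R, ∀ n, R ≤ n → ∀ φ, functionalDeriv F n φ = 0

namespace IsRegular

variable {F G : Functional}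

theorem isFunctionalDeriv (hF : IsRegular F) (n : ℕ) (φ : FieldConfig) :
    IsFunctionalDeriv F n φ (functionalDeriv F n φ) := by
  obtain ⟨u, hu⟩ := hF.exists_deriv n φ
  rwa [functionalDeriv_eq hu]

theorem iterDirDeriv_add (hF : IsRegular F) (hG : IsRegular G) (n : ℕ)
    (ψ : Fin n → FieldConfig) :
    iterDirDeriv n ψ (F + G) = iterDirDeriv n ψ F + iterDirDeriv n ψ G := by
  induction n with
  | zero => rfl
  | succ n ih =>
    ext φ
    rw [iterDirDeriv, ih]
    exact deriv_fun_add (hF.differentiableAt n _ φ (ψ 0)) (hG.differentiableAt n _ φ (ψ 0))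

theorem iterDirDeriv_smul (hF : IsRegular F) (c : ℂ) (n : ℕ) (ψ : Fin n → FieldConfig) :
    iterDirDeriv n ψ (c • F) = c • iterDirDeriv n ψ F := by
  induction n with
  | zero => rfl
  | succ n ih =>
    ext φ
    rw [iterDirDeriv, ih]
    exact deriv_const_mul c (hF.differentiableAt n _ φ (ψ 0))

theorem functionalDeriv_add (hF : IsRegular F) (hG : IsRegular G) (n : ℕ) (φ : FieldConfig) :
    IsFunctionalDeriv (F + G) n φ (functionalDeriv F n φ + functionalDeriv G n φ) := fun ψ => by
  rw [hF.iterDirDeriv_add hG, add_apply, hF.isFunctionalDeriv, hG.isFunctionalDeriv]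
  rfl

theorem functionalDeriv_smul (hF : IsRegular F) (c : ℂ) (n : ℕ) (φ : FieldConfig) :
    IsFunctionalDeriv (c • F) n φ (c • functionalDeriv F n φ) := fun ψ => by
  rw [hF.iterDirDeriv_smul, smul_apply, hF.isFunctionalDeriv]
  rfl

theorem add (hF : IsRegular F) (hG : IsRegular G) : IsRegular (F + G) where
  exists_deriv n φ := ⟨_, hF.functionalDeriv_add hG n φ⟩
  differentiableAt n ψ φ ξ := by
    rw [hF.iterDirDeriv_add hG]
    exact (hF.differentiableAt n ψ φ ξ).add (hG.differentiableAt n ψ φ ξ)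
  exists_bound := by
    obtain ⟨R, hR⟩ := hF.exists_bound
    obtain ⟨S, hS⟩ := hG.exists_bound
    refine ⟨max R S, fun n hn φ => ?_⟩
    rw [functionalDeriv_eq (hF.functionalDeriv_add hG n φ), hR n (le_of_max_le_left hn),
      hS n (le_of_max_le_right hn), add_zero]

theorem smul (hF : IsRegular F) (c : ℂ) : IsRegular (c • F) where
  exists_deriv n φ := ⟨_, hF.functionalDeriv_smul c n φ⟩
  differentiableAt n ψ φ ξ := by
    rw [hF.iterDirDeriv_smul]
    exact (hF.differentiableAt n ψ φ ξ).const_mul c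
  exists_bound := by
    obtain ⟨R, hR⟩ := hF.exists_bound
    refine ⟨R, fun n hn φ => ?_⟩
    rw [functionalDeriv_eq (hF.functionalDeriv_smul c n φ), hR n hn]
    exact ContinuousLinearMap.ext fun Ψ => mul_zero c

theorem summable_expProd (hG : IsRegular G) (H : C(Spacetime, ℂ)) (F : Functional)
    (φ : FieldConfig) : Summable fun n : ℕ => (1 / (n.factorial : ℂ)) *
      tensorPairing (functionalDeriv F n φ) (functionalDeriv G n φ) (kernelPower H n) := by
  obtain ⟨R, hR⟩ := hG.exists_bound
  refine summable_of_ne_finset_zero (s := Finset.range R) fun n hn => ?_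
  rw [hR n (by simpa using hn)]
  have : tensorPairing (functionalDeriv F n φ) 0 (kernelPower H n) =
    functionalDeriv F n φ 0 := rfl
  rw [this, map_zero, mul_zero]

/-- Regularity supplies what additivity requires of `deriv`, `functionalDeriv` and `tsum`:
differentiability, existence of the derivatives, and finitely many nonzero terms. The second factor
alone makes the sum finite, so `E` is arbitrary. -/
theorem expProd_add (hF : IsRegular F) (hG : IsRegular G) (H : C(Spacetime, ℂ))
    (E : Functional) : expProd H E (F + G) = expProd H E F + expProd H E G := by
  ext φ
  rw [Pi.add_apply, expProd, expProd, expProd,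
    ← (hF.summable_expProd H E φ).tsum_add (hG.summable_expProd H E φ)]
  refine tsum_congr fun n => ?_
  rw [functionalDeriv_eq (hF.functionalDeriv_add hG n φ), ← mul_add]
  congr 1
  exact tensorPairing_add _ _ _ _

theorem expProd_smul (hF : IsRegular F) (c : ℂ) (H : C(Spacetime, ℂ)) (E : Functional) :
    expProd H E (c • F) = c • expProd H E F := by
  ext φ
  rw [Pi.smul_apply, smul_eq_mul, expProd, expProd, ← tsum_mul_left]
  refine tsum_congr fun n => ?_
  rw [functionalDeriv_eq (hF.functionalDeriv_smul c n φ), mul_left_comm]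
  congr 1
  exact tensorPairing_smul _ _ _ _

end IsRegular

variable {ι : Type} [Fintype ι] {N : ι →₀ ℕ} {f : (ι → Spacetime) → ℂ}
  {Q : (ι → Spacetime) → MvPowerSeries ι ℂ}

/-- The n variables contributed by the derivatives raise the order of the series to at least n. -/
theorem derivCoeff_eq_zero_of_degree_lt (φ : FieldConfig) {n : ℕ} (hn : N.degree < n)
    (i : Fin n → ι) (X : ι → Spacetime) : derivCoeff N Q φ i X = 0 := by
  refine MvPowerSeries.coeff_of_lt_order (lt_of_lt_of_le (b := (n : ℕ∞)) (by exact_mod_cast hn) ?_)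
  refine le_trans ?_ (MvPowerSeries.le_order_mul)
  refine le_trans ?_ le_add_self
  refine le_trans ?_ (MvPowerSeries.le_order_prod _ _)
  have h1 : ∀ s : Fin n, (1 : ℕ∞) ≤ (MvPowerSeries.X (i s) : MvPowerSeries ι ℂ).order := fun s => by
    rw [← Nat.cast_one]
    refine MvPowerSeries.nat_le_order fun d hd => ?_
    rw [Nat.lt_one_iff, Finsupp.degree_eq_zero_iff] at hd
    simp [hd]
  exact (by simp : (n : ℕ∞) = ∑ _s : Fin n, 1).le.trans (Finset.sum_le_sum fun s _ => h1 s)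

theorem isRegular_kernelFunctional (N : ι →₀ ℕ) (hf : Continuous f) (hfc : HasCompactSupport f)
    (hQ : CoeffContinuous Q) : IsRegular (kernelFunctional N f Q) where
  exists_deriv n φ := ⟨_, isFunctionalDeriv_kernelDeriv hf hfc hQ n φ⟩
  differentiableAt n ψ φ ξ := by
    rw [iterDirDeriv_kernelFunctional hf hfc hQ]
    exact (hasDerivAt_kernelFunctional hf hfc
      (coeffContinuous_mul_prod_linForm hQ ψ) φ ξ).differentiableAt
  exists_bound := by
    refine ⟨N.degree + 1, fun n hn φ => ?_⟩
    rw [functionalDeriv_kernelFunctional hf hfc hQ]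
    ext Ψ
    change ∫ X, f X * ∑ i : Fin n → ι, derivCoeff N Q φ i X * Ψ (fun s => X (i s)) = 0
    simp [derivCoeff_eq_zero_of_degree_lt (Q := Q) φ hn]


variable {m l : ℝ} (hm : 0 < m) (hl : 0 < l) {A B V : Functional}

/-- The observable enters both products only through the second factor, so linearity on that side
suffices. -/
theorem bogoliubov_add (hA : IsRegular A) (hB : IsRegular B)
    (hVA : ∀ j, IsRegular (timeProd hm hl (sMatrix hm hl V j) A))
    (hVB : ∀ j, IsRegular (timeProd hm hl (sMatrix hm hl V j) B)) (k : ℕ) :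
    bogoliubov hm hl V (A + B) k = bogoliubov hm hl V A k + bogoliubov hm hl V B k := by
  simp only [bogoliubov, ← Finset.sum_add_distrib]
  refine Finset.sum_congr rfl fun j _ => ?_
  rw [timeProd, hA.expProd_add hB]
  exact (hVA j).expProd_add (hVB j) _ _

theorem bogoliubov_smul (hA : IsRegular A)
    (hVA : ∀ j, IsRegular (timeProd hm hl (sMatrix hm hl V j) A)) (c : ℂ) (k : ℕ) :
    bogoliubov hm hl V (c • A) k = c • bogoliubov hm hl V A k := by
  simp only [bogoliubov, Finset.smul_sum]
  refine Finset.sum_congr rfl fun j _ => ?_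
  rw [timeProd, hA.expProd_smul]
  exact (hVA j).expProd_smul c _ _

end Regular

/-! ### The adiabatic limit on observables -/

section AdiabaticLimit

open VertexKind

variable {m l : ℝ} (hm : 0 < m) (hl : 0 < l)

theorem isRegular_graphFunctional {ι : Type} [Fintype ι] (a : ι → VertexKind) (N : ι →₀ ℕ)
    {f : (ι → Spacetime) → ℂ} (hf : Continuous f) (hfc : HasCompactSupport f) :
    IsRegular (graphFunctional hm hl a N f) :=
  isRegular_kernelFunctional N hf hfc (coeffContinuous_graphSeries hm hl a)

/-- The functionals `A` with an adiabatic limit of `ω(R_V(A)^{[k]})` on which `R_V` is linear. -/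
structure HasAdiabaticLimit (n : ℕ) (χ : ℝ → ℝ) (k : ℕ) (A : Functional) : Prop where
  isRegular : IsRegular A
  isRegular_timeProd : ∀ g : Spacetime → ℝ, Continuous g → HasCompactSupport g → ∀ j,
    IsRegular (timeProd hm hl (sMatrix hm hl (interaction n g) j) A)
  exists_limit : ∃ L : ℂ, ∀ h : ℕ → Space → ℝ,
    (∀ j, Continuous (h j) ∧ HasCompactSupport (h j)) → (∃ C : ℝ, ∀ j x, |h j x| ≤ C) →
    (∀ x, Tendsto (fun j => h j x) atTop (𝓝 1)) →
    Tendsto (fun j => vacuum (bogoliubov hm hl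
      (interaction n (fun x => χ x.1 * h j x.2)) A k)) atTop (𝓝 L)

variable {n : ℕ} {χ : ℝ → ℝ} {k : ℕ} {A B : Functional}

theorem hasAdiabaticLimit_multilocal (hχ : Continuous χ) (hχc : HasCompactSupport χ) {ℓ : ℕ}
    {f : (Fin ℓ → Spacetime) → ℂ} (hf : Continuous f) (hfc : HasCompactSupport f)
    (N : Fin ℓ → ℕ) : HasAdiabaticLimit hm hl n χ k (multilocal f N) := by
  rw [multilocal_eq_graphFunctional hm hl]
  have hf' : Continuous ((∏ i, ((N i).factorial : ℂ)) • f) := hf.const_smul _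
  have hfc' : HasCompactSupport ((∏ i, ((N i).factorial : ℂ)) • f) := hfc.smul_left
  generalize (∏ i, ((N i).factorial : ℂ)) • f = f' at hf' hfc'
  refine ⟨isRegular_graphFunctional hm hl _ _ hf' hfc', fun g hg hgc j => ?_, ?_⟩
  · rw [timeProd_sMatrix_graphFunctional hm hl n _ hg hgc hf' hfc']
    exact (isRegular_graphFunctional hm hl _ _ (continuous_tensorFun
      (continuous_prodWeight (continuous_vertexWeight n hg)) hf')
      (hasCompactSupport_tensorFun (hasCompactSupport_prodWeight
        (hasCompactSupport_vertexWeight n hgc)) hfc')).smul _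
  · refine ⟨((-Complex.I) ^ k / (k.factorial : ℂ)) * ∫ Z, tensorFun
        (prodWeight (Fin k) (vertexWeight n fun x : Spacetime => χ x.1)) f' Z *
        connectedCoeff hm hl ((constDegree (Fin k) n).sumElim
          (Finsupp.equivFunOnFinite.symm N)) Z, fun h hh ⟨C, hC⟩ hlim => ?_⟩
    have hval : ∀ j, vacuum (bogoliubov hm hl (interaction n fun x => χ x.1 * h j x.2)
        (graphFunctional hm hl (fun _ => obs) (Finsupp.equivFunOnFinite.symm N) f') k) =
        ((-Complex.I) ^ k / (k.factorial : ℂ)) * ∫ Z, tensorFun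
          (prodWeight (Fin k) (vertexWeight n fun x : Spacetime => χ x.1 * h j x.2)) f' Z *
          connectedCoeff hm hl ((constDegree (Fin k) n).sumElim
            (Finsupp.equivFunOnFinite.symm N)) Z := by
      intro j
      have hg := continuous_cutoff hχ (hh j).1
      have hgc := hasCompactSupport_cutoff hχc (hh j).2
      rw [bogoliubov_graphFunctional hm hl n _ hg hgc hf' hfc',
        ← vacuum_sum_vertexObsFunctional hm hl n hg hgc _ hf' hfc']
      rfl
    simp only [hval]
    exact (tendsto_integral_connectedCoeff hm hl n hχ hχc _ hf' hfc' (fun j => (hh j).1) hC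
      hlim).const_mul _

theorem HasAdiabaticLimit.add (hχ : Continuous χ) (hχc : HasCompactSupport χ)
    (hA : HasAdiabaticLimit hm hl n χ k A) (hB : HasAdiabaticLimit hm hl n χ k B) :
    HasAdiabaticLimit hm hl n χ k (A + B) := by
  refine ⟨hA.1.add hB.1, fun g hg hgc j => ?_, ?_⟩
  · rw [timeProd, hA.1.expProd_add hB.1]
    exact (hA.2 g hg hgc j).add (hB.2 g hg hgc j)
  · obtain ⟨L, hL⟩ := hA.3
    obtain ⟨L', hL'⟩ := hB.3
    refine ⟨L + L', fun h hh hC hlim => ((hL h hh hC hlim).add (hL' h hh hC hlim)).congr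
      fun j => ?_⟩
    have hg := continuous_cutoff hχ (hh j).1
    have hgc := hasCompactSupport_cutoff hχc (hh j).2
    rw [bogoliubov_add hm hl hA.1 hB.1 (hA.2 _ hg hgc) (hB.2 _ hg hgc)]
    rfl

theorem HasAdiabaticLimit.smul (hχ : Continuous χ) (hχc : HasCompactSupport χ) (c : ℂ)
    (hA : HasAdiabaticLimit hm hl n χ k A) : HasAdiabaticLimit hm hl n χ k (c • A) := by
  refine ⟨hA.1.smul c, fun g hg hgc j => ?_, ?_⟩
  · rw [timeProd, hA.1.expProd_smul]
    exact (hA.2 g hg hgc j).smul c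
  · obtain ⟨L, hL⟩ := hA.3
    refine ⟨c * L, fun h hh hC hlim => ((hL h hh hC hlim).const_mul c).congr fun j => ?_⟩
    have hg := continuous_cutoff hχ (hh j).1
    have hgc := hasCompactSupport_cutoff hχc (hh j).2
    rw [bogoliubov_smul hm hl hA.1 (hA.2 _ hg hgc)]
    rfl

theorem hasAdiabaticLimit_of_mem_observables (hχ : Continuous χ) (hχc : HasCompactSupport χ)
    {O : Set Spacetime} (hA : A ∈ observables O) : HasAdiabaticLimit hm hl n χ k A := by
  refine Submodule.span_induction ?_ ?_ (fun A B _ _ hA hB => hA.add hm hl hχ hχc hB)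
    (fun c A _ hA => hA.smul hm hl hχ hχc c) hA
  · rintro _ ⟨ℓ, f, N, -, hf, hfc, -, rfl⟩
    exact hasAdiabaticLimit_multilocal hm hl hχ hχc hf hfc N
  -- The zero functional is obtained as 0 times a multilocal functional on no points.
  · have h := (hasAdiabaticLimit_multilocal hm hl (n := n) (k := k) hχ hχc (ℓ := 0)
      (f := 0) continuous_const HasCompactSupport.zero 0).smul hm hl hχ hχc 0
    rwa [zero_smul] at h

end AdiabaticLimit

end QST

end

/-! ### The adiabatic limit for smooth cutoffs -/

theorem mainTheorem2 (m l ε : ℝ) (hm : 0 < m) (hl : 0 < l) (hε : 0 < ε) (n : ℕ)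
    (χ : ℝ → ℝ) (hχ : ContDiff ℝ ∞ χ) (hχ_one : ∀ t ∈ Set.Ioo (-ε) ε, χ t = 1)
    (hχ_supp : Function.support χ ⊆ Set.Ioo (-(2 * ε)) (2 * ε))
    (O : Set Spacetime) (hO : IsOpen O) (hO_bdd : Bornology.IsBounded O) (hO_sub : O ⊆ timeSlab ε)
    (A : Functional) (hA : A ∈ observables O) (k : ℕ) :
    ∃ L : ℂ, ∀ h : ℕ → Space → ℝ,
      (∀ j, ContDiff ℝ ∞ (h j) ∧ HasCompactSupport (h j)) →
      (∃ C : ℝ, ∀ j x, |h j x| ≤ C) →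
      (∀ x, Tendsto (fun j => h j x) atTop (𝓝 1)) →
      Tendsto (fun j => vacuum (bogoliubov hm hl
        (interaction n (fun x => χ x.1 * h j x.2)) A k)) atTop (𝓝 L) := by
  have hχc : HasCompactSupport χ := HasCompactSupport.intro (isCompact_Icc (a := -(2 * ε))
    (b := 2 * ε)) fun t ht => by
      by_contra hne
      exact ht (Set.Ioo_subset_Icc_self (hχ_supp hne))
  obtain ⟨L, hL⟩ :=
    (hasAdiabaticLimit_of_mem_observables (n := n) (k := k) hm hl hχ.continuous hχc hA).exists_limit
  exact ⟨L, fun h hh => hL h fun j => ⟨(hh j).1.continuous, (hh j).2⟩⟩
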